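/- Let $\Phi$ be a strictly plurisubharmonic real quadratic form on $\mathbf{C}^n$, and for a $C^1$ weight $\varphi:\mathbf{C}^n\to\mathbf{R}$ put $\Lambda_\varphi=\{(x,\tfrac{2}{i}\tfrac{\partial\varphi}{\partial x}(x));\ x\in\mathbf{C}^n\}\subset\mathbf{C}^{2n}$ and, for $0<h\le 1$, $H_\varphi(\mathbf{C}^n)=\mathrm{Hol}(\mathbf{C}^n)\cap L^2(\mathbf{C}^n,e^{-2\varphi/h}L(dx))$, with the norm and scalar product of $L^2(\mathbf{C}^n,e^{-2\varphi/h}L(dx))$, where $L(dx)$ is Lebesgue measure. Let $W\subset\mathbf{C}^{2n}$ be a bounded open neighbourhood of $0$. Then there is $\varepsilon>0$, depending only on $\Phi$ and $W$, such that the following holds for every bounded holomorphic function $a$ on $\Lambda_\Phi+W$. For every $h\in(0,1]$ there is a unique bounded linear operator $\mathrm{Op}_h^w(a):H_\Phi(\mathbf{C}^n)\to H_\Phi(\mathbf{C}^n)$ given by $$\mathrm{Op}_h^w(a)u(x)=\frac{1}{(2\pi h)^n}\iint_{\Gamma(x)}e^{\frac{i}{h}(x-y)\cdot\theta}\,a\Big(\frac{x+y}{2},\theta\Big)u(y)\,dy\wedge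 d\theta,\qquad \Gamma(x):\ \theta=\frac{2}{i}\frac{\partial\Phi}{\partial x}\Big(\frac{x+y}{2}\Big),$$ for all $u\in\mathrm{Hol}(\mathbf{C}^n)$ such that $u=\mathcal{O}_{h,N}(1)\langle x\rangle^{-N}e^{\Phi(x)/h}$ for every $N\ge0$; here $\Gamma(x)$ is parametrized by $y\in\mathbf{C}^n$ and oriented so that $i^{-n}\,dy\wedge d\bar y=2^nL(dy)$. Moreover, there is a constant $K$, depending only on $\Phi$, $W$, $a$ and $\varepsilon$, such that for every compactly supported $f\in C^{1,1}(\mathbf{C}^n;\mathbf{R})$ with $\|\nabla f\|_{L^\infty}\le\varepsilon$ and $\|\nabla^2 f\|_{L^\infty}\le\varepsilon$, the weight $\widetilde\Phi=\Phi+f$ satisfies $\Lambda_{\widetilde\Phi}\subset\Lambda_\Phi+W$ and, for all $h\in(0,1]$, $H_{\widetilde\Phi}(\mathbf{C}^n)=H_\Phi(\mathbf{C}^n)$ as linear spaces, and $$\Big|\big(\mathrm{Op}_h^w(a)u,v\big)_{H_{\widetilde\Phi}}-\int a\Big(x,\frac{2}{i}\frac{\partial\widetilde\Phi}{\partial x}(x)\Big)u(x)\overline{v(x)}\,e^{-2\widetilde\Phi(x)/h}\,L(dx)\Big|\le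 K\,h\,\|u\|_{H_{\widetilde\Phi}}\|v\|_{H_{\widetilde\Phi}},\qquad u,v\in H_{\widetilde\Phi}(\mathbf{C}^n).$$ -/

import Mathlib

open MeasureTheory
open scoped NNReal Pointwise ComplexConjugate

noncomputable section

namespace FBI

/-- `ℂⁿ`; its `volume` is the Lebesgue measure `L(dx)`. -/
abbrev Cn (n : ℕ) : Type := Fin n → ℂ

variable {n : ℕ}

/-- The holomorphic gradient `∂g/∂x`, with `∂/∂x_j = (∂/∂Re x_j - i ∂/∂Im x_j) / 2`. -/
def dz (g : Cn n → ℂ) (x : Cn n) : Cn n := fun j =>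
  (1 / 2 : ℂ) * (fderiv ℝ g x (Pi.single j 1) - Complex.I * fderiv ℝ g x (Pi.single j Complex.I))

/-- The antiholomorphic gradient `∂g/∂x̄`, with `∂/∂x̄_j = (∂/∂Re x_j + i ∂/∂Im x_j) / 2`. -/
def dzbar (g : Cn n → ℂ) (x : Cn n) : Cn n := fun j =>
  (1 / 2 : ℂ) * (fderiv ℝ g x (Pi.single j 1) + Complex.I * fderiv ℝ g x (Pi.single j Complex.I))

/-- Strict plurisubharmonicity of a quadratic form: the Levi form
`∑ (∂²Φ/∂x_j∂x̄_k) t_j conj(t_k)` is positive definite (its values are real). -/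
def StrictlyPlurisubharmonic (Φ : QuadraticForm ℝ (Cn n)) : Prop :=
  ∀ x t : Cn n, t ≠ 0 →
    0 < (∑ j, ∑ k, dzbar (fun z => dz (fun w => (Φ w : ℂ)) z j) x k * t j * conj (t k)).re

/-- `ξ(x) = (2/i) ∂φ/∂x (x)` for a real weight `φ`. -/
def xi (φ : Cn n → ℝ) (x : Cn n) : Cn n :=
  (2 / Complex.I) • dz (fun z => (φ z : ℂ)) x

/-- The manifold `Λ_φ = {(x, (2/i) ∂φ/∂x (x))} ⊆ ℂⁿ × ℂⁿ`. -/
def Lam (φ : Cn n → ℝ) : Set (Cn n × Cn n) := Set.range fun x => (x, xi φ x)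

/-- The measure `e^{-2φ/h} L(dx)` on `ℂⁿ`. -/
def wMeasure (φ : Cn n → ℝ) (h : ℝ) : Measure (Cn n) :=
  volume.withDensity fun x => ENNReal.ofReal (Real.exp (-2 * φ x / h))

/-- `H_φ(ℂⁿ) = Hol(ℂⁿ) ∩ L²(ℂⁿ, e^{-2φ/h} L(dx))`. -/
def HSpace (φ : Cn n → ℝ) (h : ℝ) : Submodule ℂ (Cn n → ℂ) where
  carrier := {u | Differentiable ℂ u ∧ MemLp u 2 (wMeasure φ h)}
  add_mem' hu hv := ⟨hu.1.add hv.1, hu.2.add hv.2⟩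
  zero_mem' := ⟨differentiable_const (0 : ℂ), MemLp.zero⟩
  smul_mem' c _ hu := ⟨hu.1.const_smul c, hu.2.const_smul c⟩

/-- The scalar product `(u, v)_{H_φ} = ∫ u conj(v) e^{-2φ/h} L(dx)`. -/
def wInner (φ : Cn n → ℝ) (h : ℝ) (u v : Cn n → ℂ) : ℂ :=
  ∫ x, u x * conj (v x) ∂(wMeasure φ h)

/-- The norm `‖u‖_{H_φ}`. -/
def wNorm (φ : Cn n → ℝ) (h : ℝ) (u : Cn n → ℂ) : ℝ :=
  Real.sqrt (∫ x, ‖u x‖ ^ 2 ∂(wMeasure φ h))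

/-- `∫∫_Γ F(y, θ) dy ∧ dθ` over the contour `Γ = {(y, θ(y)); y ∈ ℂⁿ}`. The pull-back of `dy ∧ dθ`
is `det(∂θ/∂ȳ) dy ∧ dȳ`, and the orientation is the one for which
`i^{-n} dy ∧ dȳ = 2ⁿ L(dy)`. -/
def contourIntegral (θ : Cn n → Cn n) (F : Cn n → Cn n → ℂ) : ℂ :=
  ∫ y, F y (θ y) * ((2 * Complex.I) ^ n *
    (Matrix.of fun j k => dzbar (fun z => θ z j) y k).det)

/-- The Weyl quantization as a contour integral,
`(2πh)^{-n} ∫∫_{Γ(x)} e^{i(x-y)·θ/h} a((x+y)/2, θ) u(y) dy ∧ dθ`, where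
`Γ(x)` is given by `θ = (2/i) ∂Φ/∂x ((x+y)/2)`. -/
def weylIntegral (Φ : Cn n → ℝ) (h : ℝ) (a : Cn n × Cn n → ℂ) (u : Cn n → ℂ) (x : Cn n) : ℂ :=
  1 / (2 * (Real.pi : ℂ) * (h : ℂ)) ^ n *
    contourIntegral (fun y => xi Φ ((1 / 2 : ℂ) • (x + y))) fun y θ =>
      Complex.exp (Complex.I / h * ∑ j, (x j - y j) * θ j) * a ((1 / 2 : ℂ) • (x + y), θ) * u y

/-- `u = O_{h,N}(1) ⟨x⟩^{-N} e^{Φ(x)/h}` for every `N`. -/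
def RapidDecay (Φ : Cn n → ℝ) (h : ℝ) (u : Cn n → ℂ) : Prop :=
  ∀ N : ℕ, ∃ C : ℝ, ∀ x, (1 + ‖x‖) ^ N * ‖u x‖ ≤ C * Real.exp (Φ x / h)

/-- `T` is the operator `Op_h^w(a)` on `H_Φ(ℂⁿ)`: a bounded linear operator that is given by the
contour integral on the holomorphic functions which decay rapidly relative to `e^{Φ/h}`. -/
def IsWeylQuantization (Φ : Cn n → ℝ) (h : ℝ) (a : Cn n × Cn n → ℂ)
    (T : HSpace Φ h →ₗ[ℂ] HSpace Φ h) : Prop :=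
  (∃ M : ℝ, ∀ u : HSpace Φ h, wNorm Φ h (T u : Cn n → ℂ) ≤ M * wNorm Φ h (u : Cn n → ℂ)) ∧
  ∀ u : HSpace Φ h, RapidDecay Φ h (u : Cn n → ℂ) →
    ∀ x, (T u : Cn n → ℂ) x = weylIntegral Φ h a (u : Cn n → ℂ) x

end FBI

end

open MeasureTheory
open scoped NNReal Pointwise ComplexConjugate

noncomputable section

namespace FBI

variable {n : ℕ}

/-! Write Φ(x) = ½ Re S(x,x) + ½ H(x,x) with S symmetric complex bilinear and H Hermitian; H is
twice the Levi form, hence positive definite. Functions of H_Φ are reproduced by the kernel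
e^{`repExp`/h}, whose modulus is e^{(Φ(y)-Φ(w)-½H(y-w,y-w))/h} when η = 0. The kernel may be twisted
by e^{i(y-w)·η/h} for any η: this factor is holomorphic in w and equals 1 on the diagonal
(`rep_formula`). Inserting the twisted formula into the Weyl integral of a rapidly decaying u turns
Op(a) into an integral operator with kernel `ker`, and η may be chosen separately for each x.

As a is holomorphic and bounded on a tube around Λ_Φ, the contour in `ker` can be translated along
the fibres (`ker_eq_shift`). A shift by η + i l·`hvec`(x-w) produces a factor e^{-c·gain/h}, where
the gain is quadratic in |x-w| near the diagonal and linear far away (`exists_norm_ker_le`). For η =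
(2/i)∂f/∂x(x) the twist has modulus e^{df_x(x-w)/h}. What remains of the change of weight is the
Taylor remainder of f, which is at most ε times a constant times the gain (`taylor_le_gain`). Thus,
seen in the weight Φ+f, the kernel is dominated by a convolution kernel of width √h and bounded
mass, and Young's inequality gives bounds uniform in f and h (`exists_norm_ker_mul_le`).

For the comparison with multiplication, expand a to first order at p(x) = (x, ξ(x)) ∈ Λ_{Φ+f}. The
constant term is multiplication by a(p(x)). The linear term is computed exactly (`ker_affine`) and
is a first order operator built from `jet`; since v̄ is antiholomorphic, jet_j u · v̄ e^{-2(Φ+f)/h}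
= h ∂_{x_j}(u v̄ e^{-2(Φ+f)/h}). Integration by parts moves this derivative onto the Lipschitz
coefficient ∂_θ a(p(x)) and yields O(h) (`norm_integral_jet_le`). The remainder is quadratic, and a
squared distance at scale √h is again O(h) (`exists_main_estimate`).

Projections of compactly supported functions are rapidly decaying and dense in H_Φ
(`exists_rapidDecay_approx`). Density gives uniqueness of the operator and extends the estimate to
all u (`quantization_vs_multiplication`). -/

/-- A quadratic weight on `ℂⁿ`, given by the complex bilinear form `S` and the Hermitian Levi
form `H`. -/
structure Weight (n : ℕ) where
  S : Cn n →L[ℂ] Cn n →L[ℂ] ℂ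
  H : Cn n →L[ℂ] Cn n →L⋆[ℂ] ℂ
  symm : ∀ x y, S y x = S x y
  herm : ∀ x y, H y x = conj (H x y)
  pos : ∀ x, x ≠ 0 → 0 < (H x x).re

/-! ### Quadratic weights and the parametrization of Λ_Φ -/

namespace Weight
variable (P : Weight n)

/-- The quadratic form `½ Re S(x, x) + ½ H(x, x)`. -/
def phi (x : Cn n) : ℝ := (1 / 2) * (P.S x x).re + (1 / 2) * (P.H x x).re

/-- The vector representing the linear form `t ↦ S(x, t)`. -/
def svec (x : Cn n) : Cn n := fun j => P.S x (Pi.single j 1)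

/-- The vector representing the linear form `t ↦ H(t, x)`. -/
def hvec (x : Cn n) : Cn n := fun j => P.H (Pi.single j 1) x

/-- The fibre coordinate of `Λ_φ`. -/
def theta (x : Cn n) : Cn n := (-Complex.I) • (P.svec x + P.hvec x)

lemma single_eq (t : Cn n) : t = ∑ j, t j • (Pi.single j (1 : ℂ) : Cn n) := by
  simpa using pi_eq_sum_univ' t

lemma dot_svec (t x : Cn n) : ∑ j, t j * P.svec x j = P.S x t := by
  conv_rhs => rw [single_eq t]
  simp [svec]

lemma dot_hvec (t x : Cn n) : ∑ j, t j * P.hvec x j = P.H t x := by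
  conv_rhs => rw [single_eq t]
  simp [hvec]

lemma H_self_im (x : Cn n) : (P.H x x).im = 0 := by
  have := congrArg Complex.im (P.herm x x)
  simp at this; linarith

lemma H_self_eq (x : Cn n) : P.H x x = ((P.H x x).re : ℂ) := by
  apply Complex.ext <;> simp [P.H_self_im]

lemma H_self_nonneg (x : Cn n) : 0 ≤ (P.H x x).re := by
  by_cases hx : x = 0
  · simp [hx]
  · exact (P.pos x hx).le

lemma H_re_symm (x y : Cn n) : (P.H y x).re = (P.H x y).re := by
  rw [P.herm x y]; simp

lemma hvec_add (x y : Cn n) : P.hvec (x + y) = P.hvec x + P.hvec y := by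
  ext j; simp [hvec]

lemma svec_add (x y : Cn n) : P.svec (x + y) = P.svec x + P.svec y := by
  ext j; simp [svec]

lemma hvec_smul (c : ℂ) (x : Cn n) : P.hvec (c • x) = conj c • P.hvec x := by
  ext j; simp [hvec]

lemma svec_smul (c : ℂ) (x : Cn n) : P.svec (c • x) = c • P.svec x := by
  ext j; simp [svec]

lemma theta_add (x y : Cn n) : P.theta (x + y) = P.theta x + P.theta y := by
  simp only [theta, svec_add, hvec_add, smul_add]; abel

/-- `theta` as a real continuous linear map. -/
def thetaL : Cn n →L[ℝ] Cn n :=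
  LinearMap.toContinuousLinearMap
    { toFun := P.theta
      map_add' := P.theta_add
      map_smul' := fun c x => by
        have : (c • x : Cn n) = (c : ℂ) • x := by ext j; simp
        simp only [theta, this, svec_smul, hvec_smul, Complex.conj_ofReal, RingHom.id_apply]
        ext j
        simp
        ring }

@[simp] lemma thetaL_apply (x : Cn n) : P.thetaL x = P.theta x := rfl

/-- `hvec` as a real continuous linear map. -/
def hvecL : Cn n →L[ℝ] Cn n :=
  LinearMap.toContinuousLinearMap
    { toFun := P.hvec
      map_add' := P.hvec_add
      map_smul' := fun c x => by
        have : (c • x : Cn n) = (c : ℂ) • x := by ext j; simp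
        rw [this, hvec_smul, Complex.conj_ofReal]
        ext j
        simp }

@[simp] lemma hvecL_apply (x : Cn n) : P.hvecL x = P.hvec x := rfl

lemma hvec_injective : Function.Injective P.hvecL := by
  rw [injective_iff_map_eq_zero]
  intro x hx
  by_contra h
  have h1 := P.pos x h
  rw [← P.dot_hvec] at h1
  simp only [hvecL_apply] at hx
  simp [hx] at h1

/-- An injective real linear endomorphism of ℂⁿ is onto. Hence every fibre direction is of the form
`hvec q`, which the contour translation needs. -/
lemma hvec_surjective (v : Cn n) : ∃ q, P.hvec q = v :=
  (LinearMap.injective_iff_surjective (f := (P.hvecL : Cn n →ₗ[ℝ] Cn n))).1 P.hvec_injective v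

@[fun_prop]
lemma continuous_theta : Continuous P.theta := P.thetaL.continuous

@[fun_prop]
lemma continuous_H {α : Type*} [TopologicalSpace α] {f g : α → Cn n} (hf : Continuous f)
    (hg : Continuous g) : Continuous fun a => P.H (f a) (g a) := by
  have h : (fun a => P.H (f a) (g a)) =
      fun a => ∑ j, conj (g a j) * P.H.flip (Pi.single j 1) (f a) := by
    ext a
    conv_lhs => rw [single_eq (g a)]
    simp
  rw [h]
  fun_prop

@[fun_prop]
lemma continuous_S {α : Type*} [TopologicalSpace α] {f g : α → Cn n} (hf : Continuous f)
    (hg : Continuous g) : Continuous fun a => P.S (f a) (g a) :=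
  (P.S.continuous.comp hf).clm_apply hg

@[fun_prop]
lemma differentiable_S {E : Type*} [NormedAddCommGroup E] [NormedSpace ℂ E] {f g : E → Cn n}
    (hf : Differentiable ℂ f) (hg : Differentiable ℂ g) :
    Differentiable ℂ fun a => P.S (f a) (g a) :=
  (P.S.differentiable.comp hf).clm_apply hg

@[fun_prop]
lemma differentiable_H {E : Type*} [NormedAddCommGroup E] [NormedSpace ℂ E] {f : E → Cn n}
    (hf : Differentiable ℂ f) (w : Cn n) : Differentiable ℂ fun a => P.H (f a) w :=
  (P.H.flip w).differentiable.comp hf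

lemma continuous_H_self : Continuous fun x : Cn n => P.H x x := by fun_prop

@[fun_prop]
lemma continuous_phi : Continuous P.phi := by unfold phi; fun_prop

/-- Compactness of the unit sphere and homogeneity; n = 0 is separate because the sphere is then
empty. -/
lemma exists_lower : ∃ c : ℝ, 0 < c ∧ ∀ x, c * ‖x‖ ^ 2 ≤ (P.H x x).re := by
  rcases isEmpty_or_nonempty (Fin n) with hn | hn
  · exact ⟨1, one_pos, fun x => by simp [Subsingleton.elim x 0]⟩
  · obtain ⟨x0, hx0, hmin⟩ := (isCompact_sphere (0 : Cn n) 1).exists_isMinOn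
      (NormedSpace.sphere_nonempty.2 zero_le_one)
      (Complex.continuous_re.comp P.continuous_H_self).continuousOn
    refine ⟨(P.H x0 x0).re, P.pos x0 ?_, fun x => ?_⟩
    · rintro rfl; simp at hx0
    · by_cases hx : x = 0
      · simp [hx]
      have hx' : ‖x‖ ≠ 0 := norm_ne_zero_iff.2 hx
      have h1 : ((‖x‖⁻¹ : ℝ) : ℂ) • x ∈ Metric.sphere (0 : Cn n) 1 := by
        simp [norm_smul, hx']
      have h2 := hmin h1
      simp only [Set.mem_ofPred_eq, Function.comp] at h2
      have h3 : (P.H x x).re = ‖x‖ ^ 2 *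
          (P.H (((‖x‖⁻¹ : ℝ) : ℂ) • x) (((‖x‖⁻¹ : ℝ) : ℂ) • x)).re := by
        simp only [map_smul, smul_apply, map_smulₛₗ, Complex.conj_ofReal,
          smul_eq_mul, Complex.re_ofReal_mul]
        field_simp
      rw [h3, mul_comm]
      gcongr

lemma exists_upper : ∃ C : ℝ, 0 < C ∧ (∀ x y, ‖P.H x y‖ ≤ C * ‖x‖ * ‖y‖) ∧
    (∀ x, ‖P.hvec x‖ ≤ C * ‖x‖) ∧ (∀ x, ‖P.theta x‖ ≤ C * ‖x‖) := by
  refine ⟨max (max ‖P.H‖ ‖P.hvecL‖) ‖P.thetaL‖ + 1, by positivity, fun x y => ?_, fun x => ?_,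
    fun x => ?_⟩
  · refine (P.H.le_opNorm₂ x y).trans ?_
    gcongr
    linarith [le_max_left (max ‖P.H‖ ‖P.hvecL‖) ‖P.thetaL‖, le_max_left ‖P.H‖ ‖P.hvecL‖]
  · refine (P.hvecL.le_opNorm x).trans ?_
    gcongr
    linarith [le_max_left (max ‖P.H‖ ‖P.hvecL‖) ‖P.thetaL‖, le_max_right ‖P.H‖ ‖P.hvecL‖]
  · refine (P.thetaL.le_opNorm x).trans ?_
    gcongr
    linarith [le_max_right (max ‖P.H‖ ‖P.hvecL‖) ‖P.thetaL‖]

end Weight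

/-! ### Splitting a real quadratic form into its bilinear and Hermitian parts -/

lemma real_smul_eq (c : ℝ) (x : Cn n) : (c • x : Cn n) = (c : ℂ) • x := by ext j; simp

/-- A real bilinear map that commutes with multiplication by `i` in both variables is complex
bilinear. -/
lemma exists_complexBilinear (b : Cn n → Cn n → ℂ)
    (al : ∀ x y t, b (x + y) t = b x t + b y t) (ar : ∀ x s t, b x (s + t) = b x s + b x t)
    (rl : ∀ (c : ℝ) x t, b (c • x) t = c * b x t) (rr : ∀ (c : ℝ) x t, b x (c • t) = c * b x t)
    (il : ∀ x t, b (Complex.I • x) t = Complex.I * b x t)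
    (ir : ∀ x t, b x (Complex.I • t) = Complex.I * b x t) :
    ∃ A : Cn n →L[ℂ] Cn n →L[ℂ] ℂ, ∀ x t, A x t = b x t := by
  have dec : ∀ (c : ℂ) (x : Cn n), c • x = c.re • x + c.im • (Complex.I • x) := by
    intro c x
    rw [real_smul_eq, real_smul_eq, smul_smul, ← add_smul, Complex.re_add_im]
  let L : Cn n →ₗ[ℂ] Cn n →ₗ[ℂ] ℂ := LinearMap.mk₂ ℂ b al
    (fun c x t => by
      rw [dec, al, rl, rl, il, ← mul_assoc, ← add_mul, Complex.re_add_im, smul_eq_mul]) ar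
    (fun c x t => by
      rw [dec, ar, rr, rr, ir, ← mul_assoc, ← add_mul, Complex.re_add_im, smul_eq_mul])
  exact ⟨LinearMap.toContinuousLinearMap
    ((LinearMap.toContinuousLinearMap : (Cn n →ₗ[ℂ] ℂ) ≃ₗ[ℂ] _).toLinearMap ∘ₗ L),
    fun x t => rfl⟩

/-- Complex conjugation on `ℂⁿ`. -/
def conjL (n : ℕ) : Cn n →L⋆[ℂ] Cn n where
  toFun x := fun j => conj (x j)
  map_add' x y := by ext j; simp
  map_smul' c x := by ext j; simp
  cont := continuous_pi fun j => Complex.continuous_conj.comp (continuous_apply j)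

lemma exists_complexSesquilinear (b : Cn n → Cn n → ℂ)
    (al : ∀ x y t, b (x + y) t = b x t + b y t) (ar : ∀ x s t, b x (s + t) = b x s + b x t)
    (rl : ∀ (c : ℝ) x t, b (c • x) t = c * b x t) (rr : ∀ (c : ℝ) x t, b x (c • t) = c * b x t)
    (il : ∀ x t, b (Complex.I • x) t = Complex.I * b x t)
    (ir : ∀ x t, b x (Complex.I • t) = -Complex.I * b x t) :
    ∃ A : Cn n →L[ℂ] Cn n →L⋆[ℂ] ℂ, ∀ x t, A x t = b x t := by
  have hin : ∀ x t, b x (-t) = - b x t := by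
    intro x t
    have := rr (-1) x t
    simpa using this
  obtain ⟨A, hA⟩ := exists_complexBilinear (fun x t => b x (conjL n t))
    (fun x y t => al x y _) (fun x s t => by rw [map_add, ar]) (fun c x t => rl c x _)
    (fun c x t => by
      rw [real_smul_eq, map_smulₛₗ, Complex.conj_ofReal, ← real_smul_eq, rr])
    (fun x t => il x _)
    (fun x t => by
      rw [map_smulₛₗ, Complex.conj_I, neg_smul, hin, ir]; ring)
  refine ⟨((ContinuousLinearMap.compSL (Cn n) (Cn n) ℂ (starRingEnd ℂ) (RingHom.id ℂ)).flip
    (conjL n)).comp A, fun x t => ?_⟩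
  have h2 : conjL n (conjL n t) = t := by ext j; simp [conjL]
  change A x (conjL n t) = b x t
  rw [hA, h2]

/-- The real derivative of a real quadratic form in terms of its complex parts. -/
lemma hasFDerivAt_quad (S : Cn n →L[ℂ] Cn n →L[ℂ] ℂ) (H : Cn n →L[ℂ] Cn n →L⋆[ℂ] ℂ)
    (symm : ∀ x y, S y x = S x y) (herm : ∀ x y, H y x = conj (H x y)) (x : Cn n)
    (L : Cn n →L[ℝ] ℝ) (hL : ∀ t, L t = (S x t + H t x).re) :
    HasFDerivAt (fun x => (1 / 2) * (S x x).re + (1 / 2) * (H x x).re) L x := by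
  rw [hasFDerivAt_iff_isLittleO_nhds_zero]
  have h1 : ∀ t : Cn n, (1 / 2) * (S (x + t) (x + t)).re + (1 / 2) * (H (x + t) (x + t)).re -
      ((1 / 2) * (S x x).re + (1 / 2) * (H x x).re) - L t =
      (1 / 2) * (S t t).re + (1 / 2) * (H t t).re := by
    intro t
    have h2 : (H x t).re = (H t x).re := by rw [herm t x]; simp
    simp only [map_add, add_apply, hL, Complex.add_re, symm x t, h2]
    ring
  simp only [h1]
  have h3 : (fun t : Cn n => (1 / 2) * (S t t).re + (1 / 2) * (H t t).re) =O[nhds 0]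
      fun t => ‖t‖ ^ 2 := by
    refine Asymptotics.IsBigO.of_bound (‖S‖ + ‖H‖) (Filter.Eventually.of_forall fun t => ?_)
    have a1 := (Complex.abs_re_le_norm (S t t)).trans (S.le_opNorm₂ t t)
    have a2 := (Complex.abs_re_le_norm (H t t)).trans (H.le_opNorm₂ t t)
    have a3 : 0 ≤ ‖S‖ * ‖t‖ * ‖t‖ := by positivity
    have a4 : 0 ≤ ‖H‖ * ‖t‖ * ‖t‖ := by positivity
    rw [Real.norm_eq_abs, norm_pow, norm_norm]
    rw [abs_le] at *
    constructor <;> nlinarith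
  refine h3.trans_isLittleO ?_
  have : (fun t : Cn n => ‖t‖ ^ 2) = fun t => ‖t‖ * ‖t‖ := by ext; ring
  rw [this]
  have h4 : (fun t : Cn n => ‖t‖) =o[nhds 0] (fun _ => (1 : ℝ)) := by
    rw [Asymptotics.isLittleO_one_iff]
    exact tendsto_norm_zero
  have h5 := (Asymptotics.isBigO_refl (fun t : Cn n => ‖t‖) (nhds 0)).mul_isLittleO h4
  simp only [mul_one] at h5
  exact h5.trans_isBigO (Asymptotics.isBigO_norm_left.2 (Asymptotics.isBigO_refl _ _))

lemma exists_gradient (S : Cn n →L[ℂ] Cn n →L[ℂ] ℂ) (H : Cn n →L[ℂ] Cn n →L⋆[ℂ] ℂ) (x : Cn n) :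
    ∃ L : Cn n →L[ℝ] ℝ, ∀ t, L t = (S x t + H t x).re :=
  ⟨Complex.reCLM.comp ((S x + H.flip x).restrictScalars ℝ), fun _ => rfl⟩

/-- Real derivatives of `f : ℂⁿ → ℝ` and of its composition with the coercion to `ℂ`. -/
lemma fderiv_ofReal_apply {f : Cn n → ℝ} {x : Cn n} (hf : DifferentiableAt ℝ f x) (t : Cn n) :
    fderiv ℝ (fun z => (f z : ℂ)) x t = (fderiv ℝ f x t : ℂ) := by
  have := (Complex.ofRealCLM.hasFDerivAt.comp x hf.hasFDerivAt).fderiv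
  change fderiv ℝ (⇑Complex.ofRealCLM ∘ f) x t = _
  rw [this]; rfl

lemma dz_quad (S : Cn n →L[ℂ] Cn n →L[ℂ] ℂ) (H : Cn n →L[ℂ] Cn n →L⋆[ℂ] ℂ)
    (symm : ∀ x y, S y x = S x y) (herm : ∀ x y, H y x = conj (H x y)) (x : Cn n) (j : Fin n) :
    dz (fun z => (((1 / 2) * (S z z).re + (1 / 2) * (H z z).re : ℝ) : ℂ)) x j =
      (1 / 2) * (S x (Pi.single j 1) + H (Pi.single j 1) x) := by
  obtain ⟨L, hL⟩ := exists_gradient S H x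
  have h := hasFDerivAt_quad S H symm herm x L hL
  unfold dz
  rw [fderiv_ofReal_apply h.differentiableAt, fderiv_ofReal_apply h.differentiableAt, h.fderiv,
    hL, hL]
  have hI : (Pi.single j Complex.I : Cn n) = Complex.I • Pi.single j 1 := by
    rw [← Pi.single_smul]; simp
  rw [hI]
  simp only [map_smul, smul_apply, smul_eq_mul]
  apply Complex.ext <;> simp [add_comm]

lemma dzbar_of_clm {g : Cn n → ℂ} (A : Cn n →L[ℝ] ℂ) {x : Cn n} (hA : HasFDerivAt g A x)
    (k : Fin n) : dzbar g x k =
      (1 / 2) * (A (Pi.single k 1) + Complex.I * A (Pi.single k Complex.I)) := by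
  unfold dzbar; rw [hA.fderiv]

/-- Strictly plurisubharmonic quadratic forms are the quadratic weights. -/
lemma exists_weight (Φ : QuadraticForm ℝ (Cn n)) (hΦ : StrictlyPlurisubharmonic Φ) :
    ∃ P : Weight n, ∀ x, Φ x = P.phi x := by
  set B := QuadraticMap.polarBilin Φ with hB
  have hs : ∀ x y, B y x = B x y := fun x y => by
    simp only [hB, QuadraticMap.polarBilin_apply_apply]; exact QuadraticMap.polar_comm _ _ _
  have hself : ∀ x, B x x = 2 * Φ x := fun x => by
    simp [hB, QuadraticMap.polarBilin_apply_apply, QuadraticMap.polar_self]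
  have hII : ∀ x : Cn n, Complex.I • (Complex.I • x) = -x := fun x => by
    rw [smul_smul, Complex.I_mul_I, neg_one_smul]
  have hIr : ∀ (c : ℝ) (x : Cn n), Complex.I • (c • x) = c • (Complex.I • x) := fun c x =>
    smul_comm _ _ _
  -- S and H are the projections of the polar form B onto the part that is complex linear in both
  -- slots and the part that is conjugate linear in one; S(x,t) + H(t,x) has real part B(x,t).
  obtain ⟨S, hS⟩ := exists_complexBilinear (fun x t => (1 / 2) * (B x t - Complex.I *
    B x (Complex.I • t) - Complex.I * B (Complex.I • x) t - B (Complex.I • x) (Complex.I • t)))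
    (fun x y t => by simp only [smul_add, map_add, LinearMap.add_apply]; push_cast; ring)
    (fun x y t => by simp only [smul_add, map_add]; push_cast; ring)
    (fun c x t => by
      simp only [hIr, map_smul, LinearMap.smul_apply, smul_eq_mul]; push_cast; ring)
    (fun c x t => by
      simp only [hIr, map_smul, smul_eq_mul]; push_cast; ring)
    (fun x t => by
      simp only [hII, map_neg, LinearMap.neg_apply]; push_cast; ring_nf; simp; ring)
    (fun x t => by
      simp only [hII, map_neg]; push_cast; ring_nf; simp; ring)
  obtain ⟨H, hH⟩ := exists_complexSesquilinear (fun t x => (1 / 2) * (B x t - Complex.I *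
    B x (Complex.I • t) + Complex.I * B (Complex.I • x) t + B (Complex.I • x) (Complex.I • t)))
    (fun x y t => by simp only [smul_add, map_add]; push_cast; ring)
    (fun x y t => by simp only [smul_add, map_add, LinearMap.add_apply]; push_cast; ring)
    (fun c x t => by
      simp only [hIr, map_smul, smul_eq_mul]; push_cast; ring)
    (fun c x t => by
      simp only [hIr, map_smul, LinearMap.smul_apply, smul_eq_mul]; push_cast; ring)
    (fun x t => by
      simp only [hII, map_neg]; push_cast; ring_nf; simp; ring)
    (fun x t => by
      simp only [hII, map_neg, LinearMap.neg_apply]; push_cast; ring_nf; simp; ring)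
  have symm : ∀ x y, S y x = S x y := fun x y => by
    rw [hS, hS]; simp only [hs x y, hs x (Complex.I • y), hs (Complex.I • x) y,
      hs (Complex.I • x) (Complex.I • y)]; ring
  have herm : ∀ x y, H y x = conj (H x y) := fun x y => by
    rw [hH, hH]
    simp only [hs x y, hs x (Complex.I • y), hs (Complex.I • x) y,
      hs (Complex.I • x) (Complex.I • y), map_mul, map_add, map_sub, Complex.conj_ofReal,
      Complex.conj_I, map_div₀, map_one, map_ofNat]
    ring
  have hval : ∀ x, Φ x = (1 / 2) * (S x x).re + (1 / 2) * (H x x).re := fun x => by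
    rw [← Complex.re_ofReal_mul, ← Complex.re_ofReal_mul, ← Complex.add_re, hS, hH]
    have : (((1 / 2 : ℝ) : ℂ) * ((1 / 2) * (B x x - Complex.I *
        B x (Complex.I • x) - Complex.I * B (Complex.I • x) x - B (Complex.I • x) (Complex.I • x)))
        + ((1 / 2 : ℝ) : ℂ) * ((1 / 2) * (B x x - Complex.I *
        B x (Complex.I • x) + Complex.I * B (Complex.I • x) x + B (Complex.I • x) (Complex.I • x))))
        = ((Φ x : ℝ) : ℂ) - Complex.I * ((1 / 2 * B x (Complex.I • x) : ℝ) : ℂ) := by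
      rw [hself x]; push_cast; ring
    rw [this]
    simp
  refine ⟨⟨S, H, symm, herm, fun t ht => ?_⟩, hval⟩
  have key := hΦ 0 t ht
  have h1 : (fun w => (Φ w : ℂ)) =
      fun w => (((1 / 2) * (S w w).re + (1 / 2) * (H w w).re : ℝ) : ℂ) := by
    ext w; rw [hval]
  -- The Levi matrix is ½H(e_j, e_k): the S-part of the gradient is holomorphic in x and is killed
  -- by ∂/∂x̄_k.
  have h2 : ∀ j k, dzbar (fun z => dz (fun w => (Φ w : ℂ)) z j) 0 k =
      (1 / 2) * H (Pi.single j 1) (Pi.single k 1) := by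
    intro j k
    rw [h1]
    simp only [dz_quad S H symm herm]
    have hc : ∀ t, H t 0 = 0 := fun t => map_zero _
    let C : Cn n →L[ℝ] ℂ := LinearMap.toContinuousLinearMap
      { toFun := fun x => (1 / 2) * (S x (Pi.single j 1) + H (Pi.single j 1) x)
        map_add' := fun x y => by simp only [map_add, add_apply]; ring
        map_smul' := fun c x => by
          rw [real_smul_eq, map_smul, map_smulₛₗ, Complex.conj_ofReal]
          simp; ring }
    have hC : HasFDerivAt (fun x => (1 / 2) * (S x (Pi.single j 1) + H (Pi.single j 1) x)) C 0 :=
      C.hasFDerivAt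
    rw [dzbar_of_clm C hC]
    change (1 / 2 : ℂ) * ((1 / 2) * (S (Pi.single k 1) (Pi.single j 1) +
      H (Pi.single j 1) (Pi.single k 1)) + Complex.I * ((1 / 2) *
      (S (Pi.single k Complex.I) (Pi.single j 1) + H (Pi.single j 1) (Pi.single k Complex.I)))) = _
    have hI : (Pi.single k Complex.I : Cn n) = Complex.I • Pi.single k 1 := by
      rw [← Pi.single_smul]; simp
    rw [hI, map_smul, map_smulₛₗ, smul_apply, smul_eq_mul, smul_eq_mul, Complex.conj_I]
    linear_combination (1 / 4 * S (Pi.single k 1) (Pi.single j 1) -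
      1 / 4 * H (Pi.single j 1) (Pi.single k 1)) * Complex.I_mul_I
  simp only [h2] at key
  have h3 : H t t = ∑ j, ∑ k, H (Pi.single j 1) (Pi.single k 1) * t j * conj (t k) := by
    conv_lhs => rw [Weight.single_eq t]
    simp only [map_sum, sum_apply, map_smul, smul_apply,
      map_smulₛₗ, smul_eq_mul, Finset.mul_sum]
    refine Finset.sum_comm.trans (Finset.sum_congr rfl fun j _ =>
      Finset.sum_congr rfl fun k _ => ?_)
    ring
  have h4 : (∑ j, ∑ k, (1 / 2) * H (Pi.single j 1) (Pi.single k 1) * t j * conj (t k)) =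
      ((1 / 2 : ℝ) : ℂ) * H t t := by
    rw [h3, Finset.mul_sum]
    refine Finset.sum_congr rfl fun j _ => ?_
    rw [Finset.mul_sum]
    refine Finset.sum_congr rfl fun k _ => ?_
    push_cast; ring
  rw [h4, Complex.re_ofReal_mul] at key
  linarith

/-! ### The covector field (2/i)∂f/∂x of a real function -/

/-- `(2/i) ∂f/∂x` in terms of the real differential of a real function `f`. -/
def eta (f : Cn n → ℝ) (x : Cn n) : Cn n := fun j =>
  -Complex.I * ((fderiv ℝ f x (Pi.single j 1) : ℂ) -
    Complex.I * (fderiv ℝ f x (Pi.single j Complex.I) : ℂ))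

lemma xi_eq_eta {f : Cn n → ℝ} {x : Cn n} (hf : DifferentiableAt ℝ f x) : xi f x = eta f x := by
  ext j
  simp only [xi, dz, eta, Pi.smul_apply, smul_eq_mul, fderiv_ofReal_apply hf]
  rw [← mul_assoc]
  congr 1
  field_simp
  simp

lemma eta_add {f g : Cn n → ℝ} {x : Cn n} (hf : DifferentiableAt ℝ f x)
    (hg : DifferentiableAt ℝ g x) : eta (fun z => f z + g z) x = eta f x + eta g x := by
  ext j
  have : fderiv ℝ (fun z => f z + g z) x = fderiv ℝ f x + fderiv ℝ g x :=
    (hf.hasFDerivAt.add hg.hasFDerivAt).fderiv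
  simp only [eta, this, add_apply, Pi.add_apply]
  push_cast; ring

/-- The left side is complex linear in t with real part df_x(t); complex linearity forces the
imaginary part to be -df_x(it). -/
lemma I_mul_dot_eta (f : Cn n → ℝ) (x t : Cn n) :
    Complex.I * ∑ j, t j * eta f x j =
      (fderiv ℝ f x t : ℂ) - Complex.I * (fderiv ℝ f x (Complex.I • t) : ℂ) := by
  have h1 : ∀ s : Cn n, fderiv ℝ f x s = ∑ j, ((s j).re * fderiv ℝ f x (Pi.single j 1) +
      (s j).im * fderiv ℝ f x (Pi.single j Complex.I)) := by
    intro s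
    have h2 : s = ∑ j, ((s j).re • (Pi.single j (1 : ℂ) : Cn n) +
        (s j).im • (Pi.single j Complex.I : Cn n)) := by
      conv_lhs => rw [Weight.single_eq s]
      refine Finset.sum_congr rfl fun j _ => ?_
      rw [← Pi.single_smul, ← Pi.single_smul, ← Pi.single_smul, ← Pi.single_add]
      congr 1
      simp [Complex.re_add_im]
    conv_lhs => rw [h2]
    simp
  rw [h1 t, h1 (Complex.I • t)]
  push_cast
  rw [Finset.mul_sum, Finset.mul_sum, ← Finset.sum_sub_distrib]
  refine Finset.sum_congr rfl fun j _ => ?_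
  simp only [eta, Pi.smul_apply, smul_eq_mul, Complex.I_mul_re, Complex.I_mul_im]
  conv_lhs => rw [← Complex.re_add_im (t j)]
  push_cast
  linear_combination (-(t j).re * (fderiv ℝ f x (Pi.single j 1) : ℂ) - (t j).im * Complex.I *
    (fderiv ℝ f x (Pi.single j 1) : ℂ) + Complex.I * (t j).re *
    (fderiv ℝ f x (Pi.single j Complex.I) : ℂ) + (t j).im * (Complex.I ^ 2 - 1) *
    (fderiv ℝ f x (Pi.single j Complex.I) : ℂ)) *
    Complex.I_sq

/-- The link between twist and perturbation: for η = `eta f x` the modulus of e^{i(x-w)·η/h} is the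
exponential of the linear Taylor term df_x(x-w)/h. -/
lemma re_I_mul_dot_eta (f : Cn n → ℝ) (x t : Cn n) :
    (Complex.I * ∑ j, t j * eta f x j).re = fderiv ℝ f x t := by
  rw [I_mul_dot_eta]; simp

lemma norm_eta_sub_le {f g : Cn n → ℝ} {x y : Cn n} :
    ‖eta f x - eta g y‖ ≤ 2 * ‖fderiv ℝ f x - fderiv ℝ g y‖ := by
  refine (pi_norm_le_iff_of_nonneg (by positivity)).2 fun j => ?_
  have h1 : eta f x j - eta g y j = -Complex.I * ((((fderiv ℝ f x - fderiv ℝ g y)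
      (Pi.single j 1) : ℝ) : ℂ) - Complex.I * (((fderiv ℝ f x - fderiv ℝ g y)
      (Pi.single j Complex.I) : ℝ) : ℂ)) := by
    simp only [eta, sub_apply]; push_cast; ring
  rw [Pi.sub_apply, h1, norm_mul, norm_neg, Complex.norm_I, one_mul]
  refine (norm_sub_le _ _).trans ?_
  rw [norm_mul, Complex.norm_I, one_mul, Complex.norm_real, Complex.norm_real]
  have a1 := (fderiv ℝ f x - fderiv ℝ g y).le_opNorm (Pi.single j (1 : ℂ))
  have a2 := (fderiv ℝ f x - fderiv ℝ g y).le_opNorm (Pi.single j Complex.I)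
  rw [Pi.norm_single] at a1 a2
  simp only [norm_one, Complex.norm_I, mul_one] at a1 a2
  linarith

lemma norm_eta_le (f : Cn n → ℝ) (x : Cn n) : ‖eta f x‖ ≤ 2 * ‖fderiv ℝ f x‖ := by
  have := norm_eta_sub_le (f := f) (g := fun _ => 0) (x := x) (y := x)
  have h0 : eta (fun _ : Cn n => (0 : ℝ)) x = 0 := by ext j; simp [eta]
  simpa [h0] using this

namespace Weight
variable (P : Weight n)

lemma differentiable_phi : Differentiable ℝ P.phi := fun x => by
  obtain ⟨L, hL⟩ := exists_gradient P.S P.H x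
  exact (hasFDerivAt_quad P.S P.H P.symm P.herm x L hL).differentiableAt

lemma fderiv_phi (x t : Cn n) : fderiv ℝ P.phi x t = (P.S x t + P.H t x).re := by
  obtain ⟨L, hL⟩ := exists_gradient P.S P.H x
  have := (hasFDerivAt_quad P.S P.H P.symm P.herm x L hL).fderiv
  rw [show P.phi = fun x => (1 / 2) * (P.S x x).re + (1 / 2) * (P.H x x).re from rfl, this, hL]

lemma xi_phi (x : Cn n) : xi P.phi x = P.theta x := by
  ext j
  simp only [xi, Pi.smul_apply, smul_eq_mul]
  have := dz_quad P.S P.H P.symm P.herm x j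
  change dz (fun z => (P.phi z : ℂ)) x j = _ at this
  rw [this]
  simp only [theta, svec, hvec, Pi.smul_apply, Pi.add_apply, smul_eq_mul]
  field_simp
  simp

lemma xi_phi_add {f : Cn n → ℝ} {x : Cn n} (hf : DifferentiableAt ℝ f x) :
    xi (fun x => P.phi x + f x) x = P.theta x + eta f x := by
  rw [xi_eq_eta (f := fun x => P.phi x + f x) ((P.differentiable_phi x).add hf),
    eta_add (P.differentiable_phi x) hf,
    ← xi_eq_eta (P.differentiable_phi x), xi_phi]

/-! ### Gaussian integrals of H and the normalization of the Weyl integral -/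

/-- The matrix of the Levi form. -/
def mat : Matrix (Fin n) (Fin n) ℂ := Matrix.of fun j k => P.H (Pi.single j 1) (Pi.single k 1)

lemma H_eq_sum (x y : Cn n) :
    P.H x y = ∑ j, ∑ k, conj (y j) * P.H (Pi.single k 1) (Pi.single j 1) * x k := by
  conv_lhs => rw [single_eq x, single_eq y]
  simp only [map_sum, sum_apply, map_smul, smul_apply,
    map_smulₛₗ, smul_eq_mul, Finset.mul_sum]
  refine Finset.sum_congr rfl fun j _ => Finset.sum_congr rfl fun k _ => ?_
  ring

-- The transpose appears because H is linear in its first slot, while `star x ⬝ᵥ A.mulVec x`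
-- conjugates the left factor.
open scoped ComplexOrder in
lemma posDef_mat_transpose : P.mat.transpose.PosDef := by
  refine Matrix.PosDef.of_dotProduct_mulVec_pos ?_ fun x hx => ?_
  · ext j k
    simp only [Matrix.conjTranspose_apply, Matrix.transpose_apply, mat, Matrix.of_apply]
    rw [P.herm]; simp
  · have : star x ⬝ᵥ (P.mat.transpose.mulVec x) = P.H x x := by
      rw [P.H_eq_sum]
      simp only [dotProduct, Matrix.mulVec, Finset.mul_sum, Matrix.transpose_apply, mat,
        Matrix.of_apply, Pi.star_apply, RCLike.star_def, mul_assoc]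
    rw [this, P.H_self_eq]
    exact_mod_cast P.pos x hx

open scoped ComplexOrder in
lemma det_mat_ne : P.mat.det ≠ 0 := by
  rw [← Matrix.det_transpose]
  exact P.posDef_mat_transpose.det_pos.ne'

-- The positive square root X of the transposed Levi matrix gives H(x,x) = ∑ |(Xx)_j|², so that the
-- Gaussian of H becomes a product Gaussian after a linear change of variables.
open scoped MatrixOrder ComplexOrder in
lemma exists_sqrt_mat : ∃ X : Matrix (Fin n) (Fin n) ℂ, (Complex.normSq X.det : ℂ) = P.mat.det ∧
    ∀ x, (P.H x x).re = ∑ j, ‖X.mulVec x j‖ ^ 2 := by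
  have hA := P.posDef_mat_transpose.posSemidef
  refine ⟨CFC.sqrt P.mat.transpose, ?_, fun x => ?_⟩
  · have h1 : (CFC.sqrt P.mat.transpose).conjTranspose = CFC.sqrt P.mat.transpose :=
      (Matrix.nonneg_iff_posSemidef.1 (CFC.sqrt_nonneg P.mat.transpose)).1
    rw [Complex.normSq_eq_conj_mul_self, ← RCLike.star_def, ← Matrix.det_conjTranspose, h1,
      ← Matrix.det_mul, CFC.sqrt_mul_sqrt_self _ hA.nonneg, Matrix.det_transpose]
  · set X := CFC.sqrt P.mat.transpose
    have h1 : X.conjTranspose = X :=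
      (Matrix.nonneg_iff_posSemidef.1 (CFC.sqrt_nonneg P.mat.transpose)).1
    have h2 : P.H x x = star x ⬝ᵥ (P.mat.transpose.mulVec x) := by
      rw [P.H_eq_sum]
      simp only [dotProduct, Matrix.mulVec, Finset.mul_sum, Matrix.transpose_apply, mat,
        Matrix.of_apply, Pi.star_apply, RCLike.star_def, mul_assoc]
    rw [h2, ← CFC.sqrt_mul_sqrt_self _ hA.nonneg]
    change (star x ⬝ᵥ ((X * X).mulVec x)).re = _
    have h3 : star x ⬝ᵥ ((X * X).mulVec x) = star (X.mulVec x) ⬝ᵥ (X.mulVec x) := by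
      rw [Matrix.star_mulVec, h1, Matrix.dotProduct_mulVec, Matrix.dotProduct_mulVec,
        Matrix.vecMul_vecMul]
    rw [h3, dotProduct, Complex.re_sum]
    refine Finset.sum_congr rfl fun j _ => ?_
    rw [Pi.star_apply, RCLike.star_def, ← Complex.normSq_eq_conj_mul_self, Complex.ofReal_re,
      Complex.normSq_eq_norm_sq]

/-- The Gaussian integral of a Hermitian form. -/
lemma integral_gaussian {c : ℝ} (hc : 0 < c) :
    ((∫ x : Cn n, Real.exp (-c * (P.H x x).re) : ℝ) : ℂ) * P.mat.det =
      (Real.pi / c : ℂ) ^ n := by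
  obtain ⟨X, hX, hH⟩ := P.exists_sqrt_mat
  have hd : P.mat.det ≠ 0 := P.det_mat_ne
  let L : Cn n →ₗ[ℝ] Cn n := (Matrix.toLin' X).restrictScalars ℝ
  -- The real determinant of a complex linear map is the squared modulus of its complex determinant.
  have hL : LinearMap.det L = Complex.normSq X.det := by
    rw [LinearMap.det_restrictScalars, LinearMap.det_toLin', Algebra.norm_complex_apply]
  have hne : Complex.normSq X.det ≠ 0 := by
    intro h0; rw [h0] at hX; exact hd (by simpa using hX.symm)
  have hmap := Measure.map_linearMap_addHaar_eq_smul_addHaar (volume : Measure (Cn n))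
    (f := L) (by rw [hL]; exact hne)
  let g : Cn n → ℝ := fun y => Real.exp (-c * ∑ j, ‖y j‖ ^ 2)
  have hg : Continuous g := by fun_prop
  have hLc : Continuous L := L.continuous_of_finiteDimensional
  have h1 : ∫ x : Cn n, Real.exp (-c * (P.H x x).re) = ∫ x, g (L x) := by
    refine integral_congr_ae (Filter.Eventually.of_forall fun x => ?_)
    simp only [hH]; rfl
  have h2 : ∫ x, g (L x) = ∫ y, g y ∂(Measure.map L volume) :=
    (integral_map hLc.aemeasurable hg.aestronglyMeasurable).symm
  have h3 : ∫ y, g y = (Real.pi / c) ^ n := by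
    have : g = fun y => ∏ j, Real.exp (-c * ‖y j‖ ^ 2) := by
      ext y; simp only [g]; rw [Finset.mul_sum, Real.exp_sum]
    rw [this]
    have h4 := integral_fintype_prod_volume_eq_pow (ι := Fin n)
      (fun z : ℂ => Real.exp (-c * ‖z‖ ^ 2))
    rw [h4, GaussianFourier.integral_rexp_neg_mul_sq_norm hc]
    simp
  rw [h1, h2, hmap, integral_smul_measure, h3, hL, ← hX]
  have hpos : 0 < Complex.normSq X.det := lt_of_le_of_ne (Complex.normSq_nonneg _) hne.symm
  rw [abs_of_pos (inv_pos.2 hpos), ENNReal.toReal_ofReal (inv_pos.2 hpos).le]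
  rw [smul_eq_mul]
  push_cast
  have hne' : (Complex.normSq X.det : ℂ) ≠ 0 := by exact_mod_cast hne
  field_simp

/-- The normalization constant of the Weyl quantization. -/
def wconst (h : ℝ) : ℝ := (∫ x : Cn n, Real.exp (-(1 / 2) * (P.H x x).re / h))⁻¹

/-- The constant combines (2πh)^{-n} with the Jacobian of the contour, and so normalizes a Gaussian
to mass one. -/
lemma wconst_eq {h : ℝ} (hh : 0 < h) :
    (P.wconst h : ℂ) = P.mat.det / (2 * Real.pi * h) ^ n := by
  have h1 := P.integral_gaussian (c := 1 / 2 / h) (by positivity)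
  have h2 : (∫ x : Cn n, Real.exp (-(1 / 2) * (P.H x x).re / h)) =
      ∫ x : Cn n, Real.exp (-(1 / 2 / h) * (P.H x x).re) := by
    congr 1; ext x; congr 1; ring
  rw [wconst, h2]
  push_cast
  have hpi : (Real.pi : ℂ) ≠ 0 := by exact_mod_cast Real.pi_ne_zero
  have hh' : (h : ℂ) ≠ 0 := by exact_mod_cast hh.ne'
  have h3 : (Real.pi / ((1 / 2 / h : ℝ) : ℂ)) ^ n = (2 * Real.pi * h : ℂ) ^ n := by
    congr 1; push_cast; field_simp
  rw [h3] at h1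
  have hd : P.mat.det ≠ 0 := P.det_mat_ne
  have h4 : (2 * Real.pi * h : ℂ) ^ n ≠ 0 :=
    pow_ne_zero _ (mul_ne_zero (mul_ne_zero two_ne_zero hpi) hh')
  rw [← h1]
  rw [← h1] at h4
  have h5 := left_ne_zero_of_mul h4
  field_simp

/-- The complex bilinear duality pairing. -/
def pair (t v : Cn n) : ℂ := ∑ j, t j * v j

lemma weylIntegral_eq {h : ℝ} (hh : 0 < h) (a : Cn n × Cn n → ℂ) (u : Cn n → ℂ) (x : Cn n) :
    weylIntegral P.phi h a u x = P.wconst h * ∫ y,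
      Complex.exp (Complex.I / h * pair (x - y) (P.theta ((1 / 2 : ℂ) • (x + y)))) *
        a ((1 / 2 : ℂ) • (x + y), P.theta ((1 / 2 : ℂ) • (x + y))) * u y := by
  -- Only the H-part of θ depends on ȳ, and the midpoint contributes ½, so ∂θ/∂ȳ = (-i/2)·`mat`. The
  -- orientation factor (2i)ⁿ cancels (-i/2)ⁿ and leaves det `mat`.
  have hdet : ∀ y, (Matrix.of fun j k =>
      dzbar (fun z => xi P.phi ((1 / 2 : ℂ) • (x + z)) j) y k) =
      (-Complex.I / 2) • P.mat := by
    intro y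
    ext j k
    simp only [xi_phi, Matrix.of_apply, Matrix.smul_apply, smul_eq_mul, mat]
    let pr : Cn n →L[ℝ] ℂ := ContinuousLinearMap.proj j
    have h1 : HasFDerivAt (fun z : Cn n => P.theta ((1 / 2 : ℂ) • (x + z)) j)
        ((1 / 2 : ℝ) • pr.comp P.thetaL) y := by
      have h2 : (fun z : Cn n => P.theta ((1 / 2 : ℂ) • (x + z)) j) =
          fun z => P.theta ((1 / 2 : ℂ) • x) j + ((1 / 2 : ℝ) • pr.comp P.thetaL) z := by
        ext z
        rw [smul_add, theta_add, Pi.add_apply]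
        congr 1
        have : (1 / 2 : ℂ) • z = (1 / 2 : ℝ) • z := by rw [real_smul_eq]; push_cast; rfl
        rw [this, ← thetaL_apply, map_smul]
        rfl
      rw [h2]
      exact (ContinuousLinearMap.hasFDerivAt _).const_add _
    rw [dzbar_of_clm _ h1]
    change (1 / 2 : ℂ) * ((1 / 2 : ℝ) • P.theta (Pi.single k 1) j +
      Complex.I * ((1 / 2 : ℝ) • P.theta (Pi.single k Complex.I) j)) = _
    have hI : (Pi.single k Complex.I : Cn n) = Complex.I • Pi.single k 1 := by
      rw [← Pi.single_smul]; simp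
    simp only [theta, hI, svec_smul, hvec_smul, Pi.smul_apply, Pi.add_apply, smul_eq_mul,
      Complex.conj_I, Complex.real_smul]
    simp only [svec, hvec]
    push_cast
    linear_combination (-Complex.I / 4 * P.S (Pi.single k 1) (Pi.single j 1) +
      Complex.I / 4 * P.H (Pi.single j 1) (Pi.single k 1)) * Complex.I_sq
  have hI2 : (2 * Complex.I) * (-Complex.I / 2) = 1 := by
    linear_combination -Complex.I_sq
  unfold weylIntegral contourIntegral
  simp only [hdet, Matrix.det_smul, Fintype.card_fin]
  have hc : ((2 * Complex.I) ^ n * ((-Complex.I / 2) ^ n * P.mat.det)) = P.mat.det := by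
    rw [← mul_assoc, ← mul_pow, hI2, one_pow, one_mul]
  simp only [hc, xi_phi]
  rw [integral_mul_const, P.wconst_eq hh]
  simp only [pair, Pi.sub_apply]
  ring

end Weight

/-! ### Cauchy estimates and holomorphic parameter integrals -/

section Cauchy
variable {E : Type*} [NormedAddCommGroup E] [NormedSpace ℂ E]

/-- Cauchy's estimate for the differential of a bounded holomorphic function on a ball. -/
lemma norm_fderiv_le_of_bounded {f : E → ℂ} {c : E} {R B : ℝ} (hR : 0 < R)
    (hf : DifferentiableOn ℂ f (Metric.ball c R)) (hB : ∀ x ∈ Metric.ball c R, ‖f x‖ ≤ B) :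
    ‖fderiv ℂ f c‖ ≤ 2 * B / R := by
  have hB0 : 0 ≤ B := (norm_nonneg _).trans (hB c (Metric.mem_ball_self hR))
  refine ContinuousLinearMap.opNorm_le_bound _ (by positivity) fun v => ?_
  by_cases hv : v = 0
  · simp [hv]
  have hv' : 0 < ‖v‖ := norm_pos_iff.2 hv
  -- With this radius the disc c + t·v stays within distance R/2 of c, hence the factor 2 in the
  -- bound.
  have hr : 0 < R / (2 * ‖v‖) := by positivity
  have hmem : ∀ t ∈ Metric.closedBall (0 : ℂ) (R / (2 * ‖v‖)), c + t • v ∈ Metric.ball c R := by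
    intro t ht
    simp only [Metric.mem_closedBall, dist_zero_right] at ht
    simp only [Metric.mem_ball, dist_eq_norm, add_sub_cancel_left, norm_smul]
    calc ‖t‖ * ‖v‖ ≤ R / (2 * ‖v‖) * ‖v‖ := by gcongr
      _ = R / 2 := by field_simp
      _ < R := by linarith
  have hl : Differentiable ℂ fun t : ℂ => c + t • v := by fun_prop
  have hd : DifferentiableOn ℂ (fun t : ℂ => f (c + t • v))
      (Metric.closedBall 0 (R / (2 * ‖v‖))) :=
    hf.comp hl.differentiableOn hmem
  have hdc : DiffContOnCl ℂ (fun t : ℂ => f (c + t • v)) (Metric.ball 0 (R / (2 * ‖v‖))) := by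
    refine ⟨hd.mono Metric.ball_subset_closedBall, ?_⟩
    rw [closure_ball _ hr.ne']
    exact hd.continuousOn
  have h1 := Complex.norm_deriv_le_of_forall_mem_sphere_norm_le hr hdc
    (fun z hz => hB _ (hmem z (Metric.sphere_subset_closedBall hz)))
  have h2 : deriv (fun t : ℂ => f (c + t • v)) 0 = fderiv ℂ f c v := by
    have hfc : HasFDerivAt f (fderiv ℂ f c) (c + (0 : ℂ) • v) := by
      rw [zero_smul, add_zero]
      exact (hf.differentiableAt (Metric.ball_mem_nhds c hR)).hasFDerivAt
    have hline : HasDerivAt (fun t : ℂ => c + t • v) v 0 := by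
      simpa using ((hasDerivAt_id (0 : ℂ)).smul_const v).const_add c
    exact (hfc.comp_hasDerivAt (0 : ℂ) hline).deriv
  rw [h2] at h1
  refine h1.trans (le_of_eq ?_)
  field_simp

variable [FiniteDimensional ℂ E] {α : Type*} [MeasurableSpace α] {μ : Measure α}

/-- Each directional derivative is an a.e. limit of difference quotients with steps 1/(m+N+1), where
N keeps the sampled points in the ball of measurability. A basis of E assembles the full derivative.
-/
lemma aestronglyMeasurable_fderiv {k : E → α → ℂ} {x₀ : E} {r : ℝ} (hr : 0 < r)
    (hm : ∀ x ∈ Metric.ball x₀ r, AEStronglyMeasurable (k x) μ)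
    (hd : ∀ᵐ w ∂μ, DifferentiableAt ℂ (fun x => k x w) x₀) :
    AEStronglyMeasurable (fun w => fderiv ℂ (fun x => k x w) x₀) μ := by
  have hv : ∀ v : E, AEStronglyMeasurable (fun w => fderiv ℂ (fun x => k x w) x₀ v) μ := by
    intro v
    obtain ⟨N, hN⟩ : ∃ N : ℕ, ∀ m : ℕ, x₀ + ((1 / ((m : ℝ) + N + 1) : ℝ) : ℂ) • v ∈
        Metric.ball x₀ r := by
      obtain ⟨N, hN⟩ := exists_nat_gt (‖v‖ / r)
      refine ⟨N, fun m => ?_⟩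
      simp only [Metric.mem_ball, dist_eq_norm, add_sub_cancel_left, norm_smul, Complex.norm_real]
      rw [Real.norm_of_nonneg (by positivity), div_mul_eq_mul_div, one_mul,
        div_lt_iff₀ (by positivity)]
      rw [div_lt_iff₀ hr] at hN
      have : (0 : ℝ) ≤ m := m.cast_nonneg
      nlinarith
    refine aestronglyMeasurable_of_tendsto_ae Filter.atTop
      (f := fun (m : ℕ) w => ((m : ℝ) + N + 1 : ℂ) *
        (k (x₀ + ((1 / ((m : ℝ) + N + 1) : ℝ) : ℂ) • v) w - k x₀ w)) (fun m => ?_) ?_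
    · exact ((hm _ (hN m)).sub (hm _ (Metric.mem_ball_self hr))).const_mul _
    · filter_upwards [hd] with w hw
      have hline : HasDerivAt (fun t : ℂ => x₀ + t • v) v 0 := by
        simpa using ((hasDerivAt_id (0 : ℂ)).smul_const v).const_add x₀
      have hfc : HasFDerivAt (fun x => k x w) (fderiv ℂ (fun x => k x w) x₀)
          (x₀ + (0 : ℂ) • v) := by
        rw [zero_smul, add_zero]; exact hw.hasFDerivAt
      have h1 := (hfc.comp_hasDerivAt (0 : ℂ) hline).tendsto_slope_zero
      have h2 : Filter.Tendsto (fun m : ℕ => ((1 / ((m : ℝ) + N + 1) : ℝ) : ℂ)) Filter.atTop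
          (nhdsWithin 0 {0}ᶜ) := by
        refine tendsto_nhdsWithin_iff.2 ⟨?_, Filter.Eventually.of_forall fun m => ?_⟩
        · have h3 : Filter.Tendsto (fun m : ℕ => (1 / ((m : ℝ) + N + 1) : ℝ)) Filter.atTop
              (nhds 0) := by
            have := (tendsto_one_div_add_atTop_nhds_zero_nat (𝕜 := ℝ)).comp
              (Filter.tendsto_add_atTop_nat N)
            refine this.congr fun m => ?_
            simp
          have := (Complex.continuous_ofReal.tendsto 0).comp h3
          rwa [Complex.ofReal_zero] at this
        · have : ((m : ℝ) + N + 1 : ℝ) ≠ 0 := by positivity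
          simp only [Set.mem_compl_iff, Set.mem_singleton_iff, Complex.ofReal_eq_zero]
          positivity
      refine (h1.comp h2).congr fun m => ?_
      simp only [Function.comp, zero_add, zero_smul, add_zero, smul_eq_mul]
      push_cast
      rw [one_div, inv_inv]
  let b := Module.finBasis ℂ E
  have hsum : ∀ L : E →L[ℂ] ℂ, L = ∑ i, L (b i) •
      (LinearMap.toContinuousLinearMap (b.coord i)) := by
    intro L
    ext x
    conv_lhs => rw [← b.sum_repr x, map_sum]
    simp [mul_comm]
  have : (fun w => fderiv ℂ (fun x => k x w) x₀) = fun w => ∑ i,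
      (fderiv ℂ (fun x => k x w) x₀ (b i)) • (LinearMap.toContinuousLinearMap (b.coord i)) := by
    ext1 w; exact hsum _
  rw [this]
  exact Finset.aestronglyMeasurable_fun_sum _ fun i _ => (hv (b i)).smul_const _

/-- An integral of holomorphic functions with a locally uniform integrable bound is holomorphic,
and may be differentiated under the integral sign. -/
lemma hasFDerivAt_integral_of_holomorphic {k : E → α → ℂ} {x₀ : E} {r : ℝ} (hr : 0 < r)
    {bound : α → ℝ} (hm : ∀ x ∈ Metric.ball x₀ r, AEStronglyMeasurable (k x) μ)
    (hd : ∀ᵐ w ∂μ, DifferentiableOn ℂ (fun x => k x w) (Metric.ball x₀ r))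
    (hb : ∀ᵐ w ∂μ, ∀ x ∈ Metric.ball x₀ r, ‖k x w‖ ≤ bound w) (hbi : Integrable bound μ) :
    HasFDerivAt (fun x => ∫ w, k x w ∂μ) (∫ w, fderiv ℂ (fun x => k x w) x₀ ∂μ) x₀ ∧
      Integrable (fun w => fderiv ℂ (fun x => k x w) x₀) μ := by
  have hx₀ := Metric.mem_ball_self (x := x₀) hr
  -- On balls of radius r/2 Cauchy's estimate turns domination of the functions into domination of
  -- their derivatives.
  have hbd : ∀ᵐ w ∂μ, ∀ x ∈ Metric.ball x₀ (r / 2),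
      ‖fderiv ℂ (fun x => k x w) x‖ ≤ 2 * bound w / (r / 2) := by
    filter_upwards [hd, hb] with w h1 h2 x hx
    have hsub : Metric.ball x (r / 2) ⊆ Metric.ball x₀ r :=
      Metric.ball_subset_ball' (by rw [Metric.mem_ball] at hx; linarith)
    exact norm_fderiv_le_of_bounded (by linarith) (h1.mono hsub) fun y hy => h2 y (hsub hy)
  have hmeas : AEStronglyMeasurable (fun w => fderiv ℂ (fun x => k x w) x₀) μ :=
    aestronglyMeasurable_fderiv hr hm (by
      filter_upwards [hd] with w h1 using h1.differentiableAt (Metric.ball_mem_nhds x₀ hr))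
  have hint : Integrable (fun w => 2 * bound w / (r / 2)) μ := (hbi.const_mul 2).div_const _
  refine ⟨hasFDerivAt_integral_of_dominated_of_fderiv_le
    (F' := fun x w => fderiv ℂ (fun x => k x w) x) (bound := fun w => 2 * bound w / (r / 2))
    (Metric.ball_mem_nhds x₀ (half_pos hr)) ?_ ?_ hmeas hbd hint ?_, ?_⟩
  · filter_upwards [Metric.ball_mem_nhds x₀ hr] with x hx using hm x hx
  · exact hbi.mono' (hm x₀ hx₀) (by filter_upwards [hb] with w h2 using h2 x₀ hx₀)
  · filter_upwards [hd] with w h1 x hx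
    exact (h1.differentiableAt (Metric.isOpen_ball.mem_nhds
      (Metric.ball_subset_ball (by linarith) hx))).hasFDerivAt
  · exact hint.mono' hmeas (by
      filter_upwards [hbd] with w h2 using h2 x₀ (Metric.mem_ball_self (half_pos hr)))

end Cauchy

/-! ### Elementary Gaussian and exponential bounds -/

section Elementary

lemma one_add_pow_le_exp (k : ℕ) {c : ℝ} (hc : 0 < c) :
    ∃ C : ℝ, 0 < C ∧ ∀ t : ℝ, 0 ≤ t → (1 + t) ^ k ≤ C * Real.exp (c * t) := by
  refine ⟨k.factorial * (c ^ k)⁻¹ * Real.exp c, by positivity, fun t ht => ?_⟩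
  have h := Real.pow_div_factorial_le_exp (c * (1 + t)) (by positivity) k
  rw [div_le_iff₀ (by positivity), mul_pow, mul_add, mul_one, Real.exp_add] at h
  have hck : 0 < c ^ k := by positivity
  calc (1 + t) ^ k = (c ^ k)⁻¹ * (c ^ k * (1 + t) ^ k) := by field_simp
    _ ≤ (c ^ k)⁻¹ * (Real.exp c * Real.exp (c * t) * k.factorial) := by gcongr
    _ = _ := by ring

lemma integrable_exp_neg_norm {c : ℝ} (hc : 0 < c) :
    Integrable fun x : Cn n => Real.exp (-c * ‖x‖) := by
  set k : ℕ := Module.finrank ℝ (Cn n) + 1 with hk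
  obtain ⟨C, hC, h⟩ := one_add_pow_le_exp k hc
  have h1 : Integrable fun x : Cn n => (1 + ‖x‖) ^ (-(k : ℝ)) :=
    integrable_one_add_norm (by rw [hk]; push_cast; linarith)
  refine (h1.const_mul C).mono' (by fun_prop) (Filter.Eventually.of_forall fun x => ?_)
  rw [Real.norm_of_nonneg (Real.exp_pos _).le, Real.rpow_neg (by positivity), Real.rpow_natCast]
  have h2 := h ‖x‖ (norm_nonneg x)
  have h3 : 0 < (1 + ‖x‖) ^ k := by positivity
  rw [← div_eq_mul_inv, le_div_iff₀ h3]
  calc Real.exp (-c * ‖x‖) * (1 + ‖x‖) ^ k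
      ≤ Real.exp (-c * ‖x‖) * (C * Real.exp (c * ‖x‖)) := by gcongr
    _ = C * (Real.exp (-c * ‖x‖) * Real.exp (c * ‖x‖)) := by ring
    _ = C := by rw [← Real.exp_add]; simp

lemma linear_sub_sq_le (A : ℝ) {c : ℝ} (hc : 0 < c) (t : ℝ) :
    A * t - c * t ^ 2 ≤ A ^ 2 / (4 * c) := by
  rw [le_div_iff₀ (by positivity)]
  nlinarith [sq_nonneg (A - 2 * c * t)]

/-- A Gaussian with a linear term and a polynomial factor is dominated by an exponential. -/
lemma exists_gaussian_le (k : ℕ) (A : ℝ) {c : ℝ} (hc : 0 < c) :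
    ∃ C : ℝ, 0 < C ∧ ∀ t : ℝ, 0 ≤ t →
      (1 + t) ^ k * Real.exp (A * t - c * t ^ 2) ≤ C * Real.exp (-t) := by
  obtain ⟨C, hC, h⟩ := one_add_pow_le_exp k one_pos
  -- Of the 2 added to A, one unit pays for the polynomial factor and one for the surviving e^{-t};
  -- the rest is the maximum of a concave parabola.
  refine ⟨C * Real.exp ((A + 2) ^ 2 / (4 * c)), by positivity, fun t ht => ?_⟩
  calc (1 + t) ^ k * Real.exp (A * t - c * t ^ 2)
      ≤ (C * Real.exp (1 * t)) * Real.exp (A * t - c * t ^ 2) := by gcongr; exact h t ht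
    _ = C * Real.exp (((A + 2) * t - c * t ^ 2) + -t) := by
        rw [mul_assoc, ← Real.exp_add]; congr 2; ring
    _ ≤ C * Real.exp ((A + 2) ^ 2 / (4 * c) + -t) := by
        gcongr; exact linear_sub_sq_le _ hc t
    _ = _ := by rw [Real.exp_add]; ring

end Elementary

/-! ### Young's inequality for L¹ ∗ L² -/

section Young

/-- Young's inequality `L¹ * L² → L²`. -/
lemma lintegral_sq_convolution_le {k G : Cn n → ENNReal} (hk : Measurable k) (hG : Measurable G) :
    ∫⁻ x, (∫⁻ w, k (x - w) * G w) ^ 2 ≤ (∫⁻ z, k z) ^ 2 * ∫⁻ w, G w ^ 2 := by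
  have hk' : ∀ x, Measurable fun w => k (x - w) := fun x => hk.comp (by fun_prop)
  have hpt : ∀ x, (∫⁻ w, k (x - w) * G w) ^ 2 ≤ (∫⁻ z, k z) * ∫⁻ w, k (x - w) * G w ^ 2 := by
    intro x
    -- Cauchy–Schwarz after splitting k·G = k^{1/2} · (k^{1/2} G).
    have h := ENNReal.lintegral_mul_le_Lp_mul_Lq (volume : Measure (Cn n))
      (Real.HolderConjugate.two_two) (f := fun w => k (x - w) ^ (1 / 2 : ℝ))
      (g := fun w => k (x - w) ^ (1 / 2 : ℝ) * G w)
      ((hk' x).pow_const _).aemeasurable (((hk' x).pow_const _).mul hG).aemeasurable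
    have e1 : ∀ w, ((fun w => k (x - w) ^ (1 / 2 : ℝ)) *
        fun w => k (x - w) ^ (1 / 2 : ℝ) * G w) w = k (x - w) * G w := by
      intro w
      simp only [Pi.mul_apply]
      rw [← mul_assoc, ← ENNReal.rpow_add_of_nonneg _ _ (by norm_num) (by norm_num)]
      norm_num
    have e2 : ∀ w, (k (x - w) ^ (1 / 2 : ℝ)) ^ (2 : ℝ) = k (x - w) := by
      intro w; rw [← ENNReal.rpow_mul]; norm_num
    have e3 : ∀ w, (k (x - w) ^ (1 / 2 : ℝ) * G w) ^ (2 : ℝ) = k (x - w) * G w ^ 2 := by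
      intro w; rw [ENNReal.mul_rpow_of_nonneg _ _ (by norm_num), e2]; norm_num
    simp only [e1, e2, e3] at h
    rw [lintegral_sub_left_eq_self (fun z => k z) x] at h
    calc (∫⁻ w, k (x - w) * G w) ^ 2
        ≤ ((∫⁻ z, k z) ^ (1 / 2 : ℝ) * (∫⁻ w, k (x - w) * G w ^ 2) ^ (1 / 2 : ℝ)) ^ 2 := by
          gcongr
      _ = _ := by
          rw [mul_pow, ← ENNReal.rpow_natCast, ← ENNReal.rpow_natCast, ← ENNReal.rpow_mul,
            ← ENNReal.rpow_mul]
          norm_num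
  calc ∫⁻ x, (∫⁻ w, k (x - w) * G w) ^ 2
      ≤ ∫⁻ x, (∫⁻ z, k z) * ∫⁻ w, k (x - w) * G w ^ 2 := lintegral_mono hpt
    _ = (∫⁻ z, k z) * ∫⁻ x, ∫⁻ w, k (x - w) * G w ^ 2 := by
        rw [lintegral_const_mul]
        refine Measurable.lintegral_prod_right' (f := fun p : Cn n × Cn n =>
          k (p.1 - p.2) * G p.2 ^ 2) ?_
        exact (hk.comp (by fun_prop)).mul ((hG.comp measurable_snd).pow_const _)
    _ = (∫⁻ z, k z) * ∫⁻ w, ∫⁻ x, k (x - w) * G w ^ 2 := by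
        rw [lintegral_lintegral_swap]
        exact ((hk.comp (by fun_prop)).mul ((hG.comp measurable_snd).pow_const _)).aemeasurable
    _ = (∫⁻ z, k z) * ∫⁻ w, (∫⁻ z, k z) * G w ^ 2 := by
        congr 1
        refine lintegral_congr fun w => ?_
        have hkw : Measurable fun x => k (x - w) := hk.comp (by fun_prop)
        rw [lintegral_mul_const _ hkw,
          lintegral_sub_right_eq_self (fun z => k z) w]
    _ = _ := by
        rw [lintegral_const_mul _ (hG.pow_const _)]; ring

/-- A function that is pointwise bounded by a convolution is controlled in `L²`. -/
lemma eLpNorm_le_of_convolution {f g : Cn n → ℂ} {k : Cn n → ℝ} (hk : Measurable k)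
    (hg : AEStronglyMeasurable g volume)
    (h : ∀ x, ‖f x‖ₑ ≤ ∫⁻ w, ‖k (x - w)‖ₑ * ‖g w‖ₑ) :
    eLpNorm f 2 volume ≤ (∫⁻ z, ‖k z‖ₑ) * eLpNorm g 2 volume := by
  set G : Cn n → ENNReal := fun w => ‖hg.mk g w‖ₑ with hGdef
  have hG : Measurable G := hg.stronglyMeasurable_mk.enorm
  have hae : ∀ᵐ w, ‖g w‖ₑ = G w := by
    filter_upwards [hg.ae_eq_mk] with w hw; rw [hGdef, hw]
  have h' : ∀ x, ‖f x‖ₑ ≤ ∫⁻ w, ‖k (x - w)‖ₑ * G w := fun x => by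
    refine (h x).trans (le_of_eq (lintegral_congr_ae ?_))
    filter_upwards [hae] with w hw; rw [hw]
  have hsq : ∀ u : Cn n → ℂ, eLpNorm u 2 volume = (∫⁻ x, ‖u x‖ₑ ^ 2) ^ (1 / 2 : ℝ) := fun u => by
    rw [eLpNorm_eq_lintegral_rpow_enorm_toReal (by norm_num) (by norm_num)]
    norm_num
  have h2 : ∫⁻ w, ‖g w‖ₑ ^ 2 = ∫⁻ w, G w ^ 2 := lintegral_congr_ae (by
    filter_upwards [hae] with w hw; rw [hw])
  rw [hsq, hsq, h2]
  have h3 : ∫⁻ x, ‖f x‖ₑ ^ 2 ≤ (∫⁻ z, ‖k z‖ₑ) ^ 2 * ∫⁻ w, G w ^ 2 :=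
    (lintegral_mono fun x => by gcongr; exact h' x).trans
      (lintegral_sq_convolution_le (k := fun z => ‖k z‖ₑ) hk.enorm hG)
  calc (∫⁻ x, ‖f x‖ₑ ^ 2) ^ (1 / 2 : ℝ)
      ≤ ((∫⁻ z, ‖k z‖ₑ) ^ 2 * ∫⁻ w, G w ^ 2) ^ (1 / 2 : ℝ) := by gcongr
    _ = _ := by
      rw [ENNReal.mul_rpow_of_nonneg _ _ (by norm_num), ← ENNReal.rpow_natCast,
        ← ENNReal.rpow_mul]
      norm_num

end Young

/-! ### The mean value property against circle invariant densities -/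

section MeanValue

lemma measurePreserving_circle_smul (θ : ℝ) :
    MeasurePreserving (fun z : Cn n => Complex.exp (θ * Complex.I) • z) := by
  have h := volume_preserving_pi (ι := Fin n) (fun _ => (rotation (Circle.exp θ)).measurePreserving)
  convert h using 2 with z
  ext i
  simp [rotation_apply]

lemma integral_circle_smul (θ : ℝ) (f : Cn n → ℂ) :
    ∫ z : Cn n, f (Complex.exp (θ * Complex.I) • z) = ∫ z, f z :=
  (measurePreserving_circle_smul θ).integral_comp
    (Homeomorph.smulOfNeZero _ (Complex.exp_ne_zero _)).measurableEmbedding f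

/-- The mean value property of entire functions against a circle invariant density. -/
lemma integral_circle_invariant {g : Cn n → ℂ} (hg : Differentiable ℂ g) {ρ : Cn n → ℝ}
    (hρ : ∀ (θ : ℝ) (z : Cn n), ρ (Complex.exp (θ * Complex.I) • z) = ρ z)
    (hρc : Continuous ρ) (hint : Integrable fun z => (ρ z : ℂ) * g z) :
    ∫ z, (ρ z : ℂ) * g z = (∫ z, (ρ z : ℂ)) * g 0 := by
  have hcont : Continuous fun p : ℝ × Cn n =>
      (ρ p.2 : ℂ) * g (Complex.exp (p.1 * Complex.I) • p.2) := by
    have := hg.continuous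
    fun_prop
  have hpi : (0 : ℝ) ≤ 2 * Real.pi := by positivity
  have h1 : ∀ θ : ℝ, ∫ z, (ρ z : ℂ) * g (Complex.exp (θ * Complex.I) • z) =
      ∫ z, (ρ z : ℂ) * g z := fun θ => by
    rw [← integral_circle_smul θ (fun z => (ρ z : ℂ) * g z)]
    simp only [hρ]
  have h1i : ∀ θ : ℝ, Integrable fun z => (ρ z : ℂ) * g (Complex.exp (θ * Complex.I) • z) :=
    fun θ => by
      have := (measurePreserving_circle_smul (n := n) θ).integrable_comp_of_integrable hint
      refine this.congr (Filter.Eventually.of_forall fun z => ?_)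
      simp only [Function.comp, hρ]
  have h1n : ∀ θ : ℝ, ∫ z, ‖(ρ z : ℂ) * g (Complex.exp (θ * Complex.I) • z)‖ =
      ∫ z, ‖(ρ z : ℂ) * g z‖ := fun θ => by
    have h := (measurePreserving_circle_smul (n := n) θ).integral_comp
      (Homeomorph.smulOfNeZero _ (Complex.exp_ne_zero _)).measurableEmbedding
      (fun z => ‖(ρ z : ℂ) * g z‖)
    rw [← h]
    simp only [hρ]
  have hprod : Integrable (Function.uncurry fun (θ : ℝ) (z : Cn n) =>
      (ρ z : ℂ) * g (Complex.exp (θ * Complex.I) • z))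
      ((volume.restrict (Set.Ioc 0 (2 * Real.pi))).prod volume) := by
    rw [integrable_prod_iff (by exact hcont.aestronglyMeasurable)]
    refine ⟨Filter.Eventually.of_forall h1i, ?_⟩
    simp only [Function.uncurry]
    simp only [h1n]
    exact integrable_const _
  -- Averaging over rotations does not change the integral; exchanging the order leaves, for each z,
  -- the circle average of ζ ↦ g(ζz), which is g(0).
  have h2 := integral_integral_swap hprod
  simp only [h1] at h2
  have h3 : ∀ z : Cn n, ∫ θ in Set.Ioc 0 (2 * Real.pi),
      (ρ z : ℂ) * g (Complex.exp (θ * Complex.I) • z) = (ρ z : ℂ) * (2 * Real.pi * g 0) := by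
    intro z
    rw [integral_const_mul]
    congr 1
    have hd : Differentiable ℂ fun ζ : ℂ => g (ζ • z) :=
      hg.comp (differentiable_id.smul_const z)
    have h4 := (hd.diffContOnCl (s := Metric.ball 0 |1|)).circleAverage
    simp only [Real.circleAverage, circleMap, zero_add, Complex.ofReal_one, one_mul, zero_smul,
      intervalIntegral.integral_of_le hpi] at h4
    rw [← h4, Complex.real_smul]
    push_cast
    have : (2 * Real.pi : ℂ) ≠ 0 := by
      simp [Real.pi_ne_zero]
    rw [mul_inv_cancel_left₀ this]
  simp only [h3] at h2
  rw [integral_mul_const] at h2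
  simp only [integral_const, measureReal_restrict_apply_univ, Real.volume_real_Ioc_of_le hpi,
    sub_zero, Complex.real_smul] at h2
  have hne : ((2 * Real.pi : ℝ) : ℂ) ≠ 0 := by
    exact_mod_cast (by positivity : (2 * Real.pi : ℝ) ≠ 0)
  apply mul_left_cancel₀ hne
  rw [h2]; push_cast; ring

end MeanValue

/-! ### Integration by parts with a Lipschitz coefficient -/

section Parts

/-- Integration by parts against a merely Lipschitz factor. -/
lemma norm_integral_mul_lineDeriv_le {q F F' : Cn n → ℂ} {e : Cn n} {L B : ℝ}
    (hqL : ∀ x (s : ℝ), ‖q (x + s • e) - q x‖ ≤ L * |s|) (hqb : ∀ x, ‖q x‖ ≤ B)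
    (hqc : Continuous q) (hF : Integrable F) (hFc' : Continuous F')
    (hFi' : Integrable F') (hd : ∀ x, HasLineDerivAt ℝ F (F' x) x e) :
    ‖∫ x, q x * F' x‖ ≤ L * ∫ x, ‖F x‖ := by
  have hL : 0 ≤ L := by
    have := (norm_nonneg _).trans (hqL 0 1)
    simpa using this
  have hder : ∀ x (s : ℝ), HasDerivAt (fun t : ℝ => F (x + t • e)) (F' (x + s • e)) s := by
    intro x s
    have h : HasDerivAt (fun t : ℝ => F (x + s • e + t • e)) (F' (x + s • e)) 0 :=
      hd (x + s • e)
    rw [← sub_self s] at h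
    have h2 := HasDerivAt.scomp (𝕜' := ℝ) (h := fun t => t - s) s h
      ((hasDerivAt_id s).sub_const s)
    simp only [one_smul] at h2
    refine h2.congr_of_eventuallyEq (Filter.Eventually.of_forall fun t => ?_)
    simp only [Function.comp]
    congr 1
    rw [add_assoc, ← add_smul]; congr 2; ring
  -- g is the derivative of G(t) = ∫ q F(·+te). The increments of G are estimated by moving the
  -- translation onto q, where the Lipschitz bound suffices; dividing by t and letting t → 0+ bounds
  -- g(0).
  set g : ℝ → ℂ := fun s => ∫ x, q x * F' (x + s • e) with hg
  have hgt : ∀ s, g s = ∫ x, q (x - s • e) * F' x := fun s => by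
    rw [hg, ← integral_add_right_eq_self _ (s • e)]
    simp
  have hgc : Continuous g := by
    have : g = fun s => ∫ x, q (x - s • e) * F' x := funext hgt
    rw [this]
    refine continuous_of_dominated (bound := fun x => B * ‖F' x‖) (fun s => ?_)
      (fun s => Filter.Eventually.of_forall fun x => ?_) (hFi'.norm.const_mul _)
      (Filter.Eventually.of_forall fun x => by fun_prop)
    · exact (Continuous.mul (by fun_prop) hFc').aestronglyMeasurable
    · rw [norm_mul]; gcongr; exact hqb _
  have hmulint : ∀ s : ℝ, Integrable fun x => q x * F (x + s • e) := fun s =>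
    (hF.comp_add_right (s • e)).bdd_mul hqc.aestronglyMeasurable (Filter.Eventually.of_forall hqb)
  set G : ℝ → ℂ := fun t => ∫ x, q x * F (x + t • e) with hG
  have hGt : ∀ t, G t = ∫ x, q (x - t • e) * F x := fun s => by
    rw [hG, ← integral_add_right_eq_self _ (s • e)]
    simp
  have hGdiff : ∀ t, 0 ≤ t → G t - G 0 = ∫ s in (0 : ℝ)..t, g s := by
    intro t ht
    have hprod : Integrable (Function.uncurry fun (s : ℝ) (x : Cn n) => q x * F' (x + s • e))
        ((volume.restrict (Set.Ioc 0 t)).prod volume) := by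
      have hc : Continuous (Function.uncurry fun (s : ℝ) (x : Cn n) => q x * F' (x + s • e)) := by
        simp only [Function.uncurry_def]; fun_prop
      rw [integrable_prod_iff hc.aestronglyMeasurable]
      refine ⟨Filter.Eventually.of_forall fun s => ?_, ?_⟩
      · exact (hFi'.comp_add_right (s • e)).bdd_mul hqc.aestronglyMeasurable
          (Filter.Eventually.of_forall hqb)
      · refine Integrable.mono' (g := fun _ => B * ∫ x, ‖F' x‖) (integrable_const _)
          hc.aestronglyMeasurable.norm.integral_prod_right'
          (Filter.Eventually.of_forall fun s => ?_)
        rw [Real.norm_of_nonneg (integral_nonneg fun _ => norm_nonneg _), ← integral_const_mul,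
          ← integral_add_right_eq_self (fun x => B * ‖F' x‖) (s • e)]
        refine integral_mono_of_nonneg (Filter.Eventually.of_forall fun _ => norm_nonneg _)
          ((hFi'.comp_add_right (s • e)).norm.const_mul _) (Filter.Eventually.of_forall fun x => ?_)
        simp only [Function.uncurry, norm_mul]
        gcongr; exact hqb _
    rw [intervalIntegral.integral_of_le ht, hg, integral_integral_swap hprod, hG,
      ← integral_sub (hmulint t) (hmulint 0)]
    refine integral_congr_ae (Filter.Eventually.of_forall fun x => ?_)
    simp only
    rw [integral_const_mul, ← intervalIntegral.integral_of_le ht,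
      intervalIntegral.integral_eq_sub_of_hasDerivAt (f := fun t : ℝ => F (x + t • e))
        (fun s _ => hder x s) (Continuous.intervalIntegrable (by fun_prop) _ _)]
    ring
  have hbound : ∀ t, 0 ≤ t → ‖G t - G 0‖ ≤ (L * ∫ x, ‖F x‖) * t := by
    intro t ht
    have i1 : ∀ t : ℝ, Integrable fun x => q (x - t • e) * F x := fun t =>
      hF.bdd_mul (Continuous.aestronglyMeasurable (by fun_prop))
        (Filter.Eventually.of_forall fun x => hqb _)
    rw [hGt, hGt, ← integral_sub (i1 _) (i1 _), mul_right_comm, ← integral_const_mul]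
    refine norm_integral_le_of_norm_le (hF.norm.const_mul _)
      (Filter.Eventually.of_forall fun x => ?_)
    rw [← sub_mul, norm_mul, zero_smul, sub_zero]
    gcongr
    have := hqL x (-t)
    rwa [abs_neg, abs_of_nonneg ht, neg_smul, ← sub_eq_add_neg] at this
  have hder2 : HasDerivAt (fun t => ∫ s in (0 : ℝ)..t, g s) (g 0) 0 :=
    intervalIntegral.integral_hasDerivAt_right (hgc.intervalIntegrable _ _)
      (hgc.stronglyMeasurableAtFilter _ _) hgc.continuousAt
  have hlim := hder2.tendsto_slope_zero_right
  have h0 : g 0 = ∫ x, q x * F' x := by simp [hg]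
  rw [← h0]
  refine le_of_tendsto hlim.norm ?_
  filter_upwards [self_mem_nhdsWithin] with t ht
  have ht' : 0 < t := ht
  rw [zero_add, intervalIntegral.integral_same, sub_zero, ← hGdiff t ht'.le, norm_smul, norm_inv,
    Real.norm_of_nonneg ht'.le, inv_mul_le_iff₀ ht', mul_comm]
  exact hbound t ht'.le

end Parts

/-! ### Reduction of weighted spaces to flat L² -/

section Weighted

/-- The reduced function `u e^{-φ/h}`. -/
def red (φ : Cn n → ℝ) (h : ℝ) (u : Cn n → ℂ) (x : Cn n) : ℂ := u x * Real.exp (-φ x / h)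

lemma continuous_red {φ : Cn n → ℝ} (hφ : Continuous φ) {h : ℝ} {u : Cn n → ℂ}
    (hu : Continuous u) : Continuous (red φ h u) := by unfold red; fun_prop

lemma norm_red (φ : Cn n → ℝ) (h : ℝ) (u : Cn n → ℂ) (x : Cn n) :
    ‖red φ h u x‖ = ‖u x‖ * Real.exp (-φ x / h) := by
  rw [red, norm_mul, Complex.norm_real, Real.norm_of_nonneg (Real.exp_pos _).le]

lemma measurable_weight {φ : Cn n → ℝ} (hφ : Continuous φ) (h : ℝ) :
    Measurable fun x => ENNReal.ofReal (Real.exp (-2 * φ x / h)) :=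
  (Continuous.measurable (by fun_prop)).ennreal_ofReal

lemma integral_wMeasure {φ : Cn n → ℝ} (hφ : Continuous φ) (h : ℝ) {E : Type*}
    [NormedAddCommGroup E] [NormedSpace ℝ E] (F : Cn n → E) :
    ∫ x, F x ∂(wMeasure φ h) = ∫ x, Real.exp (-2 * φ x / h) • F x := by
  rw [wMeasure, integral_withDensity_eq_integral_toReal_smul (measurable_weight hφ h)
    (Filter.Eventually.of_forall fun x => ENNReal.ofReal_lt_top)]
  simp only [ENNReal.toReal_ofReal (Real.exp_pos _).le]

lemma exp_two (a h : ℝ) : Real.exp (-2 * a / h) = Real.exp (-a / h) * Real.exp (-a / h) := by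
  rw [← Real.exp_add]; congr 1; ring

/-- Multiplication by e^{-φ/h} is an isometry from the weighted to the flat L² space; the later
estimates are made on reduced functions. -/
lemma eLpNorm_wMeasure {φ : Cn n → ℝ} (hφ : Continuous φ) (h : ℝ) (u : Cn n → ℂ) :
    eLpNorm u 2 (wMeasure φ h) = eLpNorm (red φ h u) 2 volume := by
  rw [eLpNorm_eq_lintegral_rpow_enorm_toReal (by norm_num) (by norm_num),
    eLpNorm_eq_lintegral_rpow_enorm_toReal (by norm_num) (by norm_num), wMeasure,
    lintegral_withDensity_eq_lintegral_mul_non_measurable _ (measurable_weight hφ h)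
      (Filter.Eventually.of_forall fun x => ENNReal.ofReal_lt_top)]
  congr 1
  refine lintegral_congr fun x => ?_
  simp only [Pi.mul_apply, red, enorm_mul, ENNReal.toReal_ofNat]
  rw [ENNReal.mul_rpow_of_nonneg _ _ (by norm_num), mul_comm]
  congr 1
  rw [exp_two, ENNReal.ofReal_mul (Real.exp_pos _).le]
  have : ‖((Real.exp (-φ x / h) : ℝ) : ℂ)‖ₑ = ENNReal.ofReal (Real.exp (-φ x / h)) := by
    rw [← ofReal_norm, Complex.norm_real, Real.norm_of_nonneg (Real.exp_pos _).le]
  rw [this]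
  norm_num [sq]

lemma memLp_wMeasure_iff {φ : Cn n → ℝ} (hφ : Continuous φ) (h : ℝ) {u : Cn n → ℂ}
    (hu : Continuous u) : MemLp u 2 (wMeasure φ h) ↔ MemLp (red φ h u) 2 volume := by
  unfold MemLp
  rw [eLpNorm_wMeasure hφ]
  simp [hu.aestronglyMeasurable, (continuous_red hφ hu).aestronglyMeasurable]

lemma mem_HSpace_iff {φ : Cn n → ℝ} (hφ : Continuous φ) (h : ℝ) {u : Cn n → ℂ} :
    u ∈ HSpace φ h ↔ Differentiable ℂ u ∧ MemLp (red φ h u) 2 volume := by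
  change (Differentiable ℂ u ∧ MemLp u 2 (wMeasure φ h)) ↔ _
  constructor
  · rintro ⟨h1, h2⟩; exact ⟨h1, (memLp_wMeasure_iff hφ h h1.continuous).1 h2⟩
  · rintro ⟨h1, h2⟩; exact ⟨h1, (memLp_wMeasure_iff hφ h h1.continuous).2 h2⟩

lemma wNorm_eq {φ : Cn n → ℝ} (hφ : Continuous φ) (h : ℝ) {u : Cn n → ℂ}
    (hu : MemLp (red φ h u) 2 volume) :
    wNorm φ h u = (eLpNorm (red φ h u) 2 volume).toReal := by
  rw [wNorm, integral_wMeasure hφ, hu.eLpNorm_eq_integral_rpow_norm (by norm_num) (by norm_num),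
    ENNReal.toReal_ofReal (by positivity), Real.sqrt_eq_rpow]
  norm_num
  congr 2
  ext x
  rw [norm_red, mul_pow, ← neg_mul, exp_two]; ring

lemma wInner_eq {φ : Cn n → ℝ} (hφ : Continuous φ) (h : ℝ) (u v : Cn n → ℂ) :
    wInner φ h u v = ∫ x, red φ h u x * conj (red φ h v x) := by
  rw [wInner, integral_wMeasure hφ]
  refine integral_congr_ae (Filter.Eventually.of_forall fun x => ?_)
  simp only [red, exp_two, map_mul, Complex.conj_ofReal, Complex.real_smul]
  push_cast; ring

lemma norm_integral_mul_le {f g : Cn n → ℂ} (hf : MemLp f 2 volume) (hg : MemLp g 2 volume) :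
    ∫ x, ‖f x‖ * ‖g x‖ ≤ (eLpNorm f 2 volume).toReal * (eLpNorm g 2 volume).toReal := by
  have h := integral_mul_norm_le_Lp_mul_Lq (μ := (volume : Measure (Cn n)))
    Real.HolderConjugate.two_two (f := f) (g := g) (by simpa using hf) (by simpa using hg)
  rw [hf.eLpNorm_eq_integral_rpow_norm (by norm_num) (by norm_num),
    hg.eLpNorm_eq_integral_rpow_norm (by norm_num) (by norm_num),
    ENNReal.toReal_ofReal (by positivity), ENNReal.toReal_ofReal (by positivity)]
  refine h.trans (le_of_eq ?_)
  norm_num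

lemma integrable_norm_mul {f g : Cn n → ℂ} (hf : MemLp f 2 volume) (hg : MemLp g 2 volume) :
    Integrable fun x => ‖f x‖ * ‖g x‖ := by
  have := MemLp.integrable_mul hf.norm hg.norm
  exact this

end Weighted

/-! ### Translation of the contour along the fibres -/

namespace Weight
variable (P : Weight n)

/-- The tubular neighbourhood `{(z, θ) : |θ - ξ(z)| < ρ}` of `Λ_φ`. -/
def tube (ρ : ℝ) : Set (Cn n × Cn n) := {p | ‖p.2 - P.theta p.1‖ < ρ}

lemma isOpen_tube (ρ : ℝ) : IsOpen (P.tube ρ) :=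
  isOpen_lt (by fun_prop) continuous_const

lemma mem_tube {ρ : ℝ} {m v : Cn n} : (m, P.theta m + v) ∈ P.tube ρ ↔ ‖v‖ < ρ := by
  simp [tube]

/-- The integral of a decaying holomorphic function over a translate of `Λ_φ` along the fibres does
not depend on the translate. -/
lemma integral_tube_shift {ρ C c : ℝ} (hc : 0 < c) {g : Cn n × Cn n → ℂ}
    (hg : DifferentiableOn ℂ g (P.tube ρ))
    (hb : ∀ m v, ‖v‖ < ρ → ‖g (m, P.theta m + v)‖ ≤ C * Real.exp (-c * ‖m‖))
    {v : Cn n} (hv : ‖v‖ < ρ) :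
    ∫ m, g (m, P.theta m + v) = ∫ m, g (m, P.theta m) := by
  obtain ⟨q, hq⟩ := P.hvec_surjective ((1 / (2 * Complex.I)) • v)
  have hv2 : v = (2 * Complex.I) • P.hvec q := by
    rw [hq, smul_smul]
    rw [mul_one_div_cancel (by simp), one_smul]
  -- For fixed m this is a complex affine line in τ, along which g is holomorphic. Relative to its
  -- own base point m + iτq it lies at height -(Im τ)·v over Λ: the complex linear S-part moves
  -- along Λ, and only the conjugate linear H-part leaves a vertical displacement. Translating m
  -- back, F depends on Im τ alone, and τ = -i corresponds to the shift v.
  set pt : ℂ → Cn n → Cn n × Cn n := fun τ m =>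
    (m + τ • (Complex.I • q), P.theta m + τ • (P.svec q - P.hvec q)) with hpt
  have hpt2 : ∀ τ m, pt τ m = (m + (τ * Complex.I) • q,
      P.theta (m + (τ * Complex.I) • q) + (-τ.im : ℂ) • v) := by
    intro τ m
    simp only [hpt, smul_smul]
    congr 1
    rw [theta_add, add_assoc]
    congr 1
    simp only [theta, svec_smul, hvec_smul, hv2]
    ext j
    have h1 : conj τ = τ - 2 * τ.im * Complex.I := by
      apply Complex.ext <;> simp; ring
    simp only [Pi.add_apply, Pi.smul_apply, Pi.sub_apply, smul_eq_mul, map_mul, Complex.conj_I, h1]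
    linear_combination (τ * (P.svec q j) - τ * P.hvec q j + 2 * τ.im * Complex.I * P.hvec q j) *
      Complex.I_sq
  set Ω : Set ℂ := {τ | |τ.im| * ‖v‖ < ρ} with hΩ
  have hΩo : IsOpen Ω := isOpen_lt (by fun_prop) continuous_const
  have hΩc : Convex ℝ Ω := by
    have : Ω = {τ : ℂ | ‖τ.im • v‖ < ρ} := by ext τ; simp [hΩ, norm_smul]
    rw [this]
    intro a ha b hb s t hs ht hst
    simp only [Set.mem_ofPred_eq] at *
    have e : (s • a + t • b).im • v = s • (a.im • v) + t • (b.im • v) := by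
      simp [add_smul, mul_smul]
    rw [e]
    have := (convex_ball (0 : Cn n) ρ) (mem_ball_zero_iff.2 ha) (mem_ball_zero_iff.2 hb) hs ht hst
    exact mem_ball_zero_iff.1 this
  have hnv : ∀ τ : ℂ, ‖(-τ.im : ℂ) • v‖ = |τ.im| * ‖v‖ := fun τ => by
    rw [norm_smul, norm_neg, Complex.norm_real, Real.norm_eq_abs]
  have hmem : ∀ τ ∈ Ω, ∀ m, pt τ m ∈ P.tube ρ := fun τ hτ m => by
    rw [hpt2, mem_tube, hnv]; exact hτ
  set F : ℂ → ℂ := fun τ => ∫ m, g (pt τ m) with hF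
  have hFim : ∀ τ, F τ = ∫ m, g (m, P.theta m + (-τ.im : ℂ) • v) := fun τ => by
    simp only [hF, hpt2]
    exact integral_add_right_eq_self
      (fun m => g (m, P.theta m + (-τ.im : ℂ) • v)) ((τ * Complex.I) • q)
  have hgc : ContinuousOn g (P.tube ρ) := hg.continuousOn
  have hFd : ∀ τ ∈ Ω, DifferentiableAt ℂ F τ := by
    intro τ hτ
    obtain ⟨r, hr, hball⟩ := Metric.isOpen_iff.1 hΩo τ hτ
    have hC : 0 ≤ C := by
      have h0 := (norm_nonneg _).trans (hb 0 v hv)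
      simpa using h0
    refine (hasFDerivAt_integral_of_holomorphic (k := fun τ m => g (pt τ m))
      (bound := fun m => C * Real.exp (c * ((‖τ‖ + r) * ‖q‖)) * Real.exp (-c * ‖m‖))
      hr ?_ ?_ ?_ ((integrable_exp_neg_norm hc).const_mul _)).1.differentiableAt
    · intro x hx
      refine Continuous.aestronglyMeasurable (hgc.comp_continuous ?_ fun m => hmem x (hball hx) m)
      simp only [hpt]; fun_prop
    · refine Filter.Eventually.of_forall fun m => ?_
      refine hg.comp (Differentiable.differentiableOn ?_) fun x hx => hmem x (hball hx) m
      simp only [hpt]; fun_prop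
    · refine Filter.Eventually.of_forall fun m x hx => ?_
      have hx' : ‖x‖ ≤ ‖τ‖ + r := by
        have : ‖x - τ‖ < r := by rwa [← dist_eq_norm]
        linarith [norm_sub_norm_le x τ]
      have h1 := hb (m + (x * Complex.I) • q) ((-x.im : ℂ) • v) (by rw [hnv]; exact hball hx)
      rw [hpt2]
      refine h1.trans ?_
      rw [mul_assoc, ← Real.exp_add]
      gcongr
      have h2 : ‖(x * Complex.I) • q‖ ≤ (‖τ‖ + r) * ‖q‖ := by
        rw [norm_smul, norm_mul, Complex.norm_I, mul_one]; gcongr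
      have h3 : ‖m‖ ≤ ‖m + (x * Complex.I) • q‖ + ‖(x * Complex.I) • q‖ := by
        have := norm_sub_le (m + (x * Complex.I) • q) ((x * Complex.I) • q)
        simpa using this
      nlinarith
  -- F is invariant under real translations of τ; its complex derivative, computed along the real
  -- direction, therefore vanishes.
  have hder : Set.EqOn (deriv F) 0 Ω := by
    intro τ hτ
    have h1 : HasDerivAt F (deriv F τ) (τ + ((0 : ℝ) : ℂ)) := by
      simpa using (hFd τ hτ).hasDerivAt
    have h2 : HasDerivAt (fun s : ℝ => τ + (s : ℂ)) 1 0 :=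
      (Complex.ofRealCLM.hasDerivAt (x := 0)).const_add τ
    have h3 := HasDerivAt.comp (𝕜' := ℂ) (0 : ℝ) h1 h2
    have h4 : (F ∘ fun s : ℝ => τ + (s : ℂ)) = fun _ => F τ := by
      ext s; simp only [Function.comp]; rw [hFim, hFim]; simp
    rw [h4, mul_one] at h3
    exact h3.unique (hasDerivAt_const _ _)
  have h0 : (0 : ℂ) ∈ Ω := by
    simp only [hΩ, Set.mem_ofPred_eq, Complex.zero_im, abs_zero, zero_mul]
    exact (norm_nonneg v).trans_lt hv
  have h1 : (-Complex.I) ∈ Ω := by simpa [hΩ] using hv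
  have h2 := hΩo.is_const_of_deriv_eq_zero hΩc.isPreconnected
    (fun τ hτ => (hFd τ hτ).differentiableWithinAt) hder h1 h0
  rw [hFim, hFim] at h2
  simpa using h2

end Weight

/-! ### Twisted reproducing kernel and Schwartz kernel: phases and pointwise bounds -/

namespace Weight

section Pair

@[fun_prop]
lemma continuous_pair {α : Type*} [TopologicalSpace α] {f g : α → Cn n} (hf : Continuous f)
    (hg : Continuous g) : Continuous fun a => pair (f a) (g a) := by
  unfold pair; fun_prop

@[fun_prop]
lemma differentiable_pair {E : Type*} [NormedAddCommGroup E] [NormedSpace ℂ E] {f g : E → Cn n}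
    (hf : Differentiable ℂ f) (hg : Differentiable ℂ g) :
    Differentiable ℂ fun a => pair (f a) (g a) := by
  unfold pair; fun_prop

lemma pair_add_left (s t v : Cn n) : pair (s + t) v = pair s v + pair t v := by
  simp [pair, add_mul, Finset.sum_add_distrib]

lemma pair_sub_left (s t v : Cn n) : pair (s - t) v = pair s v - pair t v := by
  simp [pair, sub_mul, Finset.sum_sub_distrib]

lemma pair_neg_left (t v : Cn n) : pair (-t) v = -pair t v := by simp [pair]

lemma pair_smul_left (c : ℂ) (t v : Cn n) : pair (c • t) v = c * pair t v := by
  simp [pair, Finset.mul_sum, mul_assoc]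

lemma pair_add_right (t v w : Cn n) : pair t (v + w) = pair t v + pair t w := by
  simp [pair, mul_add, Finset.sum_add_distrib]

lemma pair_smul_right (c : ℂ) (t v : Cn n) : pair t (c • v) = c * pair t v := by
  simp [pair, Finset.mul_sum, mul_left_comm]

@[simp] lemma pair_zero_left (v : Cn n) : pair 0 v = 0 := by simp [pair]
@[simp] lemma pair_zero_right (v : Cn n) : pair v 0 = 0 := by simp [pair]

lemma norm_pair_le (t v : Cn n) : ‖pair t v‖ ≤ n * ‖t‖ * ‖v‖ := by
  refine (norm_sum_le _ _).trans ?_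
  calc ∑ j, ‖t j * v j‖ ≤ ∑ _j : Fin n, ‖t‖ * ‖v‖ := by
        refine Finset.sum_le_sum fun j _ => ?_
        rw [norm_mul]
        exact mul_le_mul (norm_le_pi_norm t j) (norm_le_pi_norm v j) (norm_nonneg _) (norm_nonneg _)
    _ = n * ‖t‖ * ‖v‖ := by simp [mul_assoc]

end Pair

variable (P : Weight n)

lemma pair_hvec (t q : Cn n) : pair t (P.hvec q) = P.H t q := P.dot_hvec t q
lemma pair_svec (t q : Cn n) : pair t (P.svec q) = P.S q t := by
  rw [P.symm]; rw [← P.symm]; exact P.dot_svec t q |>.trans (by rw [P.symm])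

lemma I_mul_pair_theta (t m : Cn n) : Complex.I * pair t (P.theta m) = P.S m t + P.H t m := by
  rw [theta, pair_smul_right, pair_add_right, pair_hvec, pair_svec]
  linear_combination (-P.S m t - P.H t m) * Complex.I_sq

/-- The exponent of the reproducing kernel of `H_φ`, twisted by the linear form `i η`. -/
def repExp (η y w : Cn n) : ℂ :=
  (1 / 2) * P.S y y - (1 / 2) * P.S w w + P.H (y - w) w + Complex.I * pair (y - w) η

/-- The (unnormalized) twisted reproducing kernel, times `e^{-2φ(w)/h}`. -/
def repKer (h : ℝ) (η y w : Cn n) : ℂ := Complex.exp (P.repExp η y w / h)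

/-- Completing the square: the term -½H(y-w,y-w) is the off-diagonal decay of the kernel relative to
e^{(Φ(y)-Φ(w))/h}. -/
lemma re_repExp (η y w : Cn n) : (P.repExp η y w).re = P.phi y - P.phi w -
    (1 / 2) * (P.H (y - w) (y - w)).re + (Complex.I * pair (y - w) η).re := by
  have h1 := P.H_re_symm y w
  have e1 : ((1 / 2 : ℂ) * P.S y y).re = 1 / 2 * (P.S y y).re := by
    rw [show (1 / 2 : ℂ) = ((1 / 2 : ℝ) : ℂ) by push_cast; rfl, Complex.re_ofReal_mul]
  have e2 : ((1 / 2 : ℂ) * P.S w w).re = 1 / 2 * (P.S w w).re := by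
    rw [show (1 / 2 : ℂ) = ((1 / 2 : ℝ) : ℂ) by push_cast; rfl, Complex.re_ofReal_mul]
  simp only [repExp, phi, map_sub, sub_apply, Complex.add_re, Complex.sub_re, e1, e2]
  linarith

lemma norm_exp_div (z : ℂ) (h : ℝ) : ‖Complex.exp (z / h)‖ = Real.exp (z.re / h) := by
  rw [Complex.norm_exp, Complex.div_ofReal_re]

/-- For a quadratic function the gradient at the midpoint gives the exact increment. The Weyl phase
thus transports the weight with neither gain nor loss, and decay in x-w has to come from moving the
contour. -/
lemma re_weylPhase (x y : Cn n) :
    (Complex.I * pair (x - y) (P.theta ((1 / 2 : ℂ) • (x + y)))).re = P.phi x - P.phi y := by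
  rw [I_mul_pair_theta]
  have h1 := P.H_re_symm x y
  have h2 := P.symm x y
  have hc : conj (1 / 2 : ℂ) = ((1 / 2 : ℝ) : ℂ) := by
    rw [map_div₀, map_one, map_ofNat]; push_cast; rfl
  rw [map_smul, map_smulₛₗ, hc]
  rw [show (1 / 2 : ℂ) = ((1 / 2 : ℝ) : ℂ) by push_cast; rfl]
  simp only [phi, map_add, map_sub, add_apply, sub_apply, smul_apply, smul_eq_mul, h2,
    Complex.add_re, Complex.sub_re, Complex.re_ofReal_mul]
  linarith

/-- The integrand of the twisted Schwartz kernel of the Weyl quantization, over the contour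
translated by `v`. -/
def kerInt (h : ℝ) (g : Cn n × Cn n → ℂ) (η x w v y : Cn n) : ℂ :=
  Complex.exp (Complex.I / h * pair (x - y) (P.theta ((1 / 2 : ℂ) • (x + y)) + v)) *
    g ((1 / 2 : ℂ) • (x + y), P.theta ((1 / 2 : ℂ) • (x + y)) + v) * P.repKer h η y w

/-- The twisted Schwartz kernel of the Weyl quantization. -/
def ker (h : ℝ) (g : Cn n × Cn n → ℂ) (η x w : Cn n) : ℂ := ∫ y, P.kerInt h g η x w 0 y

lemma norm_kerInt (h : ℝ) (g : Cn n × Cn n → ℂ) (η x w v y : Cn n) :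
    ‖P.kerInt h g η x w v y‖ = Real.exp ((P.phi x - P.phi w -
      (1 / 2) * (P.H (y - w) (y - w)).re + (Complex.I * pair (y - w) η).re +
      (Complex.I * pair (x - y) v).re) / h) *
      ‖g ((1 / 2 : ℂ) • (x + y), P.theta ((1 / 2 : ℂ) • (x + y)) + v)‖ := by
  have h1 : Complex.I / h * pair (x - y) (P.theta ((1 / 2 : ℂ) • (x + y)) + v) =
      (Complex.I * pair (x - y) (P.theta ((1 / 2 : ℂ) • (x + y))) +
        Complex.I * pair (x - y) v) / h := by
    rw [pair_add_right]; ring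
  rw [kerInt, repKer, norm_mul, norm_mul, h1, norm_exp_div, norm_exp_div, mul_right_comm,
    ← Real.exp_add, Complex.add_re, re_weylPhase, re_repExp]
  congr 2
  ring

lemma norm_repKer (h : ℝ) (η y w : Cn n) : ‖P.repKer h η y w‖ = Real.exp ((P.phi y - P.phi w -
    (1 / 2) * (P.H (y - w) (y - w)).re + (Complex.I * pair (y - w) η).re) / h) := by
  rw [repKer, norm_exp_div, re_repExp]

lemma re_I_pair_le (t v : Cn n) : (Complex.I * pair t v).re ≤ n * ‖t‖ * ‖v‖ := by
  refine (Complex.re_le_norm _).trans ?_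
  rw [norm_mul, Complex.norm_I, one_mul]
  exact norm_pair_le t v

/-- Gaussian bound for the twisted reproducing kernel. -/
lemma exists_norm_repKer_le {h : ℝ} (hh : 0 < h) (η : Cn n) : ∃ C : ℝ, 0 < C ∧ ∀ y w,
    ‖P.repKer h η y w‖ ≤ C * Real.exp ((P.phi y - P.phi w) / h) * Real.exp (-‖y - w‖) := by
  obtain ⟨c, hc, hlow⟩ := P.exists_lower
  obtain ⟨C, hC, hG⟩ := exists_gaussian_le 0 (n * ‖η‖ / h) (c := c / 2 / h) (by positivity)
  refine ⟨C, hC, fun y w => ?_⟩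
  rw [norm_repKer]
  have h1 := hG ‖y - w‖ (norm_nonneg _)
  rw [pow_zero, one_mul] at h1
  calc _ ≤ Real.exp ((P.phi y - P.phi w) / h +
        (n * ‖η‖ / h * ‖y - w‖ - c / 2 / h * ‖y - w‖ ^ 2)) := by
        apply Real.exp_le_exp.2
        have h2 := re_I_pair_le (y - w) η
        have h3 := hlow (y - w)
        have : (P.phi y - P.phi w) / h + (n * ‖η‖ / h * ‖y - w‖ - c / 2 / h * ‖y - w‖ ^ 2) =
            (P.phi y - P.phi w + n * ‖y - w‖ * ‖η‖ - c / 2 * ‖y - w‖ ^ 2) / h := by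
          field_simp; ring
        rw [this]
        gcongr
        linarith
    _ ≤ Real.exp ((P.phi y - P.phi w) / h) * (C * Real.exp (-‖y - w‖)) := by
        rw [Real.exp_add]; gcongr
    _ = _ := by ring

/-- Gaussian bound for the integrand of the Schwartz kernel of a symbol of polynomial growth. -/
lemma exists_norm_kerInt_le {h : ℝ} (hh : 0 < h) {A ρ : ℝ} {k : ℕ} (η : Cn n) :
    ∃ C : ℝ, 0 < C ∧ ∀ (g : Cn n × Cn n → ℂ) (x w v y : Cn n),
      ‖g ((1 / 2 : ℂ) • (x + y), P.theta ((1 / 2 : ℂ) • (x + y)) + v)‖ ≤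
        A * (1 + ‖(1 / 2 : ℂ) • (x + y)‖) ^ k → ‖v‖ < ρ →
      ‖P.kerInt h g η x w v y‖ ≤ C * Real.exp ((P.phi x - P.phi w) / h) * (1 + ‖x + w‖) ^ k *
        Real.exp (n * ρ / h * ‖x - w‖) * Real.exp (-‖y - w‖) := by
  obtain ⟨c, hc, hlow⟩ := P.exists_lower
  obtain ⟨C, hC, hG⟩ := exists_gaussian_le k (n * ‖η‖ / h + n * ρ / h) (c := c / 2 / h)
    (by positivity)
  refine ⟨(|A| + 1) * C, by positivity, fun g x w v y hg hv => ?_⟩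
  have hρ : 0 ≤ ρ := (norm_nonneg _).trans hv.le
  rw [norm_kerInt]
  have hmid : 1 + ‖(1 / 2 : ℂ) • (x + y)‖ ≤ (1 + ‖x + w‖) * (1 + ‖y - w‖) := by
    have e : (x + y : Cn n) = (x + w) + (y - w) := by abel
    have h1 : ‖(1 / 2 : ℂ) • (x + y)‖ ≤ ‖x + w‖ + ‖y - w‖ := by
      have h2 := norm_add_le (x + w) (y - w)
      rw [← e] at h2
      rw [norm_smul]
      norm_num
      linarith [norm_nonneg (x + y)]
    nlinarith [norm_nonneg (x + w), norm_nonneg (y - w)]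
  have h1 := hG ‖y - w‖ (norm_nonneg _)
  have hxy : ‖x - y‖ ≤ ‖x - w‖ + ‖y - w‖ := by
    have := norm_sub_le (x - w) (y - w)
    simpa using this
  have hexp : Real.exp ((P.phi x - P.phi w - (1 / 2) * (P.H (y - w) (y - w)).re +
      (Complex.I * pair (y - w) η).re + (Complex.I * pair (x - y) v).re) / h) ≤
      Real.exp ((P.phi x - P.phi w) / h) * Real.exp (n * ρ / h * ‖x - w‖) *
      Real.exp ((n * ‖η‖ / h + n * ρ / h) * ‖y - w‖ - c / 2 / h * ‖y - w‖ ^ 2) := by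
    rw [← Real.exp_add, ← Real.exp_add]
    apply Real.exp_le_exp.2
    have h2 := re_I_pair_le (y - w) η
    have h3 := hlow (y - w)
    have h4 : (Complex.I * pair (x - y) v).re ≤ n * (‖x - w‖ + ‖y - w‖) * ρ :=
      (re_I_pair_le (x - y) v).trans (by gcongr)
    have : (P.phi x - P.phi w) / h + n * ρ / h * ‖x - w‖ +
        ((n * ‖η‖ / h + n * ρ / h) * ‖y - w‖ - c / 2 / h * ‖y - w‖ ^ 2) =
        (P.phi x - P.phi w + n * (‖x - w‖ + ‖y - w‖) * ρ + n * ‖y - w‖ * ‖η‖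
          - c / 2 * ‖y - w‖ ^ 2) / h := by
      field_simp; ring
    rw [this]
    gcongr
    linarith
  have hg' : ‖g ((1 / 2 : ℂ) • (x + y), P.theta ((1 / 2 : ℂ) • (x + y)) + v)‖ ≤
      (|A| + 1) * ((1 + ‖x + w‖) * (1 + ‖y - w‖)) ^ k := by
    refine hg.trans ?_
    gcongr
    linarith [le_abs_self A]
  calc _ ≤ (Real.exp ((P.phi x - P.phi w) / h) * Real.exp (n * ρ / h * ‖x - w‖) *
        Real.exp ((n * ‖η‖ / h + n * ρ / h) * ‖y - w‖ - c / 2 / h * ‖y - w‖ ^ 2)) *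
        ((|A| + 1) * ((1 + ‖x + w‖) * (1 + ‖y - w‖)) ^ k) := by gcongr
    _ = (|A| + 1) * Real.exp ((P.phi x - P.phi w) / h) * Real.exp (n * ρ / h * ‖x - w‖) *
        (1 + ‖x + w‖) ^ k * ((1 + ‖y - w‖) ^ k *
        Real.exp ((n * ‖η‖ / h + n * ρ / h) * ‖y - w‖ - c / 2 / h * ‖y - w‖ ^ 2)) := by
        rw [mul_pow]; ring
    _ ≤ (|A| + 1) * Real.exp ((P.phi x - P.phi w) / h) * Real.exp (n * ρ / h * ‖x - w‖) *
        (1 + ‖x + w‖) ^ k * (C * Real.exp (-‖y - w‖)) := by gcongr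
    _ = _ := by ring

lemma continuous_kerInt {h ρ : ℝ} {g : Cn n × Cn n → ℂ} (hg : ContinuousOn g (P.tube ρ))
    (η : Cn n) {v : Cn n} (hv : ‖v‖ < ρ) :
    Continuous fun p : Cn n × Cn n × Cn n => P.kerInt h g η p.1 p.2.1 v p.2.2 := by
  have h1 : Continuous fun p : Cn n × Cn n × Cn n =>
      g ((1 / 2 : ℂ) • (p.1 + p.2.2), P.theta ((1 / 2 : ℂ) • (p.1 + p.2.2)) + v) :=
    hg.comp_continuous (by fun_prop) fun p => P.mem_tube.2 hv
  have h2 : Continuous fun p : Cn n × Cn n × Cn n => Complex.exp (Complex.I / h *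
      pair (p.1 - p.2.2) (P.theta ((1 / 2 : ℂ) • (p.1 + p.2.2)) + v)) := by fun_prop
  have h3 : Continuous fun p : Cn n × Cn n × Cn n => P.repKer h η p.2.2 p.2.1 := by
    unfold repKer repExp; fun_prop
  exact (h2.mul h1).mul h3

lemma integrable_exp_neg_norm_sub {c : ℝ} (hc : 0 < c) (w : Cn n) :
    Integrable fun y : Cn n => Real.exp (-c * ‖y - w‖) :=
  (integrable_exp_neg_norm hc).comp_sub_right w

lemma integrable_kerInt {h : ℝ} (hh : 0 < h) {A ρ : ℝ} {k : ℕ} {g : Cn n × Cn n → ℂ}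
    (hg : ContinuousOn g (P.tube ρ)) (hA : ∀ p ∈ P.tube ρ, ‖g p‖ ≤ A * (1 + ‖p.1‖) ^ k)
    (η x w : Cn n) {v : Cn n} (hv : ‖v‖ < ρ) : Integrable (P.kerInt h g η x w v) := by
  obtain ⟨C, hC, hb⟩ := P.exists_norm_kerInt_le hh (A := A) (ρ := ρ) (k := k) η
  have h1 : Integrable fun y : Cn n => Real.exp (-‖y - w‖) := by
    simpa using integrable_exp_neg_norm_sub one_pos w
  have h2 : Continuous fun y : Cn n => P.kerInt h g η x w v y := by
    have h3 : Continuous fun y : Cn n => (x, w, y) := by fun_prop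
    have h4 := (P.continuous_kerInt (h := h) hg η hv).comp h3
    simp only [Function.comp_def] at h4
    exact h4
  refine Integrable.mono' (h1.const_mul (C * Real.exp ((P.phi x - P.phi w) / h) *
    (1 + ‖x + w‖) ^ k * Real.exp (n * ρ / h * ‖x - w‖))) h2.aestronglyMeasurable
    (Filter.Eventually.of_forall fun y => ?_)
  have h5 : ((1 / 2 : ℂ) • (x + y), P.theta ((1 / 2 : ℂ) • (x + y)) + v) ∈ P.tube ρ :=
    P.mem_tube.2 hv
  have h6 := hA _ h5
  exact hb g x w v y h6 hv

/-- Change of variables to the midpoint. -/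
lemma integral_midpoint (f : Cn n → ℂ) (x : Cn n) : ∫ y, f y =
    |((2 : ℝ) ^ Module.finrank ℝ (Cn n))| • ∫ m, f ((2 : ℂ) • m - x) := by
  have h1 : ∫ m, f ((2 : ℂ) • m - x) = ∫ m, (fun y => f (y - x)) ((2 : ℝ) • m) := by
    refine integral_congr_ae (Filter.Eventually.of_forall fun m => ?_)
    simp only
    rw [real_smul_eq]; norm_num
  rw [h1, Measure.integral_comp_smul volume (fun y => f (y - x)) (2 : ℝ), smul_smul,
    integral_sub_right_eq_self f x, ← abs_mul,
    mul_inv_cancel₀ (by positivity), abs_one, one_smul]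

/-- The Schwartz kernel may be computed over any small translate of the contour. -/
lemma ker_eq_shift {h : ℝ} (hh : 0 < h) {A ρ : ℝ} {k : ℕ} {g : Cn n × Cn n → ℂ}
    (hg : DifferentiableOn ℂ g (P.tube ρ)) (hA : ∀ p ∈ P.tube ρ, ‖g p‖ ≤ A * (1 + ‖p.1‖) ^ k)
    (η x w : Cn n) {v : Cn n} (hv : ‖v‖ < ρ) :
    P.ker h g η x w = ∫ y, P.kerInt h g η x w v y := by
  obtain ⟨C, hC, hb⟩ := P.exists_norm_kerInt_le hh (A := A) (ρ := ρ) (k := k) η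
  -- In the midpoint variables (m, θ), with y = 2m - x, the integrand is holomorphic on the tube and
  -- the contour is the graph of `theta`.
  set G : Cn n × Cn n → ℂ := fun p => Complex.exp (Complex.I / h *
    pair (x - ((2 : ℂ) • p.1 - x)) p.2) * g p * P.repKer h η ((2 : ℂ) • p.1 - x) w with hG
  have hGd : DifferentiableOn ℂ G (P.tube ρ) := by
    have h1 : Differentiable ℂ fun p : Cn n × Cn n => Complex.exp (Complex.I / h *
        pair (x - ((2 : ℂ) • p.1 - x)) p.2) := by fun_prop
    have h2 : Differentiable ℂ fun p : Cn n × Cn n => P.repKer h η ((2 : ℂ) • p.1 - x) w := by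
      unfold repKer repExp; fun_prop
    exact (h1.differentiableOn.mul hg).mul h2.differentiableOn
  have hmid : ∀ m : Cn n, (1 / 2 : ℂ) • (x + ((2 : ℂ) • m - x)) = m := fun m => by
    rw [add_sub_cancel, smul_smul]; norm_num
  have hGk : ∀ m v, G (m, P.theta m + v) = P.kerInt h g η x w v ((2 : ℂ) • m - x) := by
    intro m v
    simp only [hG, kerInt, hmid]
  have hGb : ∀ m v, ‖v‖ < ρ → ‖G (m, P.theta m + v)‖ ≤
      (C * Real.exp ((P.phi x - P.phi w) / h) * (1 + ‖x + w‖) ^ k *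
        Real.exp (n * ρ / h * ‖x - w‖) * Real.exp ‖x + w‖) * Real.exp (-2 * ‖m‖) := by
    intro m v hv
    rw [hGk]
    refine (hb g x w v _ (hA _ (P.mem_tube.2 hv)) hv).trans ?_
    rw [mul_assoc _ (Real.exp ‖x + w‖), ← Real.exp_add]
    gcongr
    have e : (2 : ℂ) • m = ((2 : ℂ) • m - x - w) + (x + w) := by abel
    have h1 : ‖(2 : ℂ) • m‖ = 2 * ‖m‖ := by rw [norm_smul]; norm_num
    have h2 := norm_add_le ((2 : ℂ) • m - x - w) (x + w)
    rw [← e, h1] at h2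
    linarith
  have hcv : ∀ v, ∫ y, P.kerInt h g η x w v y =
      |((2 : ℝ) ^ Module.finrank ℝ (Cn n))| • ∫ m, G (m, P.theta m + v) := by
    intro v
    rw [integral_midpoint _ x]
    simp only [hGk]
  have hρ : 0 < ρ := (norm_nonneg _).trans_lt hv
  rw [ker, hcv, hcv]
  congr 1
  rw [P.integral_tube_shift two_pos hGd hGb hv]
  simp

end Weight

/-! ### The reproducing formula and its derivative -/

lemma memLp_exp_neg_norm_sub {c : ℝ} (hc : 0 < c) (y : Cn n) :
    MemLp (fun w : Cn n => Real.exp (-c * ‖y - w‖)) 2 volume := by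
  refine (memLp_two_iff_integrable_sq (Continuous.aestronglyMeasurable (by fun_prop))).2 ?_
  have h := (integrable_exp_neg_norm (n := n) (c := c * 2) (by positivity)).comp_sub_right y
  refine h.congr (Filter.Eventually.of_forall fun w => ?_)
  simp only
  rw [← Real.exp_nat_mul, norm_sub_rev]
  congr 1; push_cast; ring

lemma integrable_exp_mul_norm {c : ℝ} (hc : 0 < c) (y : Cn n) {f : Cn n → ℂ}
    (hf : MemLp f 2 volume) : Integrable fun w => Real.exp (-c * ‖y - w‖) * ‖f w‖ :=
  MemLp.integrable_mul (memLp_exp_neg_norm_sub hc y) hf.norm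

lemma red_sub (φ : Cn n → ℝ) (h : ℝ) (u v : Cn n → ℂ) :
    red φ h (u - v) = red φ h u - red φ h v := by
  ext x; simp [red, sub_mul]

namespace Weight
variable (P : Weight n)

lemma wconst_pos {h : ℝ} (hh : 0 < h) : 0 < P.wconst h := by
  have h1 : P.wconst h ≠ 0 := by
    intro h0
    have h2 := P.wconst_eq hh
    rw [h0, Complex.ofReal_zero] at h2
    have h3 : (2 * Real.pi * h : ℂ) ^ n ≠ 0 := by
      have : (Real.pi : ℂ) ≠ 0 := by exact_mod_cast Real.pi_ne_zero
      have h' : (h : ℂ) ≠ 0 := by exact_mod_cast hh.ne'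
      exact pow_ne_zero _ (mul_ne_zero (mul_ne_zero two_ne_zero this) h')
    exact div_ne_zero P.det_mat_ne h3 h2.symm
  refine lt_of_le_of_ne ?_ h1.symm
  unfold wconst
  exact inv_nonneg.2 (integral_nonneg fun _ => (Real.exp_pos _).le)

lemma wconst_scale {h : ℝ} (hh : 0 < h) : P.wconst h = P.wconst 1 / h ^ n := by
  have h1 := P.wconst_eq hh
  have h2 := P.wconst_eq one_pos
  have : (P.wconst h : ℂ) = ((P.wconst 1 / h ^ n : ℝ) : ℂ) := by
    push_cast
    rw [h1, h2]
    simp only [mul_pow, Complex.ofReal_one, mul_one]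
    rw [div_div]
  exact_mod_cast this

lemma integral_eq_wconst_inv {h : ℝ} :
    ∫ x : Cn n, Real.exp (-(1 / 2) * (P.H x x).re / h) = (P.wconst h)⁻¹ := by
  rw [wconst, inv_inv]

/-- The normalization constant of the reproducing kernel. -/
def gconst (h : ℝ) : ℝ := P.wconst (h / 2)

lemma gconst_pos {h : ℝ} (hh : 0 < h) : 0 < P.gconst h := P.wconst_pos (by positivity)

lemma integral_eq_gconst_inv {h : ℝ} :
    ∫ x : Cn n, Real.exp (-(P.H x x).re / h) = (P.gconst h)⁻¹ := by
  rw [gconst, ← integral_eq_wconst_inv]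
  congr 1; ext x; congr 1; ring

lemma exp_phi_sub (a b h : ℝ) : Real.exp ((a - b) / h) = Real.exp (a / h) * Real.exp (-b / h) := by
  rw [← Real.exp_add]; congr 1; ring

lemma continuous_repKer_right (h : ℝ) (η y : Cn n) : Continuous fun w => P.repKer h η y w := by
  unfold repKer repExp; fun_prop

lemma differentiable_repKer (h : ℝ) (η w : Cn n) :
    Differentiable ℂ fun y => P.repKer h η y w := by
  unfold repKer repExp; fun_prop

lemma exists_norm_repKer_mul_le {h : ℝ} (hh : 0 < h) (η : Cn n) : ∃ C : ℝ, 0 < C ∧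
    ∀ (U : Cn n → ℂ) y w, ‖P.repKer h η y w * U w‖ ≤
      C * Real.exp (P.phi y / h) * (Real.exp (-1 * ‖y - w‖) * ‖red P.phi h U w‖) := by
  obtain ⟨C, hC, hb⟩ := P.exists_norm_repKer_le hh η
  refine ⟨C, hC, fun U y w => ?_⟩
  rw [norm_mul, norm_red]
  calc _ ≤ (C * Real.exp ((P.phi y - P.phi w) / h) * Real.exp (-‖y - w‖)) * ‖U w‖ := by
        gcongr; exact hb y w
    _ = _ := by rw [exp_phi_sub, neg_one_mul]; ring

lemma aestronglyMeasurable_of_red {h : ℝ} {U : Cn n → ℂ}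
    (hU : AEStronglyMeasurable (red P.phi h U) volume) : AEStronglyMeasurable U volume := by
  have h1 : Continuous fun x => ((Real.exp (P.phi x / h) : ℝ) : ℂ) := by fun_prop
  refine (hU.mul h1.aestronglyMeasurable).congr (Filter.Eventually.of_forall fun x => ?_)
  simp only [red, Pi.mul_apply, mul_assoc]
  rw [← Complex.ofReal_mul, ← Real.exp_add]
  simp [neg_div]

lemma integrable_repKer_mul {h : ℝ} (hh : 0 < h) (η y : Cn n) {U : Cn n → ℂ}
    (hU : MemLp (red P.phi h U) 2 volume) : Integrable fun w => P.repKer h η y w * U w := by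
  obtain ⟨C, hC, hb⟩ := P.exists_norm_repKer_mul_le hh η
  exact ((integrable_exp_mul_norm one_pos y hU).const_mul _).mono'
    ((P.continuous_repKer_right h η y).aestronglyMeasurable.mul
      (P.aestronglyMeasurable_of_red hU.1)) (Filter.Eventually.of_forall fun w => hb U y w)

/-- The reproducing formula. -/
lemma rep_formula {h : ℝ} (hh : 0 < h) (η y : Cn n) {u : Cn n → ℂ} (hu : Differentiable ℂ u)
    (hL : MemLp (red P.phi h u) 2 volume) :
    P.gconst h * ∫ w, P.repKer h η y w * u w = u y := by
  -- With w = y + z the integrand is the circle invariant e^{-H(z,z)/h} times the entire function g.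
  -- The twist sits in g and equals 1 at z = 0, so g(0) = u(y) for every η.
  set g : Cn n → ℂ := fun z => u (y + z) * Complex.exp ((-P.S y z - (1 / 2) * P.S z z - P.H z y -
    Complex.I * pair z η) / h) with hg
  have hgd : Differentiable ℂ g := by
    have : Differentiable ℂ fun z => u (y + z) := hu.comp (by fun_prop)
    refine this.mul ?_
    fun_prop
  have hker : ∀ z, P.repKer h η y (y + z) * u (y + z) =
      ((Real.exp (-(P.H z z).re / h) : ℝ) : ℂ) * g z := by
    intro z
    have h1 : P.repExp η y (y + z) / h = ((-(P.H z z).re / h : ℝ) : ℂ) +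
        (-P.S y z - (1 / 2) * P.S z z - P.H z y - Complex.I * pair z η) / h := by
      have e1 : y - (y + z) = -z := by abel
      push_cast
      rw [← P.H_self_eq, ← add_div]
      congr 1
      simp only [repExp, e1, pair_neg_left, map_add, map_neg, add_apply, neg_apply]
      rw [P.symm y z]
      ring
    rw [repKer, h1, Complex.exp_add, hg, Complex.ofReal_exp]
    ring
  have hinv : ∀ (θ : ℝ) (z : Cn n), Real.exp (-(P.H (Complex.exp (θ * Complex.I) • z)
      (Complex.exp (θ * Complex.I) • z)).re / h) = Real.exp (-(P.H z z).re / h) := by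
    intro θ z
    congr 3
    rw [map_smulₛₗ, map_smul, smul_apply, smul_eq_mul, smul_eq_mul, ← mul_assoc, mul_comm (conj _),
      Complex.mul_conj, Complex.normSq_eq_norm_sq, Complex.norm_exp_ofReal_mul_I]
    simp
  have hint := (P.integrable_repKer_mul hh η y hL).comp_add_left y
  simp only [hker] at hint
  have h2 := integral_circle_invariant hgd hinv
    (by have := P.continuous_H_self; fun_prop) hint
  rw [← integral_add_left_eq_self _ y]
  simp only [hker]
  rw [h2]
  have h3 : (∫ z : Cn n, ((Real.exp (-(P.H z z).re / h) : ℝ) : ℂ)) = ((P.gconst h)⁻¹ : ℝ) := by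
    rw [← P.integral_eq_gconst_inv, integral_complex_ofReal]
  rw [h3]
  have : (P.gconst h : ℂ) ≠ 0 := by exact_mod_cast (P.gconst_pos hh).ne'
  simp only [hg]
  push_cast
  rw [← mul_assoc, mul_inv_cancel₀ this, one_mul]
  simp

lemma exists_phi_bound (h : ℝ) (y : Cn n) :
    ∃ B : ℝ, 0 < B ∧ ∀ x ∈ Metric.ball y 1, Real.exp (P.phi x / h) ≤ B := by
  obtain ⟨B, hB⟩ := (isCompact_closedBall y 1).exists_bound_of_continuousOn
    (f := fun x => Real.exp (P.phi x / h)) (Continuous.continuousOn (by fun_prop))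
  refine ⟨|B| + 1, by positivity, fun x hx => ?_⟩
  have := hB x (Metric.ball_subset_closedBall hx)
  rw [Real.norm_of_nonneg (Real.exp_pos _).le] at this
  linarith [le_abs_self B]

lemma exp_neg_norm_le_of_mem_ball {c : ℝ} (hc : 0 < c) {x y : Cn n} (hx : x ∈ Metric.ball y 1)
    (w : Cn n) :
    Real.exp (-c * ‖x - w‖) ≤ Real.exp c * Real.exp (-c * ‖y - w‖) := by
  rw [← Real.exp_add]
  apply Real.exp_le_exp.2
  have h1 : ‖y - w‖ ≤ ‖x - w‖ + 1 := by
    rw [Metric.mem_ball, dist_comm, dist_eq_norm] at hx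
    have := norm_add_le (y - x) (x - w)
    rw [sub_add_sub_cancel] at this
    linarith
  nlinarith

/-- Kernels that are holomorphic in `x` and decay off the diagonal define holomorphic functions. -/
lemma hasFDerivAt_kernel {h : ℝ} {K : Cn n → Cn n → ℂ} {C c : ℝ} (hc : 0 < c)
    (hK : ∀ w, Differentiable ℂ fun x => K x w) (hm : ∀ x, AEStronglyMeasurable (K x) volume)
    {U : Cn n → ℂ}
    (hU : MemLp (red P.phi h U) 2 volume)
    (hb : ∀ x w, ‖K x w * U w‖ ≤ C * Real.exp (P.phi x / h) *
      (Real.exp (-c * ‖x - w‖) * ‖red P.phi h U w‖)) (y : Cn n) :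
    HasFDerivAt (fun x => ∫ w, K x w * U w) (∫ w, fderiv ℂ (fun x => K x w * U w) y) y ∧
      Integrable fun w => fderiv ℂ (fun x => K x w * U w) y := by
  obtain ⟨B, hB, hphi⟩ := P.exists_phi_bound h y
  refine hasFDerivAt_integral_of_holomorphic (k := fun x w => K x w * U w) one_pos
    (bound := fun w => |C| * B * Real.exp c * (Real.exp (-c * ‖y - w‖) * ‖red P.phi h U w‖))
    (fun x _ => (hm x).mul (P.aestronglyMeasurable_of_red hU.1))
    (Filter.Eventually.of_forall fun w => ((hK w).mul_const _).differentiableOn)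
    (Filter.Eventually.of_forall fun w x hx => ?_)
    ((integrable_exp_mul_norm hc y hU).const_mul _)
  refine (hb x w).trans ?_
  have h1 := exp_neg_norm_le_of_mem_ball hc hx w
  have h2 := hphi x hx
  calc C * Real.exp (P.phi x / h) * (Real.exp (-c * ‖x - w‖) * ‖red P.phi h U w‖)
      ≤ |C| * B * ((Real.exp c * Real.exp (-c * ‖y - w‖)) * ‖red P.phi h U w‖) := by
        gcongr; exact le_abs_self C
    _ = _ := by ring

lemma fderiv_repKer (h : ℝ) (η y w t : Cn n) : fderiv ℂ (fun y => P.repKer h η y w) y t =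
    (P.S y t + P.H t w + Complex.I * pair t η) / h * P.repKer h η y w := by
  have h1 : Differentiable ℂ fun y => P.repExp η y w := by unfold repExp; fun_prop
  have hline : HasDerivAt (fun s : ℂ => y + s • t) t 0 := by
    simpa using ((hasDerivAt_id (0 : ℂ)).smul_const t).const_add y
  have h2 : HasDerivAt (fun s : ℂ => P.repExp η (y + s • t) w)
      (P.S y t + P.H t w + Complex.I * pair t η) 0 := by
    have e : ∀ s : ℂ, P.repExp η (y + s • t) w = P.repExp η y w +
        s * (P.S y t + P.H t w + Complex.I * pair t η) + s * s * ((1 / 2) * P.S t t) := by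
      intro s
      have : y + s • t - w = (y - w) + s • t := by abel
      simp only [repExp, this, pair_add_left, pair_smul_left, map_add, map_smul, add_apply,
        smul_apply, smul_eq_mul]
      rw [P.symm y t]; ring
    simp only [e]
    have h3 := (((hasDerivAt_id (0 : ℂ)).mul_const
      (P.S y t + P.H t w + Complex.I * pair t η)).const_add (P.repExp η y w)).add
      (((hasDerivAt_id (0 : ℂ)).mul (hasDerivAt_id (0 : ℂ))).mul_const ((1 / 2) * P.S t t))
    exact h3.congr_deriv (by simp)
  have h4 : HasFDerivAt (fun y => P.repKer h η y w) (fderiv ℂ (fun y => P.repKer h η y w) y)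
      (y + (0 : ℂ) • t) := by
    rw [zero_smul, add_zero]; exact (P.differentiable_repKer h η w y).hasFDerivAt
  have h5 := h4.comp_hasDerivAt (0 : ℂ) hline
  have h6 := (h2.div_const (h : ℂ)).cexp
  have h7 := h5.unique h6
  rw [h7]
  simp only [repKer, zero_smul, add_zero]
  ring

/-- The derivative of a function in `H_φ` from the reproducing formula. -/
lemma rep_deriv {h : ℝ} (hh : 0 < h) (η y t : Cn n) {u : Cn n → ℂ} (hu : Differentiable ℂ u)
    (hL : MemLp (red P.phi h u) 2 volume) :
    h * fderiv ℂ u y t - (P.S y t + P.H t y + Complex.I * pair t η) * u y =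
      P.gconst h * ∫ w, P.H t (w - y) * (P.repKer h η y w * u w) := by
  obtain ⟨C, hC, hb⟩ := P.exists_norm_repKer_mul_le hh η
  obtain ⟨h1, h2⟩ := P.hasFDerivAt_kernel one_pos (fun w => P.differentiable_repKer h η w)
    (fun x => (P.continuous_repKer_right h η x).aestronglyMeasurable) hL (fun x w => hb u x w) y
  have hh' : (h : ℂ) ≠ 0 := by exact_mod_cast hh.ne'
  have h3 : ∀ w, fderiv ℂ (fun x => P.repKer h η x w * u w) y t =
      (P.S y t + P.H t w + Complex.I * pair t η) / h * (P.repKer h η y w * u w) := by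
    intro w
    rw [fderiv_mul_const (P.differentiable_repKer h η w y), smul_apply, fderiv_repKer, smul_eq_mul]
    ring
  have h4 : fderiv ℂ u y t = P.gconst h * ∫ w, (P.S y t + P.H t w + Complex.I * pair t η) / h *
      (P.repKer h η y w * u w) := by
    have h5 := (h1.const_mul (P.gconst h : ℂ)).fderiv
    have h6 : (fun x => (P.gconst h : ℂ) * ∫ w, P.repKer h η x w * u w) = u :=
      funext fun x => P.rep_formula hh η x hu hL
    rw [h6] at h5
    rw [h5, smul_apply, ContinuousLinearMap.integral_apply h2, smul_eq_mul]
    simp only [h3]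
  have h7 : Integrable fun w => (P.S y t + P.H t w + Complex.I * pair t η) / h *
      (P.repKer h η y w * u w) := by
    have := h2.apply_continuousLinearMap t
    simpa only [h3] using this
  have h8 := P.integrable_repKer_mul hh η y hL
  -- Differentiation brings down S(y,t) + H(t,w) + i t·η; subtracting its value at w = y leaves H(t,
  -- w-y), which vanishes on the diagonal.
  have h9 : ∫ w, P.H t (w - y) * (P.repKer h η y w * u w) =
      h * (∫ w, (P.S y t + P.H t w + Complex.I * pair t η) / h * (P.repKer h η y w * u w)) -
      (P.S y t + P.H t y + Complex.I * pair t η) * ∫ w, P.repKer h η y w * u w := by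
    rw [← integral_const_mul, ← integral_const_mul,
      ← integral_sub (h7.const_mul _) (h8.const_mul _)]
    refine integral_congr_ae (Filter.Eventually.of_forall fun w => ?_)
    simp only [map_sub]
    field_simp
    ring
  have h10 := P.rep_formula hh η y hu hL
  rw [h9, mul_sub, h4, ← h10]
  ring

/-! ### Density of rapidly decaying functions -/

section Density

/-- The Bergman type projection. -/
def proj (h : ℝ) (U : Cn n → ℂ) (x : Cn n) : ℂ := P.gconst h * ∫ w, P.repKer h 0 x w * U w

lemma differentiable_proj {h : ℝ} (hh : 0 < h) {U : Cn n → ℂ}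
    (hU : MemLp (red P.phi h U) 2 volume) : Differentiable ℂ (P.proj h U) := fun y => by
  obtain ⟨C, hC, hb⟩ := P.exists_norm_repKer_mul_le hh 0
  exact (P.hasFDerivAt_kernel one_pos (fun w => P.differentiable_repKer h 0 w)
    (fun x => (P.continuous_repKer_right h 0 x).aestronglyMeasurable) hU (fun x w => hb U x w)
    y).1.differentiableAt.const_mul _

/-- An operator whose reduced kernel is dominated by an integrable convolution kernel. -/
lemma eLpNorm_red_le {φ : Cn n → ℝ} {h : ℝ} {k : Cn n → ℝ} (hk : Measurable k)
    (hk0 : ∀ z, 0 ≤ k z) {U v : Cn n → ℂ} {K : Cn n → Cn n → ℂ}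
    (hv : ∀ x, v x = ∫ w, K x w * U w) (hU : MemLp (red φ h U) 2 volume)
    (hK : ∀ x w, ‖K x w * U w‖ ≤ Real.exp (φ x / h) * (k (x - w) * ‖red φ h U w‖)) :
    eLpNorm (red φ h v) 2 volume ≤ (∫⁻ z, ‖k z‖ₑ) * eLpNorm (red φ h U) 2 volume := by
  refine eLpNorm_le_of_convolution hk hU.1 fun x => ?_
  have h1 : red φ h v x = ∫ w, (Real.exp (-φ x / h) : ℂ) * (K x w * U w) := by
    rw [red, hv, integral_const_mul, mul_comm]
  rw [h1]
  refine (enorm_integral_le_lintegral_enorm _).trans (lintegral_mono fun w => ?_)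
  rw [← enorm_norm (red φ h U w), ← enorm_mul]
  rw [← ofReal_norm, ← ofReal_norm]
  refine ENNReal.ofReal_le_ofReal ?_
  rw [norm_mul, Complex.norm_real, Real.norm_of_nonneg (Real.exp_pos _).le]
  rw [Real.norm_of_nonneg (mul_nonneg (hk0 _) (norm_nonneg _))]
  calc Real.exp (-φ x / h) * ‖K x w * U w‖ ≤ Real.exp (-φ x / h) *
        (Real.exp (φ x / h) * (k (x - w) * ‖red φ h U w‖)) := by gcongr; exact hK x w
    _ = (Real.exp (-φ x / h) * Real.exp (φ x / h)) * (k (x - w) * ‖red φ h U w‖) := by ring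
    _ = _ := by rw [← Real.exp_add]; simp [neg_div]

/-- The Gaussian kernel is dominated by an integrable convolution kernel. The constant may depend on
h, since the projection serves only for density. -/
lemma exists_eLpNorm_proj_le {h : ℝ} (hh : 0 < h) : ∃ C : ENNReal, C ≠ ⊤ ∧
    ∀ U : Cn n → ℂ, MemLp (red P.phi h U) 2 volume →
      eLpNorm (red P.phi h (P.proj h U)) 2 volume ≤ C * eLpNorm (red P.phi h U) 2 volume := by
  obtain ⟨C, hC, hb⟩ := P.exists_norm_repKer_mul_le hh 0
  have hg := P.gconst_pos hh
  have hi := (integrable_exp_neg_norm (n := n) one_pos).const_mul (P.gconst h * C)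
  refine ⟨_, hi.2.ne, fun U hU => eLpNorm_red_le (K := fun x w => P.gconst h * P.repKer h 0 x w)
    (Continuous.measurable (by fun_prop)) (fun z => by positivity) (fun x => ?_) hU
    fun x w => ?_⟩
  · simp only [proj, mul_assoc]; rw [integral_const_mul]
  · rw [mul_assoc, norm_mul, Complex.norm_real, Real.norm_of_nonneg hg.le]
    calc P.gconst h * ‖P.repKer h 0 x w * U w‖ ≤ P.gconst h * (C * Real.exp (P.phi x / h) *
          (Real.exp (-1 * ‖x - w‖) * ‖red P.phi h U w‖)) := by gcongr; exact hb U x w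
      _ = _ := by ring

/-- On the support of U the variable w stays bounded, so the factor e^{-‖x-w‖} of the kernel bound
beats every power of 1 + ‖x‖. -/
lemma rapidDecay_proj {h : ℝ} (hh : 0 < h) {U : Cn n → ℂ}
    (hU : MemLp (red P.phi h U) 2 volume) (hc : HasCompactSupport U) :
    RapidDecay P.phi h (P.proj h U) := by
  intro N
  obtain ⟨C, hC, hb⟩ := P.exists_norm_repKer_mul_le hh 0
  obtain ⟨R, hR⟩ := hc.isCompact.isBounded.exists_norm_le
  obtain ⟨D, hD, hpow⟩ := one_add_pow_le_exp N (c := 1 / 2) (by norm_num)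
  have hg := P.gconst_pos hh
  have hi := integrable_exp_mul_norm (c := 1 / 2) (by norm_num) (0 : Cn n) hU
  refine ⟨P.gconst h * (C * D * Real.exp (1 * |R|) * ∫ w, ‖red P.phi h U w‖ *
    Real.exp (-(1 / 2) * ‖(0 : Cn n) - w‖)), fun x => ?_⟩
  have h1 : (1 + ‖x‖) ^ N * ‖∫ w, P.repKer h 0 x w * U w‖ ≤
      ∫ w, (C * D * Real.exp (1 * |R|) * Real.exp (P.phi x / h)) *
        (Real.exp (-(1 / 2) * ‖(0 : Cn n) - w‖) * ‖red P.phi h U w‖) := by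
    have h2 : (1 + ‖x‖) ^ N * ‖∫ w, P.repKer h 0 x w * U w‖ =
        ‖∫ w, ((1 + ‖x‖) ^ N : ℝ) • (P.repKer h 0 x w * U w)‖ := by
      rw [integral_smul, norm_smul, Real.norm_of_nonneg (by positivity)]
    rw [h2]
    refine norm_integral_le_of_norm_le (hi.const_mul _) (Filter.Eventually.of_forall fun w => ?_)
    by_cases hw : U w = 0
    · simp only [hw, mul_zero, smul_zero, norm_zero]; positivity
    have hwR : ‖w‖ ≤ R := hR w (subset_tsupport _ hw)
    rw [norm_smul, Real.norm_of_nonneg (by positivity)]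
    have h3 : (1 + ‖x‖) ^ N * Real.exp (-1 * ‖x - w‖) ≤ D * Real.exp (1 * |R|) *
        Real.exp (-(1 / 2) * ‖(0 : Cn n) - w‖) := by
      calc (1 + ‖x‖) ^ N * Real.exp (-1 * ‖x - w‖) ≤ D * Real.exp (1 / 2 * ‖x‖) *
            Real.exp (-1 * ‖x - w‖) := by gcongr; exact hpow _ (norm_nonneg x)
        _ = D * Real.exp (1 / 2 * ‖x‖ - ‖x - w‖) := by
            rw [mul_assoc, ← Real.exp_add]; congr 2; ring
        _ ≤ D * Real.exp (1 * |R| + -(1 / 2) * ‖(0 : Cn n) - w‖) := by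
            gcongr
            have h4 := norm_sub_norm_le x w
            have h5 := le_abs_self R
            rw [zero_sub, norm_neg]
            linarith [norm_nonneg (x - w)]
        _ = _ := by rw [Real.exp_add]; ring
    calc (1 + ‖x‖) ^ N * ‖P.repKer h 0 x w * U w‖
        ≤ (1 + ‖x‖) ^ N * (C * Real.exp (P.phi x / h) *
          (Real.exp (-1 * ‖x - w‖) * ‖red P.phi h U w‖)) := by gcongr; exact hb U x w
      _ = C * Real.exp (P.phi x / h) * ((1 + ‖x‖) ^ N * Real.exp (-1 * ‖x - w‖)) *
          ‖red P.phi h U w‖ := by ring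
      _ ≤ C * Real.exp (P.phi x / h) * (D * Real.exp (1 * |R|) *
        Real.exp (-(1 / 2) * ‖(0 : Cn n) - w‖)) * ‖red P.phi h U w‖ := by gcongr
      _ = _ := by ring
  rw [proj, norm_mul, Complex.norm_real, Real.norm_of_nonneg hg.le]
  rw [integral_const_mul] at h1
  calc (1 + ‖x‖) ^ N * (P.gconst h * ‖∫ w, P.repKer h 0 x w * U w‖)
      = P.gconst h * ((1 + ‖x‖) ^ N * ‖∫ w, P.repKer h 0 x w * U w‖) := by ring
    _ ≤ _ := mul_le_mul_of_nonneg_left h1 hg.le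
    _ = _ := by simp only [mul_comm ‖red P.phi h U _‖]; ring

/-- Rapidly decaying functions are dense in `H_φ`. -/
lemma exists_rapidDecay_approx {h : ℝ} (hh : 0 < h) {u : Cn n → ℂ} (hu : Differentiable ℂ u)
    (hL : MemLp (red P.phi h u) 2 volume) {δ : ENNReal} (hδ : δ ≠ 0) :
    ∃ v : Cn n → ℂ, Differentiable ℂ v ∧ MemLp (red P.phi h v) 2 volume ∧
      RapidDecay P.phi h v ∧ eLpNorm (red P.phi h (u - v)) 2 volume ≤ δ := by
  obtain ⟨C, hC, hproj⟩ := P.exists_eLpNorm_proj_le (n := n) hh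
  obtain ⟨g, hgc, hgle, hgcont, hgL⟩ := hL.exists_hasCompactSupport_eLpNorm_sub_le (by norm_num)
    (ε := δ / (C + 1)) (by
      have : C + 1 ≠ ⊤ := by simp [hC]
      exact (ENNReal.div_pos hδ this).ne')
  set U : Cn n → ℂ := fun x => g x * Real.exp (P.phi x / h) with hU
  have hredU : red P.phi h U = g := by
    ext x
    simp only [red, hU, mul_assoc]
    rw [← Complex.ofReal_mul, ← Real.exp_add]
    simp [neg_div]
  have hUL : MemLp (red P.phi h U) 2 volume := by rw [hredU]; exact hgL
  have hUc : HasCompactSupport U := hgc.mul_right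
  have hdiffL : MemLp (red P.phi h (u - U)) 2 volume := by rw [red_sub]; exact hL.sub hUL
  -- The projection fixes u by the reproducing formula, so the error is the projection of u - U and
  -- is controlled by its boundedness.
  have hsub : u - P.proj h U = P.proj h (u - U) := by
    ext x
    have h1 := P.rep_formula hh 0 x hu hL
    simp only [Pi.sub_apply, proj]
    conv_lhs => rw [← h1]
    rw [← mul_sub, ← integral_sub (P.integrable_repKer_mul hh 0 x hL)
      (P.integrable_repKer_mul hh 0 x hUL)]
    simp only [mul_sub]
  refine ⟨P.proj h U, P.differentiable_proj hh hUL, ?_, P.rapidDecay_proj hh hUL hUc, ?_⟩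
  · refine ⟨(continuous_red P.continuous_phi
      (P.differentiable_proj hh hUL).continuous).aestronglyMeasurable, ?_⟩
    exact (hproj U hUL).trans_lt (ENNReal.mul_lt_top hC.lt_top hUL.2)
  · rw [hsub]
    refine (hproj _ hdiffL).trans ?_
    rw [red_sub, hredU]
    calc C * eLpNorm (red P.phi h u - g) 2 volume ≤ (C + 1) * (δ / (C + 1)) := by
          gcongr; exact le_self_add
      _ ≤ δ := ENNReal.mul_div_le

end Density

end Weight

/-! ### Off-diagonal decay at scale √h -/

/-- The effective gain off the diagonal after the contour deformation. -/
def gain (δ t : ℝ) : ℝ := (1 / 2) * δ * t ^ 2 / (δ + t)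

lemma gain_nonneg {δ t : ℝ} (hδ : 0 < δ) (ht : 0 ≤ t) : 0 ≤ gain δ t := by
  unfold gain; positivity

/-- With s = t/√h, the condition h ≤ 1 gives gain/h ≥ ½δs²/(δ+s), and s² ≥ (s-δ)(s+δ). The linear
lower bound in s is what produces exponential decay at scale √h uniformly in h. -/
lemma gain_div_ge {δ h t : ℝ} (hδ : 0 < δ) (hh : 0 < h) (h1 : h ≤ 1) (ht : 0 ≤ t) :
    (1 / 2) * (δ * (t / √h) - δ ^ 2) ≤ gain δ t / h := by
  set s := t / √h with hs
  have hsq : 0 < √h := Real.sqrt_pos.2 hh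
  have hsq1 : √h ≤ 1 := Real.sqrt_le_one.2 h1
  have hs0 : 0 ≤ s := by positivity
  have ht' : t = √h * s := by rw [hs]; field_simp
  have e : gain δ t / h = (1 / 2) * δ * s ^ 2 / (δ + √h * s) := by
    have ht2 : t ^ 2 = h * s ^ 2 := by rw [ht', mul_pow, Real.sq_sqrt hh.le]
    have : 0 < δ + √h * s := by positivity
    rw [gain, ht2, ht']
    field_simp
  rw [e, le_div_iff₀ (by positivity)]
  have hd : √h * s ≤ s := by nlinarith
  rcases le_or_gt (δ * s - δ ^ 2) 0 with h0 | h0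
  · have : 0 ≤ (1 / 2) * δ * s ^ 2 := by positivity
    have h2 : 0 < δ + √h * s := by positivity
    nlinarith
  · have h2 : (δ * s - δ ^ 2) * (δ + √h * s) ≤ (δ * s - δ ^ 2) * (δ + s) := by gcongr
    nlinarith [pow_pos hδ 3]

/-- The real dimension is 2n, so the scale √h contributes exactly hⁿ. -/
lemma integral_exp_scaled {h : ℝ} (hh : 0 < h) (b : ℝ) (w : Cn n) :
    ∫ y : Cn n, Real.exp (-b * (‖y - w‖ / √h)) = h ^ n * ∫ y : Cn n, Real.exp (-b * ‖y‖) := by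
  have hsq : 0 < √h := Real.sqrt_pos.2 hh
  rw [integral_sub_right_eq_self (fun y : Cn n => Real.exp (-b * (‖y‖ / √h))) w]
  have h1 : ∀ y : Cn n, Real.exp (-b * (‖y‖ / √h)) =
      (fun y : Cn n => Real.exp (-b * ‖y‖)) ((√h)⁻¹ • y) := by
    intro y
    simp only [norm_smul, norm_inv, Real.norm_of_nonneg hsq.le]
    congr 2; rw [div_eq_inv_mul]
  simp only [h1]
  rw [Measure.integral_comp_smul volume (fun y : Cn n => Real.exp (-b * ‖y‖)), smul_eq_mul]
  congr 1
  have hf : Module.finrank ℝ (Cn n) = 2 * n := by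
    rw [Module.finrank_pi_fintype]; simp [mul_comm]
  rw [hf, inv_pow, inv_inv, pow_mul, Real.sq_sqrt hh.le, abs_of_nonneg (by positivity)]

lemma integrable_exp_scaled {h b : ℝ} (hh : 0 < h) (hb : 0 < b) (w : Cn n) :
    Integrable fun y : Cn n => Real.exp (-b * (‖y - w‖ / √h)) := by
  have hsq : 0 < √h := Real.sqrt_pos.2 hh
  have := Weight.integrable_exp_neg_norm_sub (n := n) (c := b / √h) (by positivity) w
  refine this.congr (Filter.Eventually.of_forall fun y => ?_)
  simp only; congr 1; ring

/-- The model convolution kernel at scale `√h`. -/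
def convKer (D b h : ℝ) (z : Cn n) : ℝ := D * (h ^ n)⁻¹ * Real.exp (-b * (‖z‖ / √h))

lemma measurable_convKer (D b h : ℝ) : Measurable (convKer D b h : Cn n → ℝ) :=
  Continuous.measurable (by unfold convKer; fun_prop)

lemma convKer_nonneg {D b h : ℝ} (hD : 0 ≤ D) (hh : 0 < h) (z : Cn n) : 0 ≤ convKer D b h z := by
  unfold convKer; positivity

/-- The normalization by h^{-n} makes the mass independent of h, as uniform use of Young's
inequality requires. -/
lemma lintegral_convKer {D b h : ℝ} (hD : 0 ≤ D) (hb : 0 < b) (hh : 0 < h) :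
    ∫⁻ z : Cn n, ‖convKer D b h z‖ₑ =
      ENNReal.ofReal (D * ∫ y : Cn n, Real.exp (-b * ‖y‖)) := by
  have h0 : ∀ z : Cn n, ‖convKer D b h z‖ₑ = ENNReal.ofReal (convKer D b h z) := fun z =>
    Real.enorm_of_nonneg (convKer_nonneg hD hh z)
  have hi := (integrable_exp_scaled (n := n) hh hb 0).const_mul (D * (h ^ n)⁻¹)
  simp only [sub_zero] at hi
  simp only [h0]
  rw [← ofReal_integral_eq_lintegral_ofReal (by exact hi)
    (Filter.Eventually.of_forall (convKer_nonneg hD hh))]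
  congr 1
  have h1 := integral_exp_scaled (n := n) hh b 0
  simp only [sub_zero] at h1
  simp only [convKer]
  rw [integral_const_mul, h1]
  have : h ^ n ≠ 0 := by positivity
  field_simp

namespace Weight
variable (P : Weight n)

/-- Positivity of H at ½e - l·d. The coefficient ¼ spends only half of the decay ½H(e,e) of the
reproducing kernel. -/
lemma H_re_cross (e d : Cn n) (l : ℝ) :
    l * (P.H e d).re ≤ (1 / 4) * (P.H e e).re + l ^ 2 * (P.H d d).re := by
  have h := P.H_self_nonneg ((1 / 2 : ℝ) • e - l • d)
  have h2 := P.H_re_symm e d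
  rw [real_smul_eq, real_smul_eq] at h
  simp only [map_sub, map_smul, map_smulₛₗ, sub_apply, smul_apply, smul_eq_mul,
    Complex.conj_ofReal, Complex.sub_re, Complex.re_ofReal_mul] at h
  rw [h2] at h
  linarith

set_option maxHeartbeats 1000000 in
/-- Pointwise bound for the Schwartz kernel after contour deformation. The function `g` may grow
quadratically away from the point `(x, ξ(x) + η)`. -/
lemma exists_norm_ker_le {ρ : ℝ} (hρ : 0 < ρ) : ∃ δ c₁ C₁ : ℝ, 0 < δ ∧ 0 < c₁ ∧ 0 < C₁ ∧
    ∀ (h : ℝ), 0 < h → h ≤ 1 → ∀ (g : Cn n × Cn n → ℂ), DifferentiableOn ℂ g (P.tube ρ) →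
    ∀ (M₀ M₁ : ℝ), 0 ≤ M₀ → 0 ≤ M₁ → ∀ (η x : Cn n), ‖η‖ ≤ ρ / 2 →
    (∀ p ∈ P.tube ρ, ‖g p‖ ≤ M₀ + M₁ * (‖p.1 - x‖ + ‖p.2 - P.theta x - η‖) ^ 2) →
    ∀ w, ‖P.ker h g η x w‖ ≤ C₁ * h ^ n * (M₀ + M₁ * h) *
      Real.exp ((P.phi x - P.phi w + (Complex.I * pair (x - w) η).re -
        c₁ * gain δ ‖x - w‖) / h) := by
  obtain ⟨c, hc, hlow⟩ := P.exists_lower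
  obtain ⟨B, hB, -, hBh, hBt⟩ := P.exists_upper
  -- The shift below has l‖d‖ ≤ δ/2, so its H-part is at most Bδ/2 = ρ/4; with ‖η‖ ≤ ρ/2 the contour
  -- stays in the tube.
  set δ := ρ / (2 * B) with hδ
  have hδ0 : 0 < δ := by positivity
  obtain ⟨Ca, hCa, hgauss⟩ := exists_gaussian_le 2 0 (c := c / 4) (by positivity)
  obtain ⟨Cb, hCb, hpoly⟩ := one_add_pow_le_exp 2 (c := c / 4 * ((1 / 2) * δ)) (by positivity)
  set I₀ := ∫ y : Cn n, Real.exp (-1 * ‖y‖) with hI₀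
  have hI₀0 : 0 ≤ I₀ := integral_nonneg fun _ => (Real.exp_pos _).le
  refine ⟨δ, c / 4, (1 + B) ^ 2 * Ca * (Cb * Real.exp (c / 4 * ((1 / 2) * δ ^ 2))) * (I₀ + 1),
    hδ0, by positivity, by positivity, ?_⟩
  intro h hh hh1 g hg M₀ M₁ hM₀ hM₁ η x hη hgrow w
  set d := x - w with hd
  -- Near the diagonal l is close to ½ and the gain l‖d‖² is quadratic; far away the width of the
  -- tube limits l‖d‖ and the gain becomes linear.
  set l := (1 / 2) * δ / (δ + ‖d‖) with hl
  have hl0 : 0 ≤ l := by positivity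
  have hl2 : l ≤ 1 / 2 := by
    rw [hl, div_le_iff₀ (by positivity)]
    nlinarith [norm_nonneg d]
  have hld : l * ‖d‖ ≤ δ / 2 := by
    rw [hl, div_mul_eq_mul_div, div_le_iff₀ (by positivity)]
    nlinarith [norm_nonneg d]
  have hgain : l * ‖d‖ ^ 2 = gain δ ‖d‖ := by rw [hl, gain]; ring
  -- The component η makes the two twists add up to i(x-w)·η, free of y; the component along i·`hvec
  -- d` produces the decay -l·H(d,d).
  set v := η + ((l : ℂ) * Complex.I) • P.hvec d with hv
  have hlI : ‖((l : ℂ) * Complex.I) • P.hvec d‖ ≤ B * (l * ‖d‖) := by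
    rw [norm_smul, norm_mul, Complex.norm_I, mul_one, Complex.norm_real, Real.norm_of_nonneg hl0]
    calc l * ‖P.hvec d‖ ≤ l * (B * ‖d‖) := by gcongr; exact hBh d
      _ = _ := by ring
  have hBδ : B * δ = ρ / 2 := by rw [hδ]; field_simp
  have hvρ : ‖v‖ < ρ := by
    have : B * (l * ‖d‖) ≤ B * (δ / 2) := by gcongr
    calc ‖v‖ ≤ ‖η‖ + B * (l * ‖d‖) := (norm_add_le _ _).trans (by gcongr)
      _ < ρ := by nlinarith
  -- polynomial growth
  have hpg : ∀ p ∈ P.tube ρ, ‖g p‖ ≤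
      (M₀ + M₁ * ((1 + B) * (1 + ‖x‖) + 2 * ρ) ^ 2) * (1 + ‖p.1‖) ^ 2 := by
    intro p hp
    refine (hgrow p hp).trans ?_
    have h1 : ‖p.1 - x‖ ≤ (1 + ‖x‖) * (1 + ‖p.1‖) := by
      have := norm_sub_le p.1 x
      nlinarith [norm_nonneg x, norm_nonneg p.1]
    have h2 : ‖p.2 - P.theta x - η‖ ≤ B * ((1 + ‖x‖) * (1 + ‖p.1‖)) + 2 * ρ := by
      have e : p.2 - P.theta x - η = (p.2 - P.theta p.1) + (P.theta (p.1 - x) - η) := by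
        rw [← thetaL_apply, ← thetaL_apply, ← thetaL_apply, map_sub]; abel
      have hp' : ‖p.2 - P.theta p.1‖ < ρ := hp
      have h3 : ‖P.theta (p.1 - x)‖ ≤ B * ((1 + ‖x‖) * (1 + ‖p.1‖)) :=
        (hBt _).trans (by gcongr)
      rw [e]
      have h4 := norm_add_le (p.2 - P.theta p.1) (P.theta (p.1 - x) - η)
      have h5 := norm_sub_le (P.theta (p.1 - x)) η
      linarith
    have h3 : ‖p.1 - x‖ + ‖p.2 - P.theta x - η‖ ≤
        ((1 + B) * (1 + ‖x‖) + 2 * ρ) * (1 + ‖p.1‖) := by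
      nlinarith [norm_nonneg p.1]
    have h4 : 1 ≤ (1 + ‖p.1‖) ^ 2 := by nlinarith [norm_nonneg p.1]
    calc M₀ + M₁ * (‖p.1 - x‖ + ‖p.2 - P.theta x - η‖) ^ 2
        ≤ M₀ * (1 + ‖p.1‖) ^ 2 +
          M₁ * (((1 + B) * (1 + ‖x‖) + 2 * ρ) * (1 + ‖p.1‖)) ^ 2 := by
          gcongr
          nlinarith
      _ = _ := by rw [mul_pow]; ring
  rw [P.ker_eq_shift hh hg hpg η x w hvρ]
  have hsq : 0 < √h := Real.sqrt_pos.2 hh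
  have hss : √h * √h = h := Real.mul_self_sqrt hh.le
  set D := ‖d‖ / √h with hD
  have hD0 : 0 ≤ D := by positivity
  set X := Real.exp ((P.phi x - P.phi w + (Complex.I * pair d η).re) / h) with hX
  have hpt : ∀ y, ‖P.kerInt h g η x w v y‖ ≤ (X * Real.exp (-(c / 2) * gain δ ‖d‖ / h) *
      ((M₀ + M₁ * h) * (1 + B) ^ 2 * (1 + D) ^ 2) * Ca) *
        Real.exp (-1 * (‖y - w‖ / √h)) := by
    intro y
    set e := y - w with he
    set E := ‖e‖ / √h with hE
    have hE0 : 0 ≤ E := by positivity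
    have hxy : x - y = d - e := by rw [hd, he]; abel
    have hexp : (P.phi x - P.phi w - (1 / 2) * (P.H e e).re + (Complex.I * pair e η).re +
        (Complex.I * pair (x - y) v).re) ≤ P.phi x - P.phi w + (Complex.I * pair d η).re +
        (-(c / 2) * gain δ ‖d‖ - c / 4 * ‖e‖ ^ 2) := by
      have e1 : Complex.I * pair (x - y) v = Complex.I * pair d η - Complex.I * pair e η -
          (l : ℂ) * P.H d d + (l : ℂ) * P.H e d := by
        have e2 : P.H (d - e) d = P.H d d - P.H e d := by
          have e3 := map_sub P.H d e
          rw [e3, sub_apply]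
        rw [hxy, hv, pair_add_right, pair_smul_right, pair_hvec, pair_sub_left, e2]
        linear_combination ((l : ℂ) * P.H d d - (l : ℂ) * P.H e d) * Complex.I_sq
      rw [e1]
      simp only [Complex.add_re, Complex.sub_re, Complex.re_ofReal_mul]
      -- The shift contributes -l·H(d,d) + l·Re H(e,d). The cross term costs ¼H(e,e) + l²H(d,d), and
      -- l ≤ ½ leaves at least half of l·H(d,d).
      have h1 := P.H_re_cross e d l
      have h2 := hlow e
      have h3 := hlow d
      have h4 : l ^ 2 * (P.H d d).re ≤ (1 / 2) * l * (P.H d d).re := by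
        have := P.H_self_nonneg d
        gcongr; nlinarith
      have h5 : (1 / 2) * l * (c * ‖d‖ ^ 2) ≤ (1 / 2) * l * (P.H d d).re := by gcongr
      have h6 : (1 / 2) * l * (c * ‖d‖ ^ 2) = c / 2 * gain δ ‖d‖ := by rw [← hgain]; ring
      linarith
    -- The distance from (x, ξ(x)+η) is at most a constant times ‖e‖ + ‖d‖ = √h(E + D); the
    -- quadratic growth M₁ therefore costs one factor h.
    have hg1 : ‖g ((1 / 2 : ℂ) • (x + y), P.theta ((1 / 2 : ℂ) • (x + y)) + v)‖ ≤
        (M₀ + M₁ * h) * (1 + B) ^ 2 * (1 + D) ^ 2 * (1 + E) ^ 2 := by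
      refine (hgrow _ (P.mem_tube.2 hvρ)).trans ?_
      simp only
      have a1 : (1 / 2 : ℂ) • (x + y) - x = (1 / 2 : ℂ) • (e - d) := by
        have : e - d = (x + y) - (2 : ℂ) • x := by rw [he, hd, two_smul]; abel
        rw [this, smul_sub, smul_smul]; norm_num
      have a2 : ‖(1 / 2 : ℂ) • (e - d)‖ ≤ (1 / 2) * (‖e‖ + ‖d‖) := by
        rw [norm_smul]
        have := norm_sub_le e d
        norm_num
        linarith
      have a3 : P.theta ((1 / 2 : ℂ) • (x + y)) + v - P.theta x - η =
          P.theta ((1 / 2 : ℂ) • (e - d)) + ((l : ℂ) * Complex.I) • P.hvec d := by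
        rw [← a1, hv, ← thetaL_apply, ← thetaL_apply, ← thetaL_apply, map_sub]; abel
      have a4 : ‖P.theta ((1 / 2 : ℂ) • (e - d)) + ((l : ℂ) * Complex.I) • P.hvec d‖ ≤
          B * ((1 / 2) * (‖e‖ + ‖d‖)) + B * ((1 / 2) * ‖d‖) := by
        refine (norm_add_le _ _).trans (add_le_add ((hBt _).trans (by gcongr)) (hlI.trans ?_))
        gcongr
      rw [a1, a3]
      have a5 : ‖(1 / 2 : ℂ) • (e - d)‖ +
          ‖P.theta ((1 / 2 : ℂ) • (e - d)) + ((l : ℂ) * Complex.I) • P.hvec d‖ ≤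
          (1 + B) * (‖e‖ + ‖d‖) := by
        nlinarith [norm_nonneg e, norm_nonneg d]
      have a6 : ‖e‖ + ‖d‖ = √h * (E + D) := by rw [hE, hD]; field_simp
      have a7 : E + D ≤ (1 + D) * (1 + E) := by nlinarith
      have a8 : 1 ≤ (1 + B) * ((1 + D) * (1 + E)) := by
        have : 1 ≤ (1 + D) * (1 + E) := by nlinarith
        nlinarith
      calc _ ≤ M₀ * ((1 + B) * ((1 + D) * (1 + E))) ^ 2 +
            M₁ * ((1 + B) * (√h * ((1 + D) * (1 + E)))) ^ 2 := by
            gcongr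
            · exact le_mul_of_one_le_right hM₀ (one_le_pow₀ a8)
            · exact a5.trans (by rw [a6]; gcongr)
        _ = M₀ * ((1 + B) * ((1 + D) * (1 + E))) ^ 2 +
            M₁ * (√h * √h) * ((1 + B) * ((1 + D) * (1 + E))) ^ 2 := by ring
        _ = _ := by rw [hss]; ring
    rw [norm_kerInt]
    have hE2 : ‖e‖ ^ 2 / h = E ^ 2 := by rw [hE, div_pow, Real.sq_sqrt hh.le]
    have hg2 := hgauss E hE0
    calc _ ≤ Real.exp ((P.phi x - P.phi w + (Complex.I * pair d η).re +
          (-(c / 2) * gain δ ‖d‖ - c / 4 * ‖e‖ ^ 2)) / h) *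
          ((M₀ + M₁ * h) * (1 + B) ^ 2 * (1 + D) ^ 2 * (1 + E) ^ 2) := by gcongr
      _ = X * Real.exp (-(c / 2) * gain δ ‖d‖ / h) * ((M₀ + M₁ * h) * (1 + B) ^ 2 * (1 + D) ^ 2) *
          ((1 + E) ^ 2 * Real.exp (0 * E - c / 4 * E ^ 2)) := by
          have : (P.phi x - P.phi w + (Complex.I * pair d η).re +
              (-(c / 2) * gain δ ‖d‖ - c / 4 * ‖e‖ ^ 2)) / h =
              (P.phi x - P.phi w + (Complex.I * pair d η).re) / h +
              -(c / 2) * gain δ ‖d‖ / h + (0 * E - c / 4 * E ^ 2) := by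
            rw [← hE2]; ring
          rw [this, Real.exp_add, Real.exp_add]; ring
      _ ≤ X * Real.exp (-(c / 2) * gain δ ‖d‖ / h) * ((M₀ + M₁ * h) * (1 + B) ^ 2 * (1 + D) ^ 2) *
          (Ca * Real.exp (-E)) := by gcongr
      _ = _ := by rw [neg_one_mul]; ring
  have hint : ‖∫ y, P.kerInt h g η x w v y‖ ≤ (X * Real.exp (-(c / 2) * gain δ ‖d‖ / h) *
      ((M₀ + M₁ * h) * (1 + B) ^ 2 * (1 + D) ^ 2) * Ca) * (h ^ n * I₀) := by
    rw [hI₀, ← integral_exp_scaled hh 1 w, ← integral_const_mul]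
    exact norm_integral_le_of_norm_le ((integrable_exp_scaled hh one_pos w).const_mul _)
      (Filter.Eventually.of_forall hpt)
  -- Half of the available decay, c/4 out of c/2, absorbs the polynomial in D; the other half
  -- survives as c₁.
  have hDbound : (1 + D) ^ 2 * Real.exp (-(c / 4) * gain δ ‖d‖ / h) ≤
      Cb * Real.exp (c / 4 * ((1 / 2) * δ ^ 2)) := by
    have h1 := gain_div_ge hδ0 hh hh1 (norm_nonneg d)
    rw [← hD] at h1
    calc _ ≤ Cb * Real.exp (c / 4 * ((1 / 2) * δ) * D) *
          Real.exp (-(c / 4) * ((1 / 2) * (δ * D - δ ^ 2))) := by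
          gcongr
          · exact hpoly D hD0
          · rw [mul_div_assoc]
            exact mul_le_mul_of_nonpos_left h1 (by linarith)
      _ = _ := by rw [mul_assoc, ← Real.exp_add]; congr 2; ring
  refine hint.trans ?_
  have hsplit : Real.exp (-(c / 2) * gain δ ‖d‖ / h) =
      Real.exp (-(c / 4) * gain δ ‖d‖ / h) * Real.exp (-(c / 4) * gain δ ‖d‖ / h) := by
    rw [← Real.exp_add]; congr 1; ring
  have hfin : Real.exp ((P.phi x - P.phi w + (Complex.I * pair d η).re -
      c / 4 * gain δ ‖d‖) / h) = X * Real.exp (-(c / 4) * gain δ ‖d‖ / h) := by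
    rw [hX, ← Real.exp_add]; congr 1; ring
  rw [hsplit, hfin]
  have hM : 0 ≤ M₀ + M₁ * h := by positivity
  calc X * (Real.exp (-(c / 4) * gain δ ‖d‖ / h) * Real.exp (-(c / 4) * gain δ ‖d‖ / h)) *
        ((M₀ + M₁ * h) * (1 + B) ^ 2 * (1 + D) ^ 2) * Ca * (h ^ n * I₀)
      = ((1 + D) ^ 2 * Real.exp (-(c / 4) * gain δ ‖d‖ / h)) *
        (X * Real.exp (-(c / 4) * gain δ ‖d‖ / h) * ((M₀ + M₁ * h) * (1 + B) ^ 2) * Ca *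
        (h ^ n * I₀)) := by ring
    _ ≤ (Cb * Real.exp (c / 4 * ((1 / 2) * δ ^ 2))) *
        (X * Real.exp (-(c / 4) * gain δ ‖d‖ / h) * ((M₀ + M₁ * h) * (1 + B) ^ 2) * Ca *
        (h ^ n * (I₀ + 1))) := by gcongr; linarith
    _ = _ := by ring

end Weight

/-! ### The Weyl integral as an integral operator -/

lemma RapidDecay.integrable_red {φ : Cn n → ℝ} (hφ : Continuous φ) {h : ℝ} {u : Cn n → ℂ}
    (hu : Continuous u) (hr : RapidDecay φ h u) : Integrable (red φ h u) := by
  obtain ⟨C, hC⟩ := hr (2 * n + 1)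
  have hf : Module.finrank ℝ (Cn n) = 2 * n := by
    rw [Module.finrank_pi_fintype]; simp [mul_comm]
  have h1 := integrable_one_add_norm (E := Cn n) (μ := volume) (r := (2 * n + 1 : ℕ))
    (by rw [hf]; push_cast; linarith)
  refine (h1.const_mul C).mono' (continuous_red hφ hu).aestronglyMeasurable
    (Filter.Eventually.of_forall fun x => ?_)
  have h2 : 0 < (1 + ‖x‖) ^ (2 * n + 1) := by positivity
  rw [Real.rpow_neg (by positivity), Real.rpow_natCast, norm_red, ← div_eq_mul_inv,
    le_div_iff₀ h2]
  calc ‖u x‖ * Real.exp (-φ x / h) * (1 + ‖x‖) ^ (2 * n + 1)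
      = ((1 + ‖x‖) ^ (2 * n + 1) * ‖u x‖) * Real.exp (-φ x / h) := by ring
    _ ≤ (C * Real.exp (φ x / h)) * Real.exp (-φ x / h) :=
          mul_le_mul_of_nonneg_right (hC x) (Real.exp_pos _).le
    _ = C := by rw [mul_assoc, ← Real.exp_add]; simp [neg_div]

namespace Weight
variable (P : Weight n)

/-- On the unshifted contour the Weyl phase telescopes with the weight, and the decay of the
reproducing kernel in y-w remains. This is enough for Fubini and for holomorphy in x. -/
lemma exists_norm_kerInt_zero_le {h : ℝ} (hh : 0 < h) (η : Cn n) : ∃ C : ℝ, 0 < C ∧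
    ∀ (g : Cn n × Cn n → ℂ) (A : ℝ) (x w y : Cn n),
      ‖g ((1 / 2 : ℂ) • (x + y), P.theta ((1 / 2 : ℂ) • (x + y)))‖ ≤ A →
      ‖P.kerInt h g η x w 0 y‖ ≤
        C * A * Real.exp ((P.phi x - P.phi w) / h) * Real.exp (-1 * ‖y - w‖) := by
  obtain ⟨C, hC, hb⟩ := P.exists_norm_repKer_le hh η
  refine ⟨C, hC, fun g A x w y hg => ?_⟩
  have h1 : Complex.I / h * pair (x - y) (P.theta ((1 / 2 : ℂ) • (x + y)) + 0) =
      (Complex.I * pair (x - y) (P.theta ((1 / 2 : ℂ) • (x + y)))) / h := by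
    rw [add_zero]; ring
  rw [kerInt, norm_mul, norm_mul, h1, norm_exp_div, re_weylPhase, add_zero]
  have hA : 0 ≤ A := (norm_nonneg _).trans hg
  calc _ ≤ Real.exp ((P.phi x - P.phi y) / h) * A *
        (C * Real.exp ((P.phi y - P.phi w) / h) * Real.exp (-‖y - w‖)) := by
        gcongr; exact hb y w
    _ = C * A * (Real.exp ((P.phi x - P.phi y) / h) * Real.exp ((P.phi y - P.phi w) / h)) *
        Real.exp (-1 * ‖y - w‖) := by rw [neg_one_mul]; ring
    _ = _ := by rw [← Real.exp_add]; congr 3; ring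

/-- The Weyl quantization in terms of the twisted Schwartz kernel. -/
lemma weylIntegral_eq_ker {h : ℝ} (hh : 0 < h) {ρ M : ℝ} (hρ : 0 < ρ) {a : Cn n × Cn n → ℂ}
    (ha : ContinuousOn a (P.tube ρ)) (hM : ∀ p ∈ P.tube ρ, ‖a p‖ ≤ M) (η : Cn n) {u : Cn n → ℂ}
    (hu : Differentiable ℂ u) (hL : MemLp (red P.phi h u) 2 volume) (hr : RapidDecay P.phi h u)
    (x : Cn n) : weylIntegral P.phi h a u x =
      P.wconst h * (P.gconst h * ∫ w, P.ker h a η x w * u w) := by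
  obtain ⟨C, hC, hb⟩ := P.exists_norm_kerInt_zero_le hh η
  have h0 : ‖(0 : Cn n)‖ < ρ := by simpa using hρ
  have hmem : ∀ m, (m, P.theta m) ∈ P.tube ρ := fun m => by
    have := (P.mem_tube (m := m) (v := 0)).2 h0
    rwa [add_zero] at this
  have hcont := P.continuous_kerInt (h := h) ha η h0
  set F : Cn n → Cn n → ℂ := fun y w => P.kerInt h a η x w 0 y * u w with hF
  have hFc : Continuous fun p : Cn n × Cn n => F p.1 p.2 := by
    have h3 : Continuous fun p : Cn n × Cn n => (x, p.2, p.1) := by fun_prop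
    have h4 := hcont.comp h3
    simp only [Function.comp_def] at h4
    exact h4.mul (hu.continuous.comp continuous_snd)
  -- Rapid decay makes u e^{-Φ/h} integrable, not merely square integrable; this gives absolute
  -- integrability in (y,w) and permits Fubini.
  have hri := (RapidDecay.integrable_red P.continuous_phi hu.continuous hr).norm
  have hei := integrable_exp_neg_norm (n := n) (c := 1) one_pos
  have hconv := hri.convolution_integrand (ContinuousLinearMap.mul ℝ ℝ) hei
  have hFi : Integrable (Function.uncurry F) (volume.prod volume) := by
    refine (hconv.const_mul (C * M * Real.exp (P.phi x / h))).mono' hFc.aestronglyMeasurable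
      (Filter.Eventually.of_forall fun p => ?_)
    rcases p with ⟨y, w⟩
    simp only [Function.uncurry, hF, norm_mul, ContinuousLinearMap.mul_apply', norm_red]
    calc _ ≤ (C * M * Real.exp ((P.phi x - P.phi w) / h) * Real.exp (-1 * ‖y - w‖)) * ‖u w‖ := by
          gcongr; exact hb a M x w y (hM _ (hmem _))
      _ = _ := by rw [exp_phi_sub]; ring
  have hsw := integral_integral_swap hFi
  have hin : ∀ y, Complex.exp (Complex.I / h * pair (x - y) (P.theta ((1 / 2 : ℂ) • (x + y)))) *
      a ((1 / 2 : ℂ) • (x + y), P.theta ((1 / 2 : ℂ) • (x + y))) * u y =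
      P.gconst h * ∫ w, F y w := by
    intro y
    rw [← P.rep_formula hh η y hu hL, mul_left_comm]
    congr 1
    rw [← integral_const_mul]
    refine integral_congr_ae (Filter.Eventually.of_forall fun w => ?_)
    simp only [hF, kerInt, add_zero]
    ring
  rw [P.weylIntegral_eq hh]
  congr 1
  simp only [hin]
  rw [integral_const_mul, hsw]
  congr 1
  refine integral_congr_ae (Filter.Eventually.of_forall fun w => ?_)
  simp only [hF, ker]
  rw [integral_mul_const]

lemma aestronglyMeasurable_ker {h ρ : ℝ} {g : Cn n × Cn n → ℂ} (hρ : 0 < ρ)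
    (hg : ContinuousOn g (P.tube ρ)) (η x : Cn n) :
    AEStronglyMeasurable (P.ker h g η x) volume := by
  have h0 : ‖(0 : Cn n)‖ < ρ := by simpa using hρ
  have hcont := P.continuous_kerInt (h := h) hg η h0
  have h3 : Continuous fun p : Cn n × Cn n => (x, p.1, p.2) := by fun_prop
  have h4 := hcont.comp h3
  simp only [Function.comp_def] at h4
  have h5 := h4.stronglyMeasurable.integral_prod_right' (ν := (volume : Measure (Cn n)))
  exact h5.aestronglyMeasurable

/-- In the variable y the symbol is evaluated at points depending non-holomorphically on x through
`theta`. In the midpoint variable m the value a(m, θ(m)) is independent of x, which then enters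
through entire factors only. -/
lemma differentiable_ker {h ρ M : ℝ} (hh : 0 < h) (hρ : 0 < ρ) {a : Cn n × Cn n → ℂ}
    (ha : DifferentiableOn ℂ a (P.tube ρ)) (hM : ∀ p ∈ P.tube ρ, ‖a p‖ ≤ M) (η w : Cn n) :
    Differentiable ℂ fun x => P.ker h a η x w := by
  obtain ⟨C, hC, hb⟩ := P.exists_norm_kerInt_zero_le hh η
  have h0 : ‖(0 : Cn n)‖ < ρ := by simpa using hρ
  have hmem : ∀ m, (m, P.theta m) ∈ P.tube ρ := fun m => by
    have := (P.mem_tube (m := m) (v := 0)).2 h0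
    rwa [add_zero] at this
  have hmid : ∀ x m : Cn n, (1 / 2 : ℂ) • (x + ((2 : ℂ) • m - x)) = m := fun x m => by
    rw [add_sub_cancel, smul_smul]; norm_num
  have hM0 : 0 ≤ M := (norm_nonneg _).trans (hM _ (hmem 0))
  have he : ∀ x m, P.kerInt h a η x w 0 ((2 : ℂ) • m - x) =
      Complex.exp (Complex.I / h * pair (x - ((2 : ℂ) • m - x)) (P.theta m)) *
      a (m, P.theta m) * P.repKer h η ((2 : ℂ) • m - x) w := by
    intro x m
    rw [kerInt, hmid, add_zero]
  have heq : (fun x => P.ker h a η x w) = fun x => |((2 : ℝ) ^ Module.finrank ℝ (Cn n))| •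
      ∫ m, P.kerInt h a η x w 0 ((2 : ℂ) • m - x) := by
    ext x; rw [ker, integral_midpoint _ x]
  rw [heq]
  intro x₀
  refine DifferentiableAt.const_smul (F := ℂ) (f := fun x =>
    ∫ m, P.kerInt h a η x w 0 ((2 : ℂ) • m - x)) ?_ |((2 : ℝ) ^ Module.finrank ℝ (Cn n))|
  obtain ⟨B, hB, hphi⟩ := P.exists_phi_bound h x₀
  have hcont := P.continuous_kerInt (h := h) ha.continuousOn η h0
  refine (hasFDerivAt_integral_of_holomorphic
    (k := fun x m => P.kerInt h a η x w 0 ((2 : ℂ) • m - x)) one_pos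
    (bound := fun m => C * M * (B * Real.exp (-P.phi w / h)) * (Real.exp 1 *
      Real.exp (-1 * ‖x₀ - ((2 : ℂ) • m - w)‖)))
    (fun x _ => ?_) (Filter.Eventually.of_forall fun m => ?_)
    (Filter.Eventually.of_forall fun m x hx => ?_) ?_).1.differentiableAt
  · have h3 : Continuous fun m : Cn n => (x, w, (2 : ℂ) • m - x) := by fun_prop
    have h4 := hcont.comp h3
    simp only [Function.comp_def] at h4
    exact h4.aestronglyMeasurable
  · simp only [he]
    have h1 : Differentiable ℂ fun x : Cn n => (2 : ℂ) • m - x := by fun_prop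
    have h2 : Differentiable ℂ fun x : Cn n => x - ((2 : ℂ) • m - x) := by fun_prop
    have h3 : Differentiable ℂ fun x : Cn n => P.repKer h η ((2 : ℂ) • m - x) w :=
      (P.differentiable_repKer h η w).comp h1
    have h5 : Differentiable ℂ fun x : Cn n => Complex.exp (Complex.I / h *
        pair (x - ((2 : ℂ) • m - x)) (P.theta m)) := by
      refine Differentiable.cexp (Differentiable.const_mul ?_ _)
      exact differentiable_pair h2 (differentiable_const _)
    exact ((h5.mul_const _).mul h3).differentiableOn
  · refine (hb a M x w _ (hM _ (hmem _))).trans ?_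
    have h1 := hphi x hx
    have h2 := exp_neg_norm_le_of_mem_ball one_pos hx ((2 : ℂ) • m - w)
    have h3 : (2 : ℂ) • m - x - w = -(x - ((2 : ℂ) • m - w)) := by abel
    rw [h3, norm_neg, exp_phi_sub]
    gcongr
  · refine Integrable.const_mul (Integrable.const_mul ?_ _) _
    have h1 := (integrable_exp_neg_norm (n := n) (c := 2) two_pos).comp_sub_right
      ((1 / 2 : ℂ) • (x₀ + w))
    refine h1.congr (Filter.Eventually.of_forall fun m => ?_)
    simp only
    have h2 : x₀ - ((2 : ℂ) • m - w) = (-2 : ℂ) • (m - (1 / 2 : ℂ) • (x₀ + w)) := by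
      rw [smul_sub, smul_smul, neg_smul]; norm_num; abel
    rw [h2, norm_smul]
    norm_num

end Weight

/-! ### The kernel in the perturbed weight and the operator on H_Φ -/

/-- The Taylor remainder is at most εt² by the Lipschitz gradient and 2εt by the bounded gradient.
Using the former for t ≤ 1 and the latter for t ≥ 1 matches the quadratic-then-linear shape of the
gain. -/
lemma taylor_le_gain {δ : ℝ} (hδ : 0 < δ) {ε : ℝ≥0} {f : Cn n → ℝ} (hf : Differentiable ℝ f)
    (hf1 : ∀ x, ‖fderiv ℝ f x‖ ≤ ε) (hf2 : LipschitzWith ε (fderiv ℝ f)) (x w : Cn n) :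
    f w - f x + fderiv ℝ f x (x - w) ≤ ε * (4 * (δ + 1) / δ) * gain δ ‖x - w‖ := by
  set t := ‖x - w‖ with ht
  have ht0 : 0 ≤ t := norm_nonneg _
  have hwx : ‖w - x‖ = t := by rw [ht, norm_sub_rev]
  have key : ∀ C : ℝ, (∀ z ∈ segment ℝ x w, ‖fderiv ℝ f z - fderiv ℝ f x‖ ≤ C) →
      f w - f x + fderiv ℝ f x (x - w) ≤ C * t := by
    intro C hC
    have h1 := (convex_segment x w).norm_image_sub_le_of_norm_fderiv_le' (𝕜 := ℝ)
      (fun z _ => hf z) hC (left_mem_segment ℝ x w) (right_mem_segment ℝ x w)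
    rw [hwx] at h1
    have h2 : fderiv ℝ f x (x - w) = -fderiv ℝ f x (w - x) := by rw [← map_neg, neg_sub]
    rw [h2]
    have := Real.le_norm_self (f w - f x - fderiv ℝ f x (w - x))
    linarith
  have hε : (0 : ℝ) ≤ ε := ε.2
  have h1 : f w - f x + fderiv ℝ f x (x - w) ≤ (ε * t) * t := by
    refine key _ fun z hz => ?_
    have h2 := hf2.dist_le_mul z x
    rw [dist_eq_norm, dist_eq_norm] at h2
    refine h2.trans ?_
    gcongr
    rw [← hwx]
    exact norm_sub_le_of_mem_segment hz
  have h2 : f w - f x + fderiv ℝ f x (x - w) ≤ (2 * ε) * t := by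
    refine key _ fun z _ => (norm_sub_le _ _).trans ?_
    have := hf1 z
    have := hf1 x
    linarith
  have h3 : ε * (4 * (δ + 1) / δ) * gain δ t = ε * (2 * (δ + 1) * t ^ 2 / (δ + t)) := by
    have : 0 < δ + t := by positivity
    rw [gain]; field_simp; ring
  rw [h3]
  rcases le_total t 1 with h | h
  · refine h1.trans ?_
    rw [mul_assoc]
    gcongr
    rw [le_div_iff₀ (by positivity)]
    nlinarith [sq_nonneg t]
  · refine h2.trans ?_
    rw [mul_comm 2 (ε : ℝ), mul_assoc]
    gcongr
    rw [le_div_iff₀ (by positivity)]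
    nlinarith [mul_nonneg hδ.le (sub_nonneg.2 h),
      mul_nonneg ht0 (mul_nonneg hδ.le (sub_nonneg.2 h))]

namespace Weight
variable (P : Weight n)

/-- Of the factor h^{-2n}, one h^{-n} is cancelled by the hⁿ in the bound for `ker`; the other
normalizes `convKer`. -/
lemma wconst_mul_gconst {h : ℝ} (hh : 0 < h) :
    P.wconst h * P.gconst h = P.wconst 1 ^ 2 * 2 ^ n / (h ^ n * h ^ n) := by
  rw [gconst, P.wconst_scale hh, P.wconst_scale (h := h / 2) (by positivity), div_pow]
  have : h ^ n ≠ 0 := by positivity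
  field_simp

/-- The normalized Schwartz kernel, read between the spaces with weight `φ + f`, is dominated by
a convolution kernel at scale `√h`. -/
lemma exists_norm_ker_mul_le {ρ : ℝ} (hρ : 0 < ρ) : ∃ (ε : ℝ≥0) (b D : ℝ), 0 < ε ∧ 0 < b ∧ 0 < D ∧
    ∀ (f : Cn n → ℝ), Differentiable ℝ f → (∀ x, ‖fderiv ℝ f x‖ ≤ ε) →
      LipschitzWith ε (fderiv ℝ f) →
    ∀ (h : ℝ), 0 < h → h ≤ 1 → ∀ (g : Cn n × Cn n → ℂ), DifferentiableOn ℂ g (P.tube ρ) →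
    ∀ (M₀ M₁ : ℝ), 0 ≤ M₀ → 0 ≤ M₁ → ∀ (x : Cn n),
    (∀ p ∈ P.tube ρ, ‖g p‖ ≤ M₀ + M₁ * (‖p.1 - x‖ + ‖p.2 - P.theta x - eta f x‖) ^ 2) →
    ∀ (U : Cn n → ℂ) (w : Cn n),
      ‖(P.wconst h * P.gconst h * P.ker h g (eta f x) x w) * U w‖ ≤
      Real.exp ((P.phi x + f x) / h) * (convKer (D * (M₀ + M₁ * h)) b h (x - w) *
        ‖red (fun x => P.phi x + f x) h U w‖) := by
  obtain ⟨δ, c, C, hδ, hc, hC, hker⟩ := P.exists_norm_ker_le hρ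
  -- The first entry gives ‖`eta f x`‖ ≤ 2ε ≤ ρ/2, as the kernel bound requires; the second lets
  -- half of the gain absorb the Taylor remainder of f.
  set ε : ℝ := min (ρ / 4) (c / 2 / (4 * (δ + 1) / δ)) with hε
  have hε0 : 0 < ε := by positivity
  have hερ : ε ≤ ρ / 4 := min_le_left _ _
  have hεc : ε * (4 * (δ + 1) / δ) ≤ c / 2 := by
    rw [← le_div_iff₀ (by positivity)]; exact min_le_right _ _
  have hW := P.wconst_pos one_pos
  refine ⟨⟨ε, hε0.le⟩, c / 4 * δ, P.wconst 1 ^ 2 * 2 ^ n * C * Real.exp (c / 4 * δ ^ 2), hε0,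
    by positivity, by positivity, ?_⟩
  intro f hf hf1 hf2 h hh h1 g hg M₀ M₁ hM₀ hM₁ x hgrow U w
  have heta : ‖eta f x‖ ≤ ρ / 2 := (norm_eta_le _ _).trans (by
    have : ‖fderiv ℝ f x‖ ≤ ε := hf1 x
    linarith)
  have hk := hker h hh h1 g hg M₀ M₁ hM₀ hM₁ (eta f x) x heta hgrow w
  have hT : f w - f x + fderiv ℝ f x (x - w) ≤ ε * (4 * (δ + 1) / δ) * gain δ ‖x - w‖ :=
    taylor_le_gain hδ hf hf1 hf2 x w
  have hG := gain_nonneg hδ (norm_nonneg (x - w))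
  have hGd := gain_div_ge hδ hh h1 (norm_nonneg (x - w))
  set s := ‖x - w‖ / √h with hs
  have hre : (Complex.I * pair (x - w) (eta f x)).re = fderiv ℝ f x (x - w) :=
    re_I_mul_dot_eta f x _
  have hexp : (P.phi x - P.phi w + (Complex.I * pair (x - w) (eta f x)).re -
      c * gain δ ‖x - w‖) / h ≤ (P.phi x + f x) / h + -(P.phi w + f w) / h +
      (c / 4 * δ ^ 2 + -(c / 4 * δ) * s) := by
    have h2 : ε * (4 * (δ + 1) / δ) * gain δ ‖x - w‖ ≤ c / 2 * gain δ ‖x - w‖ := by gcongr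
    have h3 : (P.phi x - P.phi w + (Complex.I * pair (x - w) (eta f x)).re -
        c * gain δ ‖x - w‖) / h ≤ ((P.phi x + f x) + -(P.phi w + f w) -
          c / 2 * gain δ ‖x - w‖) / h := by
      refine div_le_div_of_nonneg_right ?_ hh.le
      rw [hre]
      linarith
    have h4 : c / 2 * ((1 / 2) * (δ * s - δ ^ 2)) ≤ c / 2 * (gain δ ‖x - w‖ / h) := by gcongr
    refine h3.trans ?_
    rw [sub_div, add_div, mul_div_assoc]
    linarith
  have hM : 0 ≤ M₀ + M₁ * h := by positivity
  have hwg : 0 ≤ P.wconst h * P.gconst h := (mul_pos (P.wconst_pos hh) (P.gconst_pos hh)).le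
  rw [norm_mul, norm_mul, ← Complex.ofReal_mul, Complex.norm_real, Real.norm_of_nonneg hwg,
    norm_red, convKer, ← hs]
  calc P.wconst h * P.gconst h * ‖P.ker h g (eta f x) x w‖ * ‖U w‖
      ≤ P.wconst h * P.gconst h * (C * h ^ n * (M₀ + M₁ * h) *
        Real.exp ((P.phi x + f x) / h + -(P.phi w + f w) / h +
          (c / 4 * δ ^ 2 + -(c / 4 * δ) * s))) * ‖U w‖ := by
        gcongr
        exact hk.trans (by gcongr)
    _ = _ := by
        have : h ^ n ≠ 0 := by positivity
        rw [P.wconst_mul_gconst hh, Real.exp_add, Real.exp_add, Real.exp_add]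
        field_simp

lemma eta_zero (x : Cn n) : eta (fun _ => (0 : ℝ)) x = 0 := by
  have h := norm_eta_le (fun _ : Cn n => (0 : ℝ)) x
  simpa using h

/-- The Weyl quantization as an integral operator with Schwartz kernel `P.ker`. -/
def weylOp (h : ℝ) (a : Cn n × Cn n → ℂ) (u : Cn n → ℂ) (x : Cn n) : ℂ :=
  ∫ w, (P.wconst h * P.gconst h * P.ker h a 0 x w) * u w

lemma weylIntegral_eq_kernel {h : ℝ} (hh : 0 < h) {ρ M : ℝ} (hρ : 0 < ρ) {a : Cn n × Cn n → ℂ}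
    (ha : ContinuousOn a (P.tube ρ)) (hM : ∀ p ∈ P.tube ρ, ‖a p‖ ≤ M) (η : Cn n) {u : Cn n → ℂ}
    (hu : Differentiable ℂ u) (hL : MemLp (red P.phi h u) 2 volume) (hr : RapidDecay P.phi h u)
    (x : Cn n) : weylIntegral P.phi h a u x =
      ∫ w, (P.wconst h * P.gconst h * P.ker h a η x w) * u w := by
  rw [P.weylIntegral_eq_ker hh hρ ha hM η hu hL hr, ← mul_assoc, ← integral_const_mul]
  simp only [mul_assoc]

/-- Bounds for the Schwartz kernel of the Weyl quantization of a bounded symbol. -/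
lemma exists_norm_weylOp_ker_le {h ρ M : ℝ} (hh : 0 < h) (h1 : h ≤ 1) (hρ : 0 < ρ)
    {a : Cn n × Cn n → ℂ} (ha : DifferentiableOn ℂ a (P.tube ρ))
    (hM : ∀ p ∈ P.tube ρ, ‖a p‖ ≤ M) (hM0 : 0 ≤ M) : ∃ b D : ℝ, 0 < b ∧ 0 ≤ D ∧
    ∀ (U : Cn n → ℂ) x w, ‖(P.wconst h * P.gconst h * P.ker h a 0 x w) * U w‖ ≤
      Real.exp (P.phi x / h) * (convKer D b h (x - w) * ‖red P.phi h U w‖) := by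
  obtain ⟨ε, b, D, -, hb, hD, hk⟩ := P.exists_norm_ker_mul_le hρ
  refine ⟨b, D * M, hb, by positivity, fun U x w => ?_⟩
  have := hk (fun _ => 0) (differentiable_const _) (by simp) (by
      rw [show fderiv ℝ (fun _ : Cn n => (0 : ℝ)) = fun _ => 0 by ext; simp]
      exact LipschitzWith.const' _)
    h hh h1 a ha M 0 hM0 le_rfl x (by simpa using hM) U w
  simpa [eta_zero] using this

lemma differentiable_weylOp {h ρ M : ℝ} (hh : 0 < h) (h1 : h ≤ 1) (hρ : 0 < ρ)
    {a : Cn n × Cn n → ℂ} (ha : DifferentiableOn ℂ a (P.tube ρ))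
    (hM : ∀ p ∈ P.tube ρ, ‖a p‖ ≤ M) (hM0 : 0 ≤ M) {u : Cn n → ℂ}
    (hL : MemLp (red P.phi h u) 2 volume) : Differentiable ℂ (P.weylOp h a u) := fun y => by
  obtain ⟨b, D, hb, hD, hk⟩ := P.exists_norm_weylOp_ker_le hh h1 hρ ha hM hM0
  have hsq : 0 < √h := Real.sqrt_pos.2 hh
  refine (P.hasFDerivAt_kernel (h := h) (C := D * (h ^ n)⁻¹) (c := b / √h) (by positivity)
    (K := fun x w => P.wconst h * P.gconst h * P.ker h a 0 x w)
    (fun w => (P.differentiable_ker hh hρ ha hM 0 w).const_mul _)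
    (fun x => (P.aestronglyMeasurable_ker hρ ha.continuousOn 0 x).const_mul _) hL
    (fun x w => (hk u x w).trans (le_of_eq ?_)) y).1.differentiableAt
  rw [convKer]
  have : -b * (‖x - w‖ / √h) = -(b / √h) * ‖x - w‖ := by ring
  rw [this]; ring

lemma integrable_weylOp {h ρ M : ℝ} (hh : 0 < h) (h1 : h ≤ 1) (hρ : 0 < ρ)
    {a : Cn n × Cn n → ℂ} (ha : DifferentiableOn ℂ a (P.tube ρ))
    (hM : ∀ p ∈ P.tube ρ, ‖a p‖ ≤ M) (hM0 : 0 ≤ M) {u : Cn n → ℂ}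
    (hL : MemLp (red P.phi h u) 2 volume) (x : Cn n) :
    Integrable fun w => (P.wconst h * P.gconst h * P.ker h a 0 x w) * u w := by
  obtain ⟨b, D, hb, hD, hk⟩ := P.exists_norm_weylOp_ker_le hh h1 hρ ha hM hM0
  have hsq : 0 < √h := Real.sqrt_pos.2 hh
  refine ((integrable_exp_mul_norm (c := b / √h) (by positivity) x hL).const_mul
    (Real.exp (P.phi x / h) * (D * (h ^ n)⁻¹))).mono'
    (((P.aestronglyMeasurable_ker hρ ha.continuousOn 0 x).const_mul _).mul
      (P.aestronglyMeasurable_of_red hL.1))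
    (Filter.Eventually.of_forall fun w => (hk u x w).trans (le_of_eq ?_))
  rw [convKer]
  have : -b * (‖x - w‖ / √h) = -(b / √h) * ‖x - w‖ := by ring
  rw [this]; ring

lemma exists_eLpNorm_weylOp_le {h ρ M : ℝ} (hh : 0 < h) (h1 : h ≤ 1) (hρ : 0 < ρ)
    {a : Cn n × Cn n → ℂ} (ha : DifferentiableOn ℂ a (P.tube ρ))
    (hM : ∀ p ∈ P.tube ρ, ‖a p‖ ≤ M) (hM0 : 0 ≤ M) : ∃ C : ℝ, 0 ≤ C ∧ ∀ u : Cn n → ℂ,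
    MemLp (red P.phi h u) 2 volume → eLpNorm (red P.phi h (P.weylOp h a u)) 2 volume ≤
      ENNReal.ofReal C * eLpNorm (red P.phi h u) 2 volume := by
  obtain ⟨b, D, hb, hD, hk⟩ := P.exists_norm_weylOp_ker_le hh h1 hρ ha hM hM0
  refine ⟨D * ∫ y : Cn n, Real.exp (-b * ‖y‖),
    mul_nonneg hD (integral_nonneg fun _ => (Real.exp_pos _).le), fun u hL => ?_⟩
  rw [← lintegral_convKer hD hb hh]
  exact eLpNorm_red_le (measurable_convKer D b h) (convKer_nonneg hD hh) (fun x => rfl) hL (hk u)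

/-- The operator on `H_φ` quantizing `a`. -/
lemma exists_isWeylQuantization {h ρ M : ℝ} (hh : 0 < h) (h1 : h ≤ 1) (hρ : 0 < ρ)
    {a : Cn n × Cn n → ℂ} (ha : DifferentiableOn ℂ a (P.tube ρ))
    (hM : ∀ p ∈ P.tube ρ, ‖a p‖ ≤ M) (hM0 : 0 ≤ M) : ∃ T : HSpace P.phi h →ₗ[ℂ] HSpace P.phi h,
    IsWeylQuantization P.phi h a T := by
  obtain ⟨C, hC, hbd⟩ := P.exists_eLpNorm_weylOp_le hh h1 hρ ha hM hM0
  have hmem : ∀ u : HSpace P.phi h, P.weylOp h a u ∈ HSpace P.phi h := fun u => by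
    obtain ⟨h2, h3⟩ := (mem_HSpace_iff P.continuous_phi h).1 u.2
    have h4 := P.differentiable_weylOp hh h1 hρ ha hM hM0 h3
    exact (mem_HSpace_iff P.continuous_phi h).2 ⟨h4,
      (continuous_red P.continuous_phi h4.continuous).aestronglyMeasurable,
      (hbd _ h3).trans_lt (ENNReal.mul_lt_top ENNReal.ofReal_lt_top h3.2)⟩
  have hint := fun (u : HSpace P.phi h) (x : Cn n) => P.integrable_weylOp hh h1 hρ ha hM hM0
    ((mem_HSpace_iff P.continuous_phi h).1 u.2).2 x
  refine ⟨{ toFun := fun u => ⟨P.weylOp h a u, hmem u⟩, map_add' := ?_, map_smul' := ?_ }, ?_, ?_⟩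
  · intro u v
    ext x
    simp only [Submodule.coe_add, Pi.add_apply, weylOp, mul_add]
    exact integral_add (hint u x) (hint v x)
  · intro c u
    ext x
    simp only [Submodule.coe_smul, Pi.smul_apply, weylOp, RingHom.id_apply, smul_eq_mul]
    rw [← integral_const_mul]
    simp only [mul_left_comm]
  · refine ⟨C, fun u => ?_⟩
    have h3 := ((mem_HSpace_iff P.continuous_phi h).1 u.2).2
    have h4 := ((mem_HSpace_iff P.continuous_phi h).1 (hmem u)).2
    rw [wNorm_eq P.continuous_phi h h3]
    simp only [LinearMap.coe_mk, AddHom.coe_mk]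
    rw [wNorm_eq P.continuous_phi h h4]
    have h5 := ENNReal.toReal_mono (ENNReal.mul_ne_top ENNReal.ofReal_ne_top h3.2.ne) (hbd _ h3)
    rwa [ENNReal.toReal_mul, ENNReal.toReal_ofReal hC] at h5
  · intro u hr x
    obtain ⟨h2, h3⟩ := (mem_HSpace_iff P.continuous_phi h).1 u.2
    exact (P.weylIntegral_eq_kernel hh hρ ha.continuousOn hM 0 h2 h3 hr x).symm

end Weight

/-! ### Uniqueness of the quantization -/

lemma differentiable_coe {φ : Cn n → ℝ} {h : ℝ} (u : HSpace φ h) :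
    Differentiable ℂ (u : Cn n → ℂ) := u.2.1

lemma memLp_red_coe {φ : Cn n → ℝ} (hφ : Continuous φ) {h : ℝ} (u : HSpace φ h) :
    MemLp (red φ h (u : Cn n → ℂ)) 2 volume := ((mem_HSpace_iff hφ h).1 u.2).2

lemma exists_eLpNorm_le_of_wNorm_le {φ : Cn n → ℝ} (hφ : Continuous φ) {h : ℝ}
    {T : HSpace φ h →ₗ[ℂ] HSpace φ h}
    (hT : ∃ M : ℝ, ∀ u : HSpace φ h, wNorm φ h (T u : Cn n → ℂ) ≤ M * wNorm φ h (u : Cn n → ℂ)) :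
    ∃ M : ℝ, 0 ≤ M ∧ ∀ u : HSpace φ h, eLpNorm (red φ h (T u : Cn n → ℂ)) 2 volume ≤
      ENNReal.ofReal M * eLpNorm (red φ h (u : Cn n → ℂ)) 2 volume := by
  obtain ⟨M, hM⟩ := hT
  refine ⟨|M|, abs_nonneg M, fun u => ?_⟩
  have h1 := hM u
  have h2 := memLp_red_coe hφ u
  have h3 := memLp_red_coe hφ (T u)
  rw [wNorm_eq hφ h h2, wNorm_eq hφ h h3] at h1
  rw [← ENNReal.toReal_le_toReal h3.2.ne (ENNReal.mul_ne_top ENNReal.ofReal_ne_top h2.2.ne),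
    ENNReal.toReal_mul, ENNReal.toReal_ofReal (abs_nonneg M)]
  exact h1.trans (mul_le_mul_of_nonneg_right (le_abs_self M) ENNReal.toReal_nonneg)

namespace Weight
variable (P : Weight n)

/-- Two bounded operators that agree on the dense set of rapidly decaying functions agree in L²;
their values are continuous functions, so equality a.e. is equality everywhere. -/
lemma isWeylQuantization_unique {h : ℝ} (hh : 0 < h) {a : Cn n × Cn n → ℂ}
    {T₁ T₂ : HSpace P.phi h →ₗ[ℂ] HSpace P.phi h} (h₁ : IsWeylQuantization P.phi h a T₁)
    (h₂ : IsWeylQuantization P.phi h a T₂) : T₁ = T₂ := by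
  obtain ⟨M₁, hM₁, hb₁⟩ := exists_eLpNorm_le_of_wNorm_le P.continuous_phi h₁.1
  obtain ⟨M₂, hM₂, hb₂⟩ := exists_eLpNorm_le_of_wNorm_le P.continuous_phi h₂.1
  ext1 u
  set E := eLpNorm (red P.phi h (T₁ u : Cn n → ℂ) - red P.phi h (T₂ u : Cn n → ℂ)) 2 volume with hE
  have hm₁ := memLp_red_coe P.continuous_phi (T₁ u)
  have hm₂ := memLp_red_coe P.continuous_phi (T₂ u)
  have key : ∀ δ : ℝ≥0, 0 < δ → E ≤ δ := by
    intro δ hδ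
    have hpos : 0 < M₁ + M₂ + 1 := by positivity
    obtain ⟨v, hv1, hv2, hv3, hv4⟩ := P.exists_rapidDecay_approx hh (differentiable_coe u)
      (memLp_red_coe P.continuous_phi u) (δ := ENNReal.ofReal (δ / (M₁ + M₂ + 1)))
      (by have : 0 < (δ : ℝ) / (M₁ + M₂ + 1) := by positivity
          simpa using this)
    set V : HSpace P.phi h := ⟨v, (mem_HSpace_iff P.continuous_phi h).2 ⟨hv1, hv2⟩⟩ with hV
    have hTV : (T₁ V : Cn n → ℂ) = T₂ V := by
      ext x; rw [h₁.2 V hv3, h₂.2 V hv3]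
    have e : red P.phi h (T₁ u : Cn n → ℂ) - red P.phi h (T₂ u : Cn n → ℂ) =
        red P.phi h (T₁ (u - V) : Cn n → ℂ) - red P.phi h (T₂ (u - V) : Cn n → ℂ) := by
      rw [map_sub, map_sub, Submodule.coe_sub, Submodule.coe_sub, red_sub, red_sub, hTV]
      abel
    have h3 := memLp_red_coe P.continuous_phi (T₁ (u - V))
    have h4 := memLp_red_coe P.continuous_phi (T₂ (u - V))
    rw [hE, e]
    have h5 : eLpNorm (red P.phi h ((u - V : HSpace P.phi h) : Cn n → ℂ)) 2 volume ≤
      ENNReal.ofReal (δ / (M₁ + M₂ + 1)) := hv4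
    calc _ ≤ ENNReal.ofReal M₁ * ENNReal.ofReal (δ / (M₁ + M₂ + 1)) +
          ENNReal.ofReal M₂ * ENNReal.ofReal (δ / (M₁ + M₂ + 1)) := by
          refine (eLpNorm_sub_le h3.1 h4.1 (by norm_num)).trans (add_le_add ?_ ?_)
          · exact (hb₁ _).trans (by gcongr)
          · exact (hb₂ _).trans (by gcongr)
      _ = ENNReal.ofReal ((M₁ + M₂) * (δ / (M₁ + M₂ + 1))) := by
          rw [← add_mul, ← ENNReal.ofReal_add hM₁ hM₂, ← ENNReal.ofReal_mul (by positivity)]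
      _ ≤ ENNReal.ofReal δ := by
          apply ENNReal.ofReal_le_ofReal
          rw [mul_div_assoc', div_le_iff₀ hpos]
          nlinarith [δ.2]
      _ = δ := ENNReal.ofReal_coe_nnreal
  have hE0 : E = 0 := by
    refine le_antisymm (ENNReal.le_of_forall_pos_le_add fun δ hδ _ => ?_) zero_le
    simpa using key δ hδ
  have hae := (eLpNorm_eq_zero_iff (hm₁.1.sub hm₂.1) (by norm_num)).1 hE0
  have hc₁ := continuous_red (h := h) P.continuous_phi (differentiable_coe (T₁ u)).continuous
  have hc₂ := continuous_red (h := h) P.continuous_phi (differentiable_coe (T₂ u)).continuous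
  have heq := ((hc₁.sub hc₂).ae_eq_iff_eq volume continuous_const).1 hae
  ext x
  have h6 : ((T₁ u : Cn n → ℂ) x - (T₂ u : Cn n → ℂ) x) * (Real.exp (-P.phi x / h) : ℂ) = 0 := by
    rw [sub_mul]; exact congrFun heq x
  exact sub_eq_zero.1 ((mul_eq_zero.1 h6).resolve_right (by simp))

end Weight

/-! ### Bounded perturbations of the weight -/

/-- A bounded perturbation of the weight changes neither `L²` membership nor, up to a constant,
the norm. -/
lemma exists_eLpNorm_red_le (φ : Cn n → ℝ) {f : Cn n → ℝ} {B : ℝ}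
    (hB : ∀ x, |f x| ≤ B) {h : ℝ} (hh : 0 < h) : ∃ C : ℝ, 0 ≤ C ∧ ∀ u : Cn n → ℂ,
      eLpNorm (red (fun x => φ x + f x) h u) 2 volume ≤
        ENNReal.ofReal C * eLpNorm (red φ h u) 2 volume := by
  refine ⟨Real.exp (B / h), (Real.exp_pos _).le, fun u => ?_⟩
  refine eLpNorm_le_mul_eLpNorm_of_ae_le_mul (Filter.Eventually.of_forall fun x => ?_) 2
  rw [norm_red, norm_red]
  have e : Real.exp (-(φ x + f x) / h) = Real.exp (-f x / h) * Real.exp (-φ x / h) := by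
    rw [← Real.exp_add]; congr 1; ring
  have h1 : Real.exp (-f x / h) ≤ Real.exp (B / h) := by
    have := neg_le_of_abs_le (hB x)
    gcongr; linarith
  rw [e]
  calc _ = Real.exp (-f x / h) * (‖u x‖ * Real.exp (-φ x / h)) := by ring
    _ ≤ _ := by gcongr

lemma memLp_red_add_iff {φ f : Cn n → ℝ} (hφ : Continuous φ) (hf : Continuous f) {B : ℝ}
    (hB : ∀ x, |f x| ≤ B) {h : ℝ} (hh : 0 < h) {u : Cn n → ℂ} (hu : Continuous u) :
    MemLp (red (fun x => φ x + f x) h u) 2 volume ↔ MemLp (red φ h u) 2 volume := by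
  constructor
  · intro hL
    obtain ⟨C, -, hC⟩ := exists_eLpNorm_red_le (fun x => φ x + f x) (f := fun x => -f x) (B := B)
      (by simpa using hB) hh
    have h1 := hC u
    simp only [add_neg_cancel_right] at h1
    exact ⟨(continuous_red hφ hu).aestronglyMeasurable,
      h1.trans_lt (ENNReal.mul_lt_top ENNReal.ofReal_lt_top hL.2)⟩
  · intro hL
    obtain ⟨C, -, hC⟩ := exists_eLpNorm_red_le φ hB hh
    exact ⟨(continuous_red (hφ.add hf) hu).aestronglyMeasurable,
      (hC u).trans_lt (ENNReal.mul_lt_top ENNReal.ofReal_lt_top hL.2)⟩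

lemma HSpace_add_eq {φ f : Cn n → ℝ} (hφ : Continuous φ) (hf : Continuous f) {B : ℝ}
    (hB : ∀ x, |f x| ≤ B) {h : ℝ} (hh : 0 < h) :
    HSpace (fun x => φ x + f x) h = HSpace φ h := by
  ext u
  rw [mem_HSpace_iff (φ := fun x => φ x + f x) (by fun_prop), mem_HSpace_iff hφ]
  exact and_congr_right fun hu => memLp_red_add_iff hφ hf hB hh hu.continuous

/-! ### Cauchy and Taylor estimates on the tube -/

/-- Cauchy's estimate for Z ↦ a(Z+p) - a(Z+q), which is bounded by C‖p-q‖ on a ball, gives a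
Lipschitz bound for the derivative without second derivatives. -/
lemma norm_fderiv_sub_le {E : Type*} [NormedAddCommGroup E] [NormedSpace ℂ E] {a : E → ℂ}
    {s : Set E} (hs : Convex ℝ s) (ha : ∀ x ∈ s, DifferentiableAt ℂ a x) {C r : ℝ} (hr : 0 < r)
    (hC : ∀ x ∈ s, ‖fderiv ℂ a x‖ ≤ C) {p q : E} (hp : Metric.ball p r ⊆ s)
    (hq : Metric.ball q r ⊆ s) :
    ‖fderiv ℂ a p - fderiv ℂ a q‖ ≤ 2 * C / r * ‖p - q‖ := by
  have hmem : ∀ {p}, Metric.ball p r ⊆ s → ∀ Z ∈ Metric.ball (0 : E) r, Z + p ∈ s :=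
    fun {p} hp Z hZ => hp (by simpa using hZ)
  have hGd : ∀ Z ∈ Metric.ball (0 : E) r, HasFDerivAt (fun Z => a (Z + p) - a (Z + q))
      (fderiv ℂ a (Z + p) - fderiv ℂ a (Z + q)) Z := fun Z hZ =>
    (hasFDerivAt_comp_add_right p |>.2 (ha _ (hmem hp Z hZ)).hasFDerivAt).sub
      (hasFDerivAt_comp_add_right q |>.2 (ha _ (hmem hq Z hZ)).hasFDerivAt)
  have hGb : ∀ Z ∈ Metric.ball (0 : E) r, ‖a (Z + p) - a (Z + q)‖ ≤ C * ‖p - q‖ := by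
    intro Z hZ
    have := hs.norm_image_sub_le_of_norm_fderiv_le (𝕜 := ℂ) (f := a) ha hC
      (hmem hq Z hZ) (hmem hp Z hZ)
    rwa [add_sub_add_left_eq_sub] at this
  have h3 := norm_fderiv_le_of_bounded hr
    (fun Z hZ => (hGd Z hZ).differentiableAt.differentiableWithinAt) hGb
  rw [(hGd 0 (Metric.mem_ball_self hr)).fderiv, zero_add, zero_add] at h3
  exact h3.trans (le_of_eq (by ring))

/-- Two Cauchy estimates on nested balls bound the increment of the derivative near x by a multiple
of ‖z-x‖. -/
lemma continuous_fderiv_of_entire {u : Cn n → ℂ} (hu : Differentiable ℂ u) :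
    Continuous (fderiv ℂ u) := by
  refine continuous_iff_continuousAt.2 fun x => ?_
  obtain ⟨B, hB⟩ := (isCompact_closedBall x 3).exists_bound_of_continuousOn
    hu.continuous.continuousOn
  have hb : ∀ {z : Cn n} {r s : ℝ}, z ∈ Metric.ball x r → r + s ≤ 3 →
      Metric.ball z s ⊆ Metric.ball x (r + s) := fun {z r s} hz _ =>
    Metric.ball_subset_ball' (by have := Metric.mem_ball.1 hz; linarith)
  have h1 : ∀ z ∈ Metric.ball x 2, ‖fderiv ℂ u z‖ ≤ 2 * B / 1 := fun z hz =>
    norm_fderiv_le_of_bounded one_pos hu.differentiableOn fun y hy => hB y (by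
      have := hb (s := 1) hz (by norm_num) hy
      exact Metric.ball_subset_closedBall (by convert this using 1; norm_num))
  have h2 : ∀ z ∈ Metric.ball x 1, ‖fderiv ℂ u z - fderiv ℂ u x‖ ≤
      2 * (2 * B / 1) / 1 * ‖z - x‖ := fun z hz =>
    norm_fderiv_sub_le (convex_ball x 2) (fun y _ => hu y) one_pos h1
      (by convert hb (s := 1) hz (by norm_num) using 1; norm_num)
      (Metric.ball_subset_ball (by norm_num))
  refine tendsto_iff_norm_sub_tendsto_zero.2 ?_
  have h3 : Filter.Tendsto (fun z => 2 * (2 * B / 1) / 1 * ‖z - x‖) (nhds x) (nhds 0) := by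
    have : Continuous fun z => 2 * (2 * B / 1) / 1 * ‖z - x‖ := by fun_prop
    simpa using this.tendsto x
  exact squeeze_zero' (Filter.Eventually.of_forall fun _ => norm_nonneg _)
    (Filter.eventually_of_mem (Metric.ball_mem_nhds x one_pos) h2) h3

namespace Weight
variable (P : Weight n)

lemma convex_tube (r : ℝ) : Convex ℝ (P.tube r) := by
  have h := (convex_ball (0 : Cn n) r).linear_preimage
    ((ContinuousLinearMap.snd ℝ (Cn n) (Cn n)) -
      P.thetaL.comp (ContinuousLinearMap.fst ℝ (Cn n) (Cn n))).toLinearMap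
  have e : P.tube r = ((ContinuousLinearMap.snd ℝ (Cn n) (Cn n)) -
      P.thetaL.comp (ContinuousLinearMap.fst ℝ (Cn n) (Cn n))).toLinearMap ⁻¹'
        Metric.ball (0 : Cn n) r := by
    ext p; simp [tube]
  rw [e]
  exact h

lemma tube_mono {r s : ℝ} (h : r ≤ s) : P.tube r ⊆ P.tube s := fun _ hp =>
  lt_of_lt_of_le (show _ < r from hp) h

lemma exists_ball_subset_tube : ∃ B : ℝ, 0 < B ∧
    ∀ r s : ℝ, ∀ p ∈ P.tube r, Metric.ball p (s / B) ⊆ P.tube (r + s) := by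
  obtain ⟨C, hC, -, -, hCt⟩ := P.exists_upper
  refine ⟨1 + C, by positivity, fun r s p hp q hq => ?_⟩
  have hp' : ‖p.2 - P.theta p.1‖ < r := hp
  have hq' : ‖q - p‖ < s / (1 + C) := by rwa [← dist_eq_norm]
  rw [lt_div_iff₀ (by positivity)] at hq'
  have h1 : ‖q.1 - p.1‖ ≤ ‖q - p‖ := norm_fst_le (q - p)
  have h2 : ‖q.2 - p.2‖ ≤ ‖q - p‖ := norm_snd_le (q - p)
  have e : q.2 - P.theta q.1 = (p.2 - P.theta p.1) + (q.2 - p.2) - P.theta (q.1 - p.1) := by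
    rw [← thetaL_apply, ← thetaL_apply, ← thetaL_apply, map_sub]; abel
  change ‖q.2 - P.theta q.1‖ < r + s
  rw [e]
  have h3 := norm_sub_le ((p.2 - P.theta p.1) + (q.2 - p.2)) (P.theta (q.1 - p.1))
  have h4 := norm_add_le (p.2 - P.theta p.1) (q.2 - p.2)
  have h5 : ‖P.theta (q.1 - p.1)‖ ≤ C * ‖q - p‖ := (hCt _).trans (by gcongr)
  linarith

/-- Cauchy estimates and Taylor's formula for bounded holomorphic functions on a tube. -/
lemma exists_taylor {ρ : ℝ} (hρ : 0 < ρ) : ∃ A : ℝ, 0 < A ∧ ∀ (a : Cn n × Cn n → ℂ) (M : ℝ),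
    DifferentiableOn ℂ a (P.tube ρ) → (∀ p ∈ P.tube ρ, ‖a p‖ ≤ M) → 0 ≤ M →
    (∀ p ∈ P.tube (ρ / 4), ‖fderiv ℂ a p‖ ≤ A * M) ∧
    (∀ p ∈ P.tube (ρ / 4), ∀ q ∈ P.tube (ρ / 4),
      ‖fderiv ℂ a p - fderiv ℂ a q‖ ≤ A * M * ‖p - q‖) ∧
    (∀ p ∈ P.tube (ρ / 4), ∀ q ∈ P.tube (ρ / 4),
      ‖a q - a p - fderiv ℂ a p (q - p)‖ ≤ A * M * ‖q - p‖ ^ 2) := by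
  obtain ⟨B, hB, hball⟩ := P.exists_ball_subset_tube
  -- A ball of radius r widens a tube by at most ρ/4, so two successive Cauchy estimates fit between
  -- the widths ρ/4 and ρ.
  set r := ρ / 4 / B with hr
  have hr0 : 0 < r := by positivity
  have hb1 : ∀ p ∈ P.tube (ρ / 4), Metric.ball p r ⊆ P.tube (ρ / 2) := fun p hp =>
    (hball _ (ρ / 4) p hp).trans (P.tube_mono (by linarith))
  have hb2 : ∀ p ∈ P.tube (ρ / 2), Metric.ball p r ⊆ P.tube ρ := fun p hp =>
    (hball _ (ρ / 4) p hp).trans (P.tube_mono (by linarith))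
  refine ⟨2 / r + 4 / r ^ 2, by positivity, fun a M ha hM hM0 => ?_⟩
  have hda : ∀ p ∈ P.tube ρ, DifferentiableAt ℂ a p := fun p hp =>
    ha.differentiableAt ((P.isOpen_tube ρ).mem_nhds hp)
  have h1 : ∀ p ∈ P.tube (ρ / 2), ‖fderiv ℂ a p‖ ≤ 2 * M / r := fun p hp =>
    norm_fderiv_le_of_bounded hr0 (ha.mono (hb2 p hp)) fun x hx => hM x (hb2 p hp hx)
  have h42 : P.tube (ρ / 4) ⊆ P.tube (ρ / 2) := P.tube_mono (by linarith)
  have h21 : P.tube (ρ / 2) ⊆ P.tube ρ := P.tube_mono (by linarith)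
  have hle1 : 2 * M / r ≤ (2 / r + 4 / r ^ 2) * M := by
    have : 0 ≤ 4 / r ^ 2 * M := by positivity
    have e : 2 * M / r = 2 / r * M := by ring
    rw [add_mul, e]; linarith
  have h2 : ∀ p ∈ P.tube (ρ / 4), ∀ q ∈ P.tube (ρ / 4),
      ‖fderiv ℂ a p - fderiv ℂ a q‖ ≤ (2 / r + 4 / r ^ 2) * M * ‖p - q‖ := by
    intro p hp q hq
    refine (norm_fderiv_sub_le (P.convex_tube (ρ / 2)) (fun x hx => hda x (h21 hx)) hr0 h1
      (hb1 p hp) (hb1 q hq)).trans ?_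
    have e : 2 * (2 * M / r) / r * ‖p - q‖ = 4 / r ^ 2 * M * ‖p - q‖ := by field_simp; ring
    rw [e]
    gcongr
    have : 0 < 2 / r := by positivity
    linarith
  refine ⟨fun p hp => (h1 p (h42 hp)).trans hle1, h2, fun p hp q hq => ?_⟩
  have hseg : segment ℝ p q ⊆ P.tube (ρ / 4) := (P.convex_tube _).segment_subset hp hq
  have h3 := (convex_segment p q).norm_image_sub_le_of_norm_fderiv_le' (𝕜 := ℂ) (f := a)
    (φ := fderiv ℂ a p) (C := (2 / r + 4 / r ^ 2) * M * ‖q - p‖)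
    (fun z hz => hda z (h21 (h42 (hseg hz)))) (fun z hz => (h2 z (hseg hz) p hp).trans (by
      gcongr; exact norm_sub_le_of_mem_segment hz))
    (left_mem_segment ℝ p q) (right_mem_segment ℝ p q)
  refine h3.trans (le_of_eq ?_)
  ring

/-! ### Exact kernel of an affine symbol -/

lemma theta_ofReal_smul (s : ℝ) (t : Cn n) : P.theta ((s : ℂ) • t) = (s : ℂ) • P.theta t := by
  rw [← real_smul_eq, ← real_smul_eq, ← thetaL_apply, map_smul, thetaL_apply]

/-- On a tube the fibre variable stays within ρ of a linear function of the base point, so an affine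
symbol has the polynomial growth admitted by `ker_eq_shift`. -/
lemma exists_affine_growth (ρ : ℝ) (c : ℂ) (L : Cn n × Cn n →L[ℂ] ℂ) :
    ∃ A : ℝ, ∀ p ∈ P.tube ρ, ‖c + L p‖ ≤ A * (1 + ‖p.1‖) ^ 1 := by
  obtain ⟨C, hC, -, -, hCt⟩ := P.exists_upper
  refine ⟨‖c‖ + ‖L‖ * (1 + C + |ρ|), fun p hp => ?_⟩
  have hp' : ‖p.2 - P.theta p.1‖ < ρ := hp
  have h1 : ‖p‖ ≤ (1 + C + |ρ|) * (1 + ‖p.1‖) := by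
    have h2 : ‖p.2‖ ≤ ‖p.2 - P.theta p.1‖ + ‖P.theta p.1‖ := by
      simpa using norm_add_le (p.2 - P.theta p.1) (P.theta p.1)
    have h3 := hCt p.1
    have h4 := le_abs_self ρ
    have h5 := norm_nonneg p.1
    rw [Prod.norm_def]
    refine max_le ?_ ?_ <;> nlinarith [abs_nonneg ρ]
  have h2 := L.le_opNorm p
  have h3 := norm_add_le c (L p)
  have h4 : ‖L‖ * ‖p‖ ≤ ‖L‖ * ((1 + C + |ρ|) * (1 + ‖p.1‖)) := by gcongr
  have h5 : 0 ≤ ‖c‖ * ‖p.1‖ := by positivity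
  rw [pow_one]
  linarith

/-- The Schwartz kernel of the quantization of an affine symbol. -/
lemma ker_affine {h : ℝ} (hh : 0 < h) (c : ℂ) (L : Cn n × Cn n →L[ℂ] ℂ) (η x w : Cn n) :
    P.ker h (fun p => c + L p) η x w = (P.wconst h : ℂ)⁻¹ *
      (P.repKer h η x w * (c + L (x, P.theta x + η + Complex.I • P.hvec (x - w)))) := by
  -- The full shift l = 1 is permitted because an affine symbol is entire and lives on every tube.
  -- It completes the square: with y = x + t the exponent is -½H(t,t) plus that of the reproducing
  -- kernel at (x,w).
  set v := η + Complex.I • P.hvec (x - w) with hv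
  obtain ⟨A, hA⟩ := P.exists_affine_growth (‖v‖ + 1) c L
  have hgd : Differentiable ℂ fun p => c + L p := by fun_prop
  rw [P.ker_eq_shift hh hgd.differentiableOn hA η x w (v := v) (by linarith)]
  rw [← integral_add_left_eq_self _ x]
  have hpt : ∀ t, P.kerInt h (fun p => c + L p) η x w v (x + t) =
      ((Real.exp (-(1 / 2) * (P.H t t).re / h) : ℝ) : ℂ) *
        (P.repKer h η x w * (c + L (x, P.theta x + v))) +
      ((Real.exp (-(1 / 2) * (P.H t t).re / h) : ℝ) : ℂ) *
        (P.repKer h η x w * ((1 / 2) * L (t, P.theta t))) := by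
    intro t
    have e1 : (1 / 2 : ℂ) • (x + (x + t)) = x + (1 / 2 : ℂ) • t := by
      rw [← add_assoc, ← two_smul ℂ x, smul_add, smul_smul]; norm_num
    have e2 : P.theta (x + (1 / 2 : ℂ) • t) = P.theta x + (1 / 2 : ℂ) • P.theta t := by
      rw [theta_add]
      have := P.theta_ofReal_smul (1 / 2) t
      push_cast at this
      rw [this]
    have e3 : x - (x + t) = -t := by abel
    have e4 : L (x + (1 / 2 : ℂ) • t, P.theta x + (1 / 2 : ℂ) • P.theta t + v) =
        L (x, P.theta x + v) + (1 / 2) * L (t, P.theta t) := by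
      rw [← smul_eq_mul, ← map_smul, ← map_add]
      congr 1
      ext1
      · rfl
      · simp only [Prod.snd_add, Prod.smul_snd]; abel
    have e5 : Complex.exp (Complex.I / h * pair (-t) (P.theta (x + (1 / 2 : ℂ) • t) + v)) *
        P.repKer h η (x + t) w = ((Real.exp (-(1 / 2) * (P.H t t).re / h) : ℝ) : ℂ) *
        P.repKer h η x w := by
      rw [repKer, repKer, Complex.ofReal_exp, ← Complex.exp_add, ← Complex.exp_add]
      congr 1
      push_cast
      rw [← P.H_self_eq]
      have e6 : Complex.I / h * pair (-t) (P.theta (x + (1 / 2 : ℂ) • t) + v) =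
          -(P.S (x + (1 / 2 : ℂ) • t) t + P.H t (x + (1 / 2 : ℂ) • t) + Complex.I * pair t η -
            P.H t (x - w)) / h := by
        rw [pair_neg_left, pair_add_right, hv, pair_add_right, pair_smul_right, pair_hvec,
          ← I_mul_pair_theta]
        linear_combination (-(P.H t (x - w)) / h) * Complex.I_sq
      have hc : conj (1 / 2 : ℂ) = 1 / 2 := by rw [map_div₀, map_one, map_ofNat]
      have e7 : x + t - w = (x - w) + t := by abel
      rw [e6, ← add_div, ← add_div]
      congr 1
      simp only [repExp, e7, pair_add_left, map_add, map_sub, map_smul, map_smulₛₗ, add_apply,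
        sub_apply, smul_apply, smul_eq_mul, hc]
      rw [P.symm x t]
      ring
    rw [kerInt, e1, e3, e2, e4, ← e2]
    linear_combination (c + (L (x, P.theta x + v) + (1 / 2) * L (t, P.theta t))) * e5
  simp only [hpt]
  obtain ⟨cl, hcl, hlow⟩ := P.exists_lower
  obtain ⟨Cu, hCu, -, -, hCt⟩ := P.exists_upper
  obtain ⟨Cg, hCg, hG⟩ := exists_gaussian_le 1 0 (c := cl / 2 / h) (by positivity)
  have hbd : ∀ t : Cn n, (1 + ‖t‖) * Real.exp (-(1 / 2) * (P.H t t).re / h) ≤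
      Cg * Real.exp (-1 * ‖t‖) := by
    intro t
    have h1 := hG ‖t‖ (norm_nonneg t)
    rw [pow_one] at h1
    refine le_trans ?_ (h1.trans (by rw [neg_one_mul]))
    gcongr
    have h2 := hlow t
    have h3 : 0 * ‖t‖ - cl / 2 / h * ‖t‖ ^ 2 = -(1 / 2) * (cl * ‖t‖ ^ 2) / h := by ring
    rw [h3]
    exact div_le_div_of_nonneg_right (by linarith) hh.le
  have hE : Continuous fun t : Cn n => Real.exp (-(1 / 2) * (P.H t t).re / h) := by
    have := P.continuous_H_self
    fun_prop
  have hE' : Continuous fun t : Cn n => ((Real.exp (-(1 / 2) * (P.H t t).re / h) : ℝ) : ℂ) :=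
    Complex.continuous_ofReal.comp hE
  have hi := integrable_exp_neg_norm (n := n) one_pos
  have hi1 : Integrable fun t : Cn n => ((Real.exp (-(1 / 2) * (P.H t t).re / h) : ℝ) : ℂ) := by
    refine (hi.const_mul Cg).mono' hE'.aestronglyMeasurable
      (Filter.Eventually.of_forall fun t => ?_)
    rw [Complex.norm_real, Real.norm_of_nonneg (Real.exp_pos _).le]
    refine le_trans ?_ (hbd t)
    exact le_mul_of_one_le_left (Real.exp_pos _).le (by linarith [norm_nonneg t])
  have hi2 : Integrable fun t : Cn n => ((Real.exp (-(1 / 2) * (P.H t t).re / h) : ℝ) : ℂ) *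
      L (t, P.theta t) := by
    have hLc : Continuous fun t : Cn n => L (t, P.theta t) := by fun_prop
    refine (hi.const_mul (‖L‖ * (1 + Cu) * Cg)).mono' (hE'.mul hLc).aestronglyMeasurable
      (Filter.Eventually.of_forall fun t => ?_)
    rw [norm_mul, Complex.norm_real, Real.norm_of_nonneg (Real.exp_pos _).le]
    have h1 : ‖((t, P.theta t) : Cn n × Cn n)‖ ≤ (1 + Cu) * (1 + ‖t‖) := by
      have := hCt t
      have := norm_nonneg t
      rw [Prod.norm_def]
      refine max_le ?_ ?_ <;> nlinarith
    calc _ ≤ Real.exp (-(1 / 2) * (P.H t t).re / h) * (‖L‖ * ((1 + Cu) * (1 + ‖t‖))) := by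
          gcongr
          exact (L.le_opNorm _).trans (by gcongr)
      _ = ‖L‖ * (1 + Cu) * ((1 + ‖t‖) * Real.exp (-(1 / 2) * (P.H t t).re / h)) := by ring
      _ ≤ ‖L‖ * (1 + Cu) * (Cg * Real.exp (-1 * ‖t‖)) :=
          mul_le_mul_of_nonneg_left (hbd t) (by positivity)
      _ = _ := by ring
  -- The Gaussian is even and `theta` is odd, so the part of the symbol linear in t integrates to
  -- zero.
  have hodd : ∫ t : Cn n, ((Real.exp (-(1 / 2) * (P.H t t).re / h) : ℝ) : ℂ) *
      L (t, P.theta t) = 0 := by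
    refine self_eq_neg.1 ?_
    rw [← integral_neg, ← integral_neg_eq_self]
    refine integral_congr_ae (Filter.Eventually.of_forall fun t => ?_)
    have e1 : ((-t, P.theta (-t)) : Cn n × Cn n) = -(t, P.theta t) := by
      rw [← thetaL_apply, map_neg]; rfl
    simp only [map_neg, neg_apply, neg_neg, e1, mul_neg]
  have hsplit : ∀ t : Cn n, ((Real.exp (-(1 / 2) * (P.H t t).re / h) : ℝ) : ℂ) *
        (P.repKer h η x w * ((1 / 2) * L (t, P.theta t))) =
      P.repKer h η x w * (1 / 2) * (((Real.exp (-(1 / 2) * (P.H t t).re / h) : ℝ) : ℂ) *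
        L (t, P.theta t)) := fun t => by ring
  simp only [hsplit]
  rw [integral_add (hi1.mul_const _) (hi2.const_mul _), integral_const_mul, hodd, mul_zero,
    add_zero, integral_mul_const, integral_complex_ofReal, P.integral_eq_wconst_inv, hv,
    Complex.ofReal_inv, add_assoc]

end Weight

/-! ### First order terms and the twisted expansion -/

namespace Weight
variable (P : Weight n)

lemma exists_norm_H_repKer_mul_le {h : ℝ} (hh : 0 < h) (η t : Cn n) : ∃ C : ℝ, 0 < C ∧
    ∀ (U : Cn n → ℂ) y w, ‖P.H t (w - y) * (P.repKer h η y w * U w)‖ ≤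
      C * Real.exp (P.phi y / h) * (Real.exp (-(1 / 2) * ‖y - w‖) * ‖red P.phi h U w‖) := by
  obtain ⟨C, hC, hb⟩ := P.exists_norm_repKer_mul_le hh η
  obtain ⟨B, hB, hH, -, -⟩ := P.exists_upper
  obtain ⟨D, hD, hpow⟩ := one_add_pow_le_exp 1 (c := 1 / 2) (by norm_num)
  refine ⟨B * (‖t‖ + 1) * D * C, by positivity, fun U y w => ?_⟩
  have h1 : ‖P.H t (w - y)‖ ≤ B * (‖t‖ + 1) * (D * Real.exp (1 / 2 * ‖y - w‖)) := by
    have h2 := hpow ‖y - w‖ (norm_nonneg _)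
    rw [pow_one] at h2
    calc _ ≤ B * ‖t‖ * ‖w - y‖ := hH _ _
      _ ≤ B * (‖t‖ + 1) * (D * Real.exp (1 / 2 * ‖y - w‖)) := by
          rw [norm_sub_rev w y]
          gcongr
          · linarith
          · linarith
  rw [norm_mul]
  calc _ ≤ (B * (‖t‖ + 1) * (D * Real.exp (1 / 2 * ‖y - w‖))) *
        (C * Real.exp (P.phi y / h) * (Real.exp (-1 * ‖y - w‖) * ‖red P.phi h U w‖)) := by
        gcongr; exact hb U y w
    _ = B * (‖t‖ + 1) * D * C * Real.exp (P.phi y / h) *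
        ((Real.exp (1 / 2 * ‖y - w‖) * Real.exp (-1 * ‖y - w‖)) * ‖red P.phi h U w‖) := by ring
    _ = _ := by rw [← Real.exp_add]; congr 4; ring

lemma integrable_H_repKer_mul {h : ℝ} (hh : 0 < h) (η t y : Cn n) {U : Cn n → ℂ}
    (hU : MemLp (red P.phi h U) 2 volume) :
    Integrable fun w => P.H t (w - y) * (P.repKer h η y w * U w) := by
  obtain ⟨C, hC, hb⟩ := P.exists_norm_H_repKer_mul_le hh η t
  have h1 : Continuous fun w => P.H t (w - y) := by fun_prop
  exact ((integrable_exp_mul_norm (by norm_num) y hU).const_mul _).mono'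
    (h1.aestronglyMeasurable.mul ((P.continuous_repKer_right h η y).aestronglyMeasurable.mul
      (P.aestronglyMeasurable_of_red hU.1))) (Filter.Eventually.of_forall fun w => hb U y w)

/-- The action on `u` of the quantization of the linear symbol `i t · (θ - ξ(x) - η)`, as a
first order differential operator at `x`. -/
def jet (h : ℝ) (η : Cn n) (u : Cn n → ℂ) (t x : Cn n) : ℂ :=
  h * fderiv ℂ u x t - (P.S x t + P.H t x + Complex.I * pair t η) * u x

lemma continuous_jet {h : ℝ} {η : Cn n → Cn n} (hη : Continuous η) {u : Cn n → ℂ}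
    (hu : Differentiable ℂ u) (hu' : Continuous (fderiv ℂ u)) (t : Cn n) :
    Continuous fun x => P.jet h (η x) u t x := by
  have h1 := hu.continuous
  have h2 : Continuous fun x => fderiv ℂ u x t := hu'.clm_apply continuous_const
  unfold jet
  fun_prop

/-- By `rep_deriv` the jet is an integral operator with the extra factor H(t, w-x), which grows
linearly and is absorbed by the exponential decay; Young's inequality then applies. -/
lemma memLp_red_jet {h : ℝ} (hh : 0 < h) {u : Cn n → ℂ} (hu : Differentiable ℂ u)
    (hu' : Continuous (fderiv ℂ u)) (hL : MemLp (red P.phi h u) 2 volume) (t : Cn n) :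
    MemLp (red P.phi h fun x => P.jet h 0 u t x) 2 volume := by
  obtain ⟨C, hC, hb⟩ := P.exists_norm_H_repKer_mul_le hh 0 t
  have hg := P.gconst_pos hh
  have hi := (integrable_exp_neg_norm (n := n) (c := 1 / 2) (by norm_num)).const_mul
    (P.gconst h * C)
  refine ⟨(continuous_red P.continuous_phi
    (P.continuous_jet continuous_const hu hu' t)).aestronglyMeasurable, ?_⟩
  refine (eLpNorm_red_le (K := fun x w => P.gconst h * (P.H t (w - x) * P.repKer h 0 x w))
    (k := fun z => P.gconst h * C * Real.exp (-(1 / 2) * ‖z‖))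
    (Continuous.measurable (by fun_prop)) (fun z => by positivity) (fun x => ?_) hL
    fun x w => ?_).trans_lt (ENNReal.mul_lt_top hi.2 hL.2)
  · rw [jet, P.rep_deriv hh 0 x t hu hL, ← integral_const_mul]
    simp only [mul_assoc]
  · rw [mul_assoc, mul_assoc, norm_mul, Complex.norm_real, Real.norm_of_nonneg hg.le]
    calc _ ≤ P.gconst h * (C * Real.exp (P.phi x / h) *
          (Real.exp (-(1 / 2) * ‖x - w‖) * ‖red P.phi h u w‖)) := by gcongr; exact hb u x w
      _ = _ := by ring

lemma clm_snd_eq_sum (L : Cn n × Cn n →L[ℂ] ℂ) (v : Cn n) :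
    L (0, v) = ∑ j, v j * L (0, Pi.single j 1) := by
  have h1 : ((0, v) : Cn n × Cn n) = ∑ j, v j • ((0, Pi.single j 1) : Cn n × Cn n) := by
    ext1
    · simp [Prod.fst_sum]
    · rw [Prod.snd_sum]; exact single_eq v
  conv_lhs => rw [h1]
  rw [map_sum]
  simp only [map_smul, smul_eq_mul]

/-- The twisted expansion: value of the symbol at `(x, ξ(x) + η)`, first order term, remainder. -/
lemma weylIntegral_expansion {h : ℝ} (hh : 0 < h) {ρ M : ℝ} (hρ : 0 < ρ)
    {a : Cn n × Cn n → ℂ} (ha : ContinuousOn a (P.tube ρ)) (hM : ∀ p ∈ P.tube ρ, ‖a p‖ ≤ M)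
    (η x : Cn n) (L : Cn n × Cn n →L[ℂ] ℂ) {u : Cn n → ℂ}
    (hu : Differentiable ℂ u) (hL : MemLp (red P.phi h u) 2 volume) (hr : RapidDecay P.phi h u)
    (hR : Integrable fun w => (P.wconst h * P.gconst h * P.ker h (fun q =>
      a q - a (x, P.theta x + η) - L (q - (x, P.theta x + η))) η x w) * u w) :
    weylIntegral P.phi h a u x = a (x, P.theta x + η) * u x +
      (-Complex.I) * ∑ j, L (0, Pi.single j 1) * P.jet h η u (Pi.single j 1) x +
      ∫ w, (P.wconst h * P.gconst h * P.ker h (fun q =>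
        a q - a (x, P.theta x + η) - L (q - (x, P.theta x + η))) η x w) * u w := by
  set p : Cn n × Cn n := (x, P.theta x + η) with hp
  have h0 : ‖(0 : Cn n)‖ < ρ := by simpa using hρ
  obtain ⟨A, hA⟩ := P.exists_affine_growth ρ (a p - L p) L
  have hM1 : ∀ q ∈ P.tube ρ, ‖a q‖ ≤ M * (1 + ‖q.1‖) ^ 0 := by simpa using hM
  have hLc : Continuous fun q => (a p - L p) + L q := by fun_prop
  have hker : ∀ w, P.ker h (fun q => a q - a p - L (q - p)) η x w =
      P.ker h a η x w - P.ker h (fun q => (a p - L p) + L q) η x w := by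
    intro w
    rw [ker, ker, ker, ← integral_sub (P.integrable_kerInt hh ha hM1 η x w h0)
      (P.integrable_kerInt hh hLc.continuousOn hA η x w h0)]
    refine integral_congr_ae (Filter.Eventually.of_forall fun y => ?_)
    simp only [kerInt, map_sub]
    ring
  have hwc : (P.wconst h : ℂ) ≠ 0 := by exact_mod_cast (P.wconst_pos hh).ne'
  have hlin : ∀ w, (P.wconst h * P.gconst h * P.ker h (fun q => (a p - L p) + L q) η x w) * u w =
      P.gconst h * a p * (P.repKer h η x w * u w) + ∑ j, (P.gconst h * (-Complex.I) *
        L (0, Pi.single j 1)) * (P.H (Pi.single j 1) (w - x) * (P.repKer h η x w * u w)) := by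
    intro w
    -- The affine symbol is evaluated at p displaced by i·`hvec`(x-w) in the fibre. The constant
    -- part reproduces a(p)u(x); each linear coefficient meets H(e_j, w-x), which `rep_deriv` turns
    -- into a jet.
    have e1 : (a p - L p) + L (x, P.theta x + η + Complex.I • P.hvec (x - w)) =
        a p + ∑ j, (-Complex.I) * L (0, Pi.single j 1) * P.H (Pi.single j 1) (w - x) := by
      have e2 : ((x, P.theta x + η + Complex.I • P.hvec (x - w)) : Cn n × Cn n) =
          p + (0, Complex.I • P.hvec (x - w)) := by
        rw [hp]; ext1 <;> simp
      rw [e2, map_add, clm_snd_eq_sum, ← add_assoc, sub_add_cancel]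
      congr 1
      refine Finset.sum_congr rfl fun j _ => ?_
      have e3 : P.hvec (x - w) j = -P.H (Pi.single j 1) (w - x) := by
        rw [← map_neg, neg_sub]; rfl
      rw [Pi.smul_apply, e3, smul_eq_mul]
      ring
    have e4 : ∀ X, (P.wconst h : ℂ) * P.gconst h *
        ((P.wconst h : ℂ)⁻¹ * (P.repKer h η x w * X)) * u w =
        P.gconst h * X * (P.repKer h η x w * u w) := fun X => by field_simp
    rw [P.ker_affine hh, e1, e4, mul_add, add_mul, Finset.mul_sum, Finset.sum_mul]
    congr 1
    refine Finset.sum_congr rfl fun j _ => ?_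
    ring
  have hi0 := P.integrable_repKer_mul hh η x hL
  have hij := fun t => P.integrable_H_repKer_mul hh η t x hL
  have hilin : Integrable fun w =>
      (P.wconst h * P.gconst h * P.ker h (fun q => (a p - L p) + L q) η x w) * u w := by
    simp only [hlin]
    exact (hi0.const_mul _).add (integrable_finsetSum _ fun j _ => (hij _).const_mul _)
  have hval : ∫ w, (P.wconst h * P.gconst h * P.ker h (fun q => (a p - L p) + L q) η x w) * u w =
      a p * u x + (-Complex.I) * ∑ j, L (0, Pi.single j 1) * P.jet h η u (Pi.single j 1) x := by
    simp only [hlin]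
    rw [integral_add (hi0.const_mul _) (integrable_finsetSum _ fun j _ => (hij _).const_mul _),
      integral_finsetSum _ fun j _ => (hij _).const_mul _, integral_const_mul,
      ← P.rep_formula hh η x hu hL, Finset.mul_sum]
    congr 1
    · ring
    · refine Finset.sum_congr rfl fun j _ => ?_
      rw [integral_const_mul, jet, P.rep_deriv hh η x _ hu hL]
      ring
  rw [P.weylIntegral_eq_kernel hh hρ ha hM η hu hL hr, ← hval, ← integral_add hilin hR]
  refine integral_congr_ae (Filter.Eventually.of_forall fun w => ?_)
  simp only [hker]
  ring

end Weight

/-! ### Integration by parts in the perturbed weight -/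

lemma continuous_eta {f : Cn n → ℝ} (hf : Continuous (fderiv ℝ f)) : Continuous (eta f) := by
  refine continuous_iff_continuousAt.2 fun x => ?_
  refine tendsto_iff_norm_sub_tendsto_zero.2 ?_
  have h1 : Filter.Tendsto (fun y => 2 * ‖fderiv ℝ f y - fderiv ℝ f x‖) (nhds x) (nhds 0) := by
    have : Continuous fun y => 2 * ‖fderiv ℝ f y - fderiv ℝ f x‖ := by fun_prop
    simpa using this.tendsto x
  exact squeeze_zero (fun _ => norm_nonneg _) (fun _ => norm_eta_sub_le) h1

namespace Weight
variable (P : Weight n)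

lemma fderiv_phi_add {f : Cn n → ℝ} {x : Cn n} (hf : DifferentiableAt ℝ f x) (e : Cn n) :
    fderiv ℝ (fun x => P.phi x + f x) x e =
      (P.S x e + P.H e x + Complex.I * pair e (eta f x)).re := by
  rw [fderiv_fun_add (P.differentiable_phi x) hf, add_apply, P.fderiv_phi, Complex.add_re]
  congr 1
  exact (re_I_mul_dot_eta f x e).symm

/-- The weight has derivative Re G with G = S(x,e) + H(e,x) + i e·η, while the jet subtracts all of
G. The discrepancy is the phase term i·Im G, which cancels in the product with a conjugate in
`hasLineDerivAt_red_mul`. -/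
lemma hasLineDerivAt_red {f : Cn n → ℝ} (hf : Differentiable ℝ f) {h : ℝ} (hh : 0 < h)
    {u : Cn n → ℂ} (hu : Differentiable ℂ u) (x e : Cn n) :
    HasLineDerivAt ℝ (red (fun x => P.phi x + f x) h u)
      ((h : ℂ)⁻¹ * (red (fun x => P.phi x + f x) h (fun x => P.jet h (eta f x) u e x) x +
        Complex.I * (P.S x e + P.H e x + Complex.I * pair e (eta f x)).im *
          red (fun x => P.phi x + f x) h u x)) x e := by
  have h1 : HasLineDerivAt ℝ u (fderiv ℂ u x e) x e :=
    ((hu x).hasFDerivAt.restrictScalars ℝ).hasLineDerivAt e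
  have h2 : HasLineDerivAt ℝ (fun x => P.phi x + f x)
      (P.S x e + P.H e x + Complex.I * pair e (eta f x)).re x e := by
    rw [← P.fderiv_phi_add (hf x)]
    exact ((P.differentiable_phi x).add (hf x)).hasFDerivAt.hasLineDerivAt e
  have h3 := (HasDerivAt.mul h1 (((HasDerivAt.neg h2).div_const h).exp.ofReal_comp))
  refine HasDerivAt.congr_deriv h3 ?_
  have hh' : (h : ℂ) ≠ 0 := by exact_mod_cast hh.ne'
  simp only [red, jet, zero_smul, add_zero, Pi.neg_apply]
  set G := P.S x e + P.H e x + Complex.I * pair e (eta f x)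
  have hG : G = (G.re : ℂ) + G.im * Complex.I := (Complex.re_add_im G).symm
  push_cast
  conv_rhs => rw [hG]
  simp only [Complex.ofReal_re, Complex.I_re, mul_zero,
    Complex.ofReal_im, Complex.I_im, mul_one, add_zero, Complex.add_im, Complex.mul_im,
    zero_add]
  field_simp
  ring

lemma hasLineDerivAt_red_mul {f : Cn n → ℝ} (hf : Differentiable ℝ f) {h : ℝ} (hh : 0 < h)
    {u v : Cn n → ℂ} (hu : Differentiable ℂ u) (hv : Differentiable ℂ v) (x e : Cn n) :
    HasLineDerivAt ℝ (fun x => red (fun x => P.phi x + f x) h u x *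
        conj (red (fun x => P.phi x + f x) h v x))
      ((h : ℂ)⁻¹ * (red (fun x => P.phi x + f x) h (fun x => P.jet h (eta f x) u e x) x *
        conj (red (fun x => P.phi x + f x) h v x) + red (fun x => P.phi x + f x) h u x *
        conj (red (fun x => P.phi x + f x) h (fun x => P.jet h (eta f x) v e x) x))) x e := by
  have h1 := P.hasLineDerivAt_red hf hh hu x e
  have h2 := P.hasLineDerivAt_red hf hh hv x e
  have h3 := HasDerivAt.mul h1 (HasDerivAt.star h2)
  refine HasDerivAt.congr_deriv h3 ?_
  simp only [zero_smul, add_zero, RCLike.star_def, map_mul, map_add, map_inv₀, Complex.conj_ofReal,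
    Complex.conj_I]
  ring

/-- Complex linearity in t is what separates the jet of u from the conjugated jet of v in
`norm_integral_jet_le`. -/
lemma jet_I_smul (h : ℝ) (η : Cn n) (u : Cn n → ℂ) (t x : Cn n) :
    P.jet h η u (Complex.I • t) x = Complex.I * P.jet h η u t x := by
  simp only [jet, map_smul, smul_apply, smul_eq_mul, pair_smul_left]
  ring

lemma red_const_mul (φ : Cn n → ℝ) (h : ℝ) (c : ℂ) (u : Cn n → ℂ) (x : Cn n) :
    red φ h (fun x => c * u x) x = c * red φ h u x := by
  simp [red, mul_assoc]

/-- Passing from η = 0 to `eta f x` changes the jet by a bounded multiple of u, and a bounded f does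
not affect membership in L². -/
lemma memLp_red_jet_eta {f : Cn n → ℝ} (hf : ContDiff ℝ 1 f) {B : ℝ} (hB : ∀ x, |f x| ≤ B)
    {B' : ℝ} (hB' : ∀ x, ‖fderiv ℝ f x‖ ≤ B') {h : ℝ} (hh : 0 < h)
    {u : Cn n → ℂ} (hu : Differentiable ℂ u) (hu' : Continuous (fderiv ℂ u))
    (hL : MemLp (red P.phi h u) 2 volume) (t : Cn n) :
    MemLp (red (fun x => P.phi x + f x) h fun x => P.jet h (eta f x) u t x) 2 volume := by
  have hη := continuous_eta (hf.continuous_fderiv one_ne_zero)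
  have hj := P.continuous_jet (h := h) hη hu hu' t
  refine (memLp_red_add_iff P.continuous_phi hf.continuous hB hh hj).2 ?_
  have h1 := P.memLp_red_jet hh hu hu' hL t
  have h2 : MemLp (red P.phi h fun x => (Complex.I * pair t (eta f x)) * u x) 2 volume := by
    refine hL.of_le_mul (c := n * ‖t‖ * (2 * B')) (continuous_red P.continuous_phi
      (by have := hu.continuous; fun_prop)).aestronglyMeasurable
      (Filter.Eventually.of_forall fun x => ?_)
    rw [norm_red, norm_red, norm_mul, norm_mul, Complex.norm_I, one_mul, mul_assoc]
    gcongr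
    refine (norm_pair_le _ _).trans ?_
    gcongr
    exact (norm_eta_le f x).trans (by gcongr; exact hB' x)
  have e : (red P.phi h fun x => P.jet h (eta f x) u t x) =
      (red P.phi h fun x => P.jet h 0 u t x) -
        red P.phi h fun x => (Complex.I * pair t (eta f x)) * u x := by
    rw [← red_sub]
    congr 1
    ext x
    simp only [jet, Pi.sub_apply, pair_zero_right]
    ring
  rw [e]
  exact h1.sub h2

/-- Integration by parts against a Lipschitz coefficient. -/
lemma norm_integral_jet_le {f : Cn n → ℝ} (hf : ContDiff ℝ 1 f) {B : ℝ} (hB : ∀ x, |f x| ≤ B)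
    {B' : ℝ} (hB' : ∀ x, ‖fderiv ℝ f x‖ ≤ B') {h : ℝ} (hh : 0 < h)
    {u v : Cn n → ℂ} (hu : Differentiable ℂ u) (hu' : Continuous (fderiv ℂ u))
    (hL : MemLp (red P.phi h u) 2 volume)
    (hv : Differentiable ℂ v) (hv' : Continuous (fderiv ℂ v))
    (hLv : MemLp (red P.phi h v) 2 volume)
    {β : Cn n → ℂ} {A L : ℝ} (hL0 : 0 ≤ L) (hβ : ∀ x, ‖β x‖ ≤ A)
    (hβL : ∀ x y, ‖β x - β y‖ ≤ L * ‖x - y‖)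
    (j : Fin n) :
    ‖∫ x, β x * (red (fun x => P.phi x + f x) h (fun x => P.jet h (eta f x) u (Pi.single j 1) x) x *
      conj (red (fun x => P.phi x + f x) h v x))‖ ≤
      h * L * ((eLpNorm (red (fun x => P.phi x + f x) h u) 2 volume).toReal *
        (eLpNorm (red (fun x => P.phi x + f x) h v) 2 volume).toReal) := by
  set Φ : Cn n → ℝ := fun x => P.phi x + f x with hΦ
  have hΦc : Continuous Φ := P.continuous_phi.add hf.continuous
  have hfd : Differentiable ℝ f := hf.differentiable one_ne_zero
  have hη := continuous_eta (hf.continuous_fderiv one_ne_zero)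
  have hLu2 := (memLp_red_add_iff P.continuous_phi hf.continuous hB hh hu.continuous).2 hL
  have hLv2 := (memLp_red_add_iff P.continuous_phi hf.continuous hB hh hv.continuous).2 hLv
  have hβc : Continuous β := by
    have hL0 : LipschitzWith (Real.toNNReal L) β := by
      refine LipschitzWith.of_dist_le_mul fun x y => ?_
      rw [dist_eq_norm, dist_eq_norm]
      exact (hβL x y).trans (by gcongr; exact Real.le_coe_toNNReal L)
    exact hL0.continuous
  set F : Cn n → ℂ := fun x => red Φ h u x * conj (red Φ h v x) with hF
  set F' : Cn n → Cn n → ℂ := fun e x => (h : ℂ)⁻¹ *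
    (red Φ h (fun x => P.jet h (eta f x) u e x) x * conj (red Φ h v x) + red Φ h u x *
        conj (red Φ h (fun x => P.jet h (eta f x) v e x) x)) with hF'
  have hru := continuous_red (h := h) hΦc hu.continuous
  have hrv := continuous_red (h := h) hΦc hv.continuous
  have hrju := fun e => continuous_red (h := h) hΦc (P.continuous_jet (h := h) hη hu hu' e)
  have hrjv := fun e => continuous_red (h := h) hΦc (P.continuous_jet (h := h) hη hv hv' e)
  have hint : ∀ {p q : Cn n → ℂ}, Continuous p → Continuous q → MemLp p 2 volume →
      MemLp q 2 volume → Integrable fun x => p x * conj (q x) := by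
    intro p q hp hq hp2 hq2
    refine (integrable_norm_mul hp2 hq2).mono'
      (Continuous.aestronglyMeasurable (by fun_prop)) (Filter.Eventually.of_forall fun x => ?_)
    rw [norm_mul, RCLike.norm_conj]
  have hju := fun e => P.memLp_red_jet_eta hf hB hB' hh hu hu' hL e
  have hjv := fun e => P.memLp_red_jet_eta hf hB hB' hh hv hv' hLv e
  have hFi : Integrable F := hint hru hrv hLu2 hLv2
  have hFi' : ∀ e, Integrable (F' e) := fun e =>
    ((hint (hrju e) hrv (hju e) hLv2).add (hint hru (hrjv e) hLu2 (hjv e))).const_mul _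
  have hFc' : ∀ e, Continuous (F' e) := fun e => by
    have := hrju e
    have := hrjv e
    simp only [hF']
    fun_prop
  have hbound : ∀ e : Cn n, ‖e‖ ≤ 1 → ‖∫ x, β x * F' e x‖ ≤ L * ∫ x, ‖F x‖ := by
    intro e he
    refine norm_integral_mul_lineDeriv_le (e := e) (fun x s => ?_) hβ hβc hFi (hFc' e) (hFi' e)
      fun x => P.hasLineDerivAt_red_mul hfd hh hu hv x e
    refine (hβL _ _).trans ?_
    rw [add_sub_cancel_left, norm_smul, Real.norm_eq_abs]
    gcongr
    exact mul_le_of_le_one_right (abs_nonneg s) he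
  have hF0 : ∫ x, ‖F x‖ ≤ (eLpNorm (red Φ h u) 2 volume).toReal *
      (eLpNorm (red Φ h v) 2 volume).toReal := by
    refine le_trans (le_of_eq ?_) (norm_integral_mul_le hLu2 hLv2)
    simp only [hF, norm_mul, RCLike.norm_conj]
  set e : Cn n := Pi.single j 1 with he
  have he1 : ‖e‖ ≤ 1 := by rw [he, Pi.norm_single, norm_one]
  have heI : ‖Complex.I • e‖ ≤ 1 := by rwa [norm_smul, Complex.norm_I, one_mul]
  have hred : ∀ w x, red Φ h (fun x => P.jet h (eta f x) w (Complex.I • e) x) x =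
      Complex.I * red Φ h (fun x => P.jet h (eta f x) w e x) x := fun w x => by
    simp only [jet_I_smul, red_const_mul]
  -- The real derivatives along e and ie combine into the holomorphic derivative ½(∂_e - i∂_{ie}),
  -- in which the terms with the conjugated jet of v cancel.
  have hcomb : ∀ x, β x * (red Φ h (fun x => P.jet h (eta f x) u e x) x * conj (red Φ h v x)) =
      (h / 2 : ℂ) * (β x * F' e x - Complex.I * (β x * F' (Complex.I • e) x)) := by
    intro x
    have hh' : (h : ℂ) ≠ 0 := by exact_mod_cast hh.ne'
    simp only [hF', hred, map_mul, Complex.conj_I]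
    field_simp
    linear_combination β x * (red Φ h (fun x => P.jet h (eta f x) u e x) x * conj (red Φ h v x) -
      red Φ h u x * conj (red Φ h (fun x => P.jet h (eta f x) v e x) x)) * Complex.I_sq
  have hβi : ∀ e, Integrable fun x => β x * F' e x := fun e =>
    (hFi' e).bdd_mul hβc.aestronglyMeasurable (Filter.Eventually.of_forall hβ)
  simp only [hcomb]
  rw [integral_const_mul, integral_sub (hβi e) ((hβi _).const_mul _), integral_const_mul,
    norm_mul, norm_div, Complex.norm_real, Real.norm_of_nonneg hh.le, Complex.norm_ofNat]
  have h2 := norm_sub_le (∫ x, β x * F' e x) (Complex.I * ∫ x, β x * F' (Complex.I • e) x)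
  rw [norm_mul, Complex.norm_I, one_mul] at h2
  have h3 := hbound e he1
  have h4 := hbound _ heI
  calc _ ≤ h / 2 * (L * (∫ x, ‖F x‖) + L * ∫ x, ‖F x‖) := by gcongr; linarith
    _ = h * L * ∫ x, ‖F x‖ := by ring
    _ ≤ _ := by gcongr

end Weight

/-! ### The main estimate on rapidly decaying functions -/

namespace Weight
variable (P : Weight n)

lemma integrable_convKer_mul {D b h : ℝ} (hb : 0 < b) (hh : 0 < h) (x : Cn n) {g : Cn n → ℂ}
    (hg : MemLp g 2 volume) : Integrable fun w => convKer D b h (x - w) * ‖g w‖ := by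
  have hsq : 0 < √h := Real.sqrt_pos.2 hh
  refine ((integrable_exp_mul_norm (c := b / √h) (by positivity) x hg).const_mul
    (D * (h ^ n)⁻¹)).congr (Filter.Eventually.of_forall fun w => ?_)
  have : -b * (‖x - w‖ / √h) = -(b / √h) * ‖x - w‖ := by ring
  simp only [convKer, this]
  ring

/-- Quantization versus multiplication, on rapidly decaying functions. -/
lemma exists_main_estimate {ρ : ℝ} (hρ : 0 < ρ) : ∃ ε : ℝ≥0, 0 < ε ∧ (2 * ε : ℝ) < ρ ∧
    ∀ (a : Cn n × Cn n → ℂ) (M : ℝ), DifferentiableOn ℂ a (P.tube ρ) →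
      (∀ p ∈ P.tube ρ, ‖a p‖ ≤ M) → 0 ≤ M → ∃ K : ℝ, 0 ≤ K ∧ ∀ (f : Cn n → ℝ) (B : ℝ),
      ContDiff ℝ 1 f → (∀ x, |f x| ≤ B) → (∀ x, ‖fderiv ℝ f x‖ ≤ ε) →
      LipschitzWith ε (fderiv ℝ f) → ∀ h : ℝ, 0 < h → h ≤ 1 → ∀ u v : Cn n → ℂ,
      Differentiable ℂ u → MemLp (red P.phi h u) 2 volume → RapidDecay P.phi h u →
      Differentiable ℂ v → MemLp (red P.phi h v) 2 volume →
      ‖∫ x, (red (fun x => P.phi x + f x) h (P.weylOp h a u) x *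
          conj (red (fun x => P.phi x + f x) h v x) -
        a (x, P.theta x + eta f x) * (red (fun x => P.phi x + f x) h u x *
          conj (red (fun x => P.phi x + f x) h v x)))‖ ≤
        K * h * ((eLpNorm (red (fun x => P.phi x + f x) h u) 2 volume).toReal *
          (eLpNorm (red (fun x => P.phi x + f x) h v) 2 volume).toReal) := by
  obtain ⟨ε₀, b, D, hε₀, hb, hD, hker⟩ := P.exists_norm_ker_mul_le (ρ := ρ / 4) (by positivity)
  obtain ⟨A, hA, htay⟩ := P.exists_taylor hρ
  obtain ⟨C, hC, -, -, hCt⟩ := P.exists_upper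
  have h40 : P.tube (ρ / 4) ⊆ P.tube ρ := P.tube_mono (by linarith)
  -- This gives ‖`eta f x`‖ ≤ ρ/8 < ρ/4, so that the points of Λ_{Φ+f} lie in the narrow tube where
  -- the Taylor estimates hold.
  set ε₁ : ℝ≥0 := ⟨ρ / 16, by positivity⟩ with hε₁
  have hε₁v : (ε₁ : ℝ) = ρ / 16 := rfl
  have hε₁0 : 0 < ε₁ := by rw [← NNReal.coe_pos, hε₁v]; positivity
  have hεle : ((min ε₀ ε₁ : ℝ≥0) : ℝ) ≤ ρ / 16 := by
    rw [← hε₁v]; exact_mod_cast min_le_right _ _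
  refine ⟨min ε₀ ε₁, lt_min hε₀ hε₁0, by linarith, fun a M ha hM hM0 => ?_⟩
  obtain ⟨ht1, ht2, ht3⟩ := htay a M ha hM hM0
  set I₀ := ∫ y : Cn n, Real.exp (-b * ‖y‖) with hI₀
  have hI₀0 : 0 ≤ I₀ := integral_nonneg fun _ => (Real.exp_pos _).le
  set L₁ := A * M * (1 + C + ρ) with hL₁
  have hL₁0 : 0 ≤ L₁ := by positivity
  -- The first summand comes from integrating n first order terms by parts, the second from Young's
  -- inequality for the remainder.
  refine ⟨n * L₁ + D * (A * M) * I₀, by positivity, ?_⟩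
  intro f B hf hB hf1 hf2 h hh h1 u v hu hLu hr hv hLv
  set Φ : Cn n → ℝ := fun x => P.phi x + f x with hΦ
  have hΦc : Continuous Φ := P.continuous_phi.add hf.continuous
  have hfd : Differentiable ℝ f := hf.differentiable one_ne_zero
  have hη := continuous_eta (hf.continuous_fderiv one_ne_zero)
  have hLu2 := (memLp_red_add_iff P.continuous_phi hf.continuous hB hh hu.continuous).2 hLu
  have hLv2 := (memLp_red_add_iff P.continuous_phi hf.continuous hB hh hv.continuous).2 hLv
  have hu' := continuous_fderiv_of_entire hu
  have hv' := continuous_fderiv_of_entire hv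
  -- the points of `Λ_Φ`
  set p : Cn n → Cn n × Cn n := fun x => (x, P.theta x + eta f x) with hp
  have heta : ∀ x, ‖eta f x‖ < ρ / 4 := fun x => by
    have := norm_eta_le f x
    have := hf1 x
    linarith
  have hpm : ∀ x, p x ∈ P.tube (ρ / 4) := fun x => P.mem_tube.2 (heta x)
  have hpL : ∀ x y, ‖p x - p y‖ ≤ (1 + C + ρ) * ‖x - y‖ := by
    intro x y
    have e : (p x - p y).2 = P.theta (x - y) + (eta f x - eta f y) := by
      simp only [hp, Prod.snd_sub, ← thetaL_apply, map_sub]; abel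
    have h2 : ‖eta f x - eta f y‖ ≤ ρ * ‖x - y‖ := by
      have h3 := hf2.dist_le_mul x y
      rw [dist_eq_norm, dist_eq_norm] at h3
      have h4 : ((min ε₀ ε₁ : ℝ≥0) : ℝ) * ‖x - y‖ ≤ ρ / 16 * ‖x - y‖ := by gcongr
      have h5 := norm_eta_sub_le (f := f) (g := f) (x := x) (y := y)
      have h6 : 0 ≤ ρ * ‖x - y‖ := by positivity
      linarith
    have h3 := hCt (x - y)
    have h4 := norm_add_le (P.theta (x - y)) (eta f x - eta f y)
    have h5 : 0 ≤ ρ * ‖x - y‖ := by positivity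
    have h6 : 0 ≤ C * ‖x - y‖ := by positivity
    rw [Prod.norm_def, e]
    refine max_le ?_ ?_
    · simp only [hp, Prod.fst_sub]; linarith
    · linarith [norm_nonneg (x - y)]
  have hpc : Continuous p := by simp only [hp]; fun_prop
  have hapc : Continuous fun x => a (p x) :=
    ha.continuousOn.comp_continuous hpc fun x => h40 (hpm x)
  -- first order coefficients
  set β : Fin n → Cn n → ℂ := fun j x => fderiv ℂ a (p x) (0, Pi.single j 1) with hβ
  have hnorm : ∀ j : Fin n, ‖((0, Pi.single j 1) : Cn n × Cn n)‖ = 1 := fun j => by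
    rw [Prod.norm_def]
    simp only [norm_zero]
    rw [Pi.norm_single, norm_one]
    exact max_eq_right zero_le_one
  have hβb : ∀ j x, ‖β j x‖ ≤ A * M := fun j x => by
    have h2 := (fderiv ℂ a (p x)).le_opNorm (0, Pi.single j 1)
    rw [hnorm, mul_one] at h2
    exact h2.trans (ht1 _ (hpm x))
  have hβL : ∀ j x y, ‖β j x - β j y‖ ≤ L₁ * ‖x - y‖ := fun j x y => by
    have h2 := (fderiv ℂ a (p x) - fderiv ℂ a (p y)).le_opNorm (0, Pi.single j 1)
    rw [hnorm, mul_one, sub_apply] at h2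
    refine h2.trans ((ht2 _ (hpm x) _ (hpm y)).trans ?_)
    rw [hL₁, mul_assoc (A * M)]
    gcongr
    exact hpL x y
  have hβc : ∀ j, Continuous (β j) := fun j => by
    have hL0 : LipschitzWith (Real.toNNReal L₁) (β j) := by
      refine LipschitzWith.of_dist_le_mul fun x y => ?_
      rw [dist_eq_norm, dist_eq_norm, Real.coe_toNNReal _ hL₁0]
      exact hβL j x y
    exact hL0.continuous
  -- remainder
  set rem : Cn n → Cn n × Cn n → ℂ := fun x q =>
    a q - a (p x) - fderiv ℂ a (p x) (q - p x) with hrem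
  have hremd : ∀ x, DifferentiableOn ℂ (rem x) (P.tube (ρ / 4)) := fun x => by
    have h2 : Differentiable ℂ fun q => fderiv ℂ a (p x) (q - p x) := by fun_prop
    exact ((ha.mono h40).sub_const _).sub h2.differentiableOn
  -- The remainder is purely quadratic, so the kernel bound is used with M₀ = 0 and its factor M₀ +
  -- M₁h is O(h).
  have hremb : ∀ x, ∀ q ∈ P.tube (ρ / 4), ‖rem x q‖ ≤
      0 + A * M * (‖q.1 - x‖ + ‖q.2 - P.theta x - eta f x‖) ^ 2 := by
    intro x q hq
    rw [zero_add]
    refine (ht3 _ (hpm x) q hq).trans ?_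
    gcongr
    rw [Prod.norm_def]
    have e : (q - p x).2 = q.2 - P.theta x - eta f x := by
      simp only [hp, Prod.snd_sub]; abel
    rw [e]
    exact max_le (le_add_of_nonneg_right (norm_nonneg _)) (le_add_of_nonneg_left (norm_nonneg _))
  set K : Cn n → Cn n → ℂ := fun x w =>
    P.wconst h * P.gconst h * P.ker h (rem x) (eta f x) x w with hK
  have hKb : ∀ x w, ‖K x w * u w‖ ≤ Real.exp (Φ x / h) *
      (convKer (D * (0 + A * M * h)) b h (x - w) * ‖red Φ h u w‖) := fun x w =>
    hker f hfd (fun x => (hf1 x).trans (by exact_mod_cast min_le_left _ _))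
      (hf2.weaken (min_le_left _ _)) h hh h1 (rem x) (hremd x) 0 (A * M) le_rfl (by positivity)
      x (hremb x) u w
  have hKi : ∀ x, Integrable fun w => K x w * u w := fun x =>
    ((integrable_convKer_mul hb hh x hLu2).const_mul (Real.exp (Φ x / h))).mono'
      (((P.aestronglyMeasurable_ker (by positivity) (hremd x).continuousOn (eta f x) x).const_mul
        _).mul hu.continuous.aestronglyMeasurable)
      (Filter.Eventually.of_forall fun w => hKb x w)
  set R : Cn n → ℂ := fun x => ∫ w, K x w * u w with hR
  -- The operator is defined with η = 0 and expanded with η = `eta f x`; both represent the same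
  -- Weyl integral, because on rapidly decaying u the twist changes nothing.
  have hexp : ∀ x, P.weylOp h a u x = a (p x) * u x + (-Complex.I) *
      ∑ j, β j x * P.jet h (eta f x) u (Pi.single j 1) x + R x := by
    intro x
    rw [weylOp, ← P.weylIntegral_eq_kernel hh hρ ha.continuousOn hM 0 hu hLu hr x]
    exact P.weylIntegral_expansion hh (ρ := ρ / 4) (by positivity) (ha.continuousOn.mono h40)
      (fun q hq => hM q (h40 hq)) (eta f x) x (fderiv ℂ a (p x)) hu hLu hr (hKi x)
  have hRL : eLpNorm (red Φ h R) 2 volume ≤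
      ENNReal.ofReal (D * (0 + A * M * h) * I₀) * eLpNorm (red Φ h u) 2 volume := by
    have hD0 : 0 ≤ D * (0 + A * M * h) := by positivity
    rw [hI₀, ← lintegral_convKer hD0 hb hh]
    exact eLpNorm_red_le (measurable_convKer _ b h) (convKer_nonneg hD0 hh) (fun x => rfl) hLu2 hKb
  have hjc := fun j : Fin n => P.continuous_jet (h := h) hη hu hu' (Pi.single j 1)
  have hRc : Continuous R := by
    have e : R = fun x => P.weylOp h a u x - (a (p x) * u x + (-Complex.I) *
        ∑ j, β j x * P.jet h (eta f x) u (Pi.single j 1) x) := by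
      ext x; rw [hexp x]; ring
    rw [e]
    have h2 := (P.differentiable_weylOp hh h1 hρ ha hM hM0 hLu).continuous
    refine h2.sub ((hapc.mul hu.continuous).add (continuous_const.mul ?_))
    exact continuous_finsetSum _ fun j _ => (hβc j).mul (hjc j)
  have hRm : MemLp (red Φ h R) 2 volume := ⟨(continuous_red hΦc hRc).aestronglyMeasurable,
    hRL.trans_lt (ENNReal.mul_lt_top ENNReal.ofReal_lt_top hLu2.2)⟩
  have hrv := continuous_red (h := h) hΦc hv.continuous
  have hjm := fun j : Fin n => P.memLp_red_jet_eta hf hB hf1 hh hu hu' hLu (Pi.single j 1)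
  have hji : ∀ j : Fin n, Integrable fun x => β j x *
      (red Φ h (fun x => P.jet h (eta f x) u (Pi.single j 1) x) x * conj (red Φ h v x)) := by
    intro j
    refine Integrable.bdd_mul ?_ (hβc j).aestronglyMeasurable
      (Filter.Eventually.of_forall (hβb j))
    refine (integrable_norm_mul (hjm j) hLv2).mono' (Continuous.aestronglyMeasurable ?_)
      (Filter.Eventually.of_forall fun x => ?_)
    · exact (continuous_red hΦc (hjc j)).mul (Complex.continuous_conj.comp hrv)
    · rw [norm_mul, RCLike.norm_conj]
  have hRi : Integrable fun x => red Φ h R x * conj (red Φ h v x) := by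
    refine (integrable_norm_mul hRm hLv2).mono' (Continuous.aestronglyMeasurable ?_)
      (Filter.Eventually.of_forall fun x => ?_)
    · exact (continuous_red hΦc hRc).mul (Complex.continuous_conj.comp hrv)
    · rw [norm_mul, RCLike.norm_conj]
  have hpt : ∀ x, red Φ h (P.weylOp h a u) x * conj (red Φ h v x) -
      a (p x) * (red Φ h u x * conj (red Φ h v x)) =
      (∑ j, (-Complex.I) * (β j x * (red Φ h (fun x => P.jet h (eta f x) u (Pi.single j 1) x) x *
        conj (red Φ h v x)))) + red Φ h R x * conj (red Φ h v x) := by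
    intro x
    simp only [red, hexp x, ← Finset.mul_sum]
    have : ∑ j, β j x * (P.jet h (eta f x) u (Pi.single j 1) x * (Real.exp (-Φ x / h) : ℂ) *
        conj (v x * (Real.exp (-Φ x / h) : ℂ))) =
        (∑ j, β j x * P.jet h (eta f x) u (Pi.single j 1) x) * ((Real.exp (-Φ x / h) : ℂ) *
        conj (v x * (Real.exp (-Φ x / h) : ℂ))) := by
      rw [Finset.sum_mul]
      exact Finset.sum_congr rfl fun j _ => by ring
    rw [this]
    ring
  set N := (eLpNorm (red Φ h u) 2 volume).toReal * (eLpNorm (red Φ h v) 2 volume).toReal with hN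
  change ‖∫ x, (red Φ h (P.weylOp h a u) x * conj (red Φ h v x) -
      a (p x) * (red Φ h u x * conj (red Φ h v x)))‖ ≤ _
  simp only [hpt]
  rw [integral_add (integrable_finsetSum _ fun j _ => (hji j).const_mul _) hRi,
    integral_finsetSum _ fun j _ => (hji j).const_mul _]
  have hb1 : ‖∑ j, ∫ x, (-Complex.I) * (β j x * (red Φ h (fun x => P.jet h (eta f x) u
      (Pi.single j 1) x) x * conj (red Φ h v x)))‖ ≤ n * (h * L₁ * N) := by
    refine (norm_sum_le _ _).trans ?_
    calc _ ≤ ∑ _j : Fin n, h * L₁ * N := by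
          refine Finset.sum_le_sum fun j _ => ?_
          rw [integral_const_mul, norm_mul, norm_neg, Complex.norm_I, one_mul]
          exact P.norm_integral_jet_le hf hB hf1 hh hu hu' hLu hv hv' hLv hL₁0 (hβb j) (hβL j) j
      _ = _ := by simp
  have hb2 : ‖∫ x, red Φ h R x * conj (red Φ h v x)‖ ≤ D * (A * M * h) * I₀ * N := by
    refine (norm_integral_le_integral_norm _).trans ?_
    simp only [norm_mul, RCLike.norm_conj]
    refine (norm_integral_mul_le hRm hLv2).trans ?_
    have h2 := ENNReal.toReal_mono (ENNReal.mul_ne_top ENNReal.ofReal_ne_top hLu2.2.ne) hRL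
    rw [ENNReal.toReal_mul, ENNReal.toReal_ofReal (by positivity), zero_add] at h2
    calc _ ≤ (D * (A * M * h) * I₀ * (eLpNorm (red Φ h u) 2 volume).toReal) *
          (eLpNorm (red Φ h v) 2 volume).toReal := by gcongr
      _ = _ := by rw [hN]; ring
  refine (norm_add_le _ _).trans ((add_le_add hb1 hb2).trans (le_of_eq ?_))
  ring

end Weight

/-! ### Extension to all of H_Φ and the final statement -/

namespace Weight
variable (P : Weight n)

lemma Lam_phi : Lam P.phi = Set.range fun x => (x, P.theta x) := by
  unfold Lam; simp only [xi_phi]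

lemma exists_tube_subset {W : Set (Cn n × Cn n)} (hWo : IsOpen W) (hW0 : (0 : Cn n × Cn n) ∈ W) :
    ∃ ρ : ℝ, 0 < ρ ∧ P.tube ρ ⊆ Lam P.phi + W := by
  obtain ⟨ρ, hρ, hball⟩ := Metric.isOpen_iff.1 hWo 0 hW0
  refine ⟨ρ, hρ, fun p hp => ?_⟩
  have hp' : ‖p.2 - P.theta p.1‖ < ρ := hp
  rw [Lam_phi]
  refine Set.mem_add.2 ⟨(p.1, P.theta p.1), ⟨p.1, rfl⟩, (0, p.2 - P.theta p.1), hball ?_, ?_⟩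
  · rw [mem_ball_zero_iff, Prod.norm_def]
    simpa using hp'
  · ext1 <;> simp

lemma Lam_add_subset_tube {ρ : ℝ} {ε : ℝ≥0} (hε : (2 * ε : ℝ) < ρ) {f : Cn n → ℝ}
    (hf : Differentiable ℝ f) (hf1 : ∀ x, ‖fderiv ℝ f x‖ ≤ ε) :
    Lam (fun x => P.phi x + f x) ⊆ P.tube ρ := by
  rintro _ ⟨x, rfl⟩
  simp only
  rw [P.xi_phi_add (hf x), mem_tube]
  have := norm_eta_le f x
  have := hf1 x
  linarith

end Weight

lemma integrable_mul_conj {p q : Cn n → ℂ} (hp : MemLp p 2 volume) (hq : MemLp q 2 volume) :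
    Integrable fun x => p x * conj (q x) :=
  MemLp.integrable_mul hp hq.star

lemma norm_integral_mul_conj_le {p q : Cn n → ℂ} (hp : MemLp p 2 volume)
    (hq : MemLp q 2 volume) : ‖∫ x, p x * conj (q x)‖ ≤
      (eLpNorm p 2 volume).toReal * (eLpNorm q 2 volume).toReal := by
  refine (norm_integral_le_integral_norm _).trans ?_
  simp only [norm_mul, RCLike.norm_conj]
  exact norm_integral_mul_le hp hq

namespace Weight
variable (P : Weight n)

/-- Quantization versus multiplication on `H_φ`, measured in the perturbed weight. -/
theorem quantization_vs_multiplication {ρ : ℝ} (hρ : 0 < ρ) :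
    ∃ ε : ℝ≥0, 0 < ε ∧ (2 * ε : ℝ) < ρ ∧
    ∀ (a : Cn n × Cn n → ℂ) (M : ℝ), DifferentiableOn ℂ a (P.tube ρ) →
      (∀ p ∈ P.tube ρ, ‖a p‖ ≤ M) → 0 ≤ M → ∃ K : ℝ, ∀ (f : Cn n → ℝ) (B : ℝ),
      ContDiff ℝ 1 f → (∀ x, |f x| ≤ B) → (∀ x, ‖fderiv ℝ f x‖ ≤ ε) →
      LipschitzWith ε (fderiv ℝ f) → ∀ h : ℝ, 0 < h → h ≤ 1 →
      ∀ T : HSpace P.phi h →ₗ[ℂ] HSpace P.phi h, IsWeylQuantization P.phi h a T →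
      ∀ u v : HSpace P.phi h,
        ‖wInner (fun x => P.phi x + f x) h (T u : Cn n → ℂ) (v : Cn n → ℂ) -
          ∫ x, a (x, xi (fun x => P.phi x + f x) x) * (u : Cn n → ℂ) x *
            conj ((v : Cn n → ℂ) x) ∂(wMeasure (fun x => P.phi x + f x) h)‖ ≤
          K * h * wNorm (fun x => P.phi x + f x) h (u : Cn n → ℂ) *
            wNorm (fun x => P.phi x + f x) h (v : Cn n → ℂ) := by
  obtain ⟨ε, hε, hερ, hmain⟩ := P.exists_main_estimate hρ
  refine ⟨ε, hε, hερ, fun a M ha hM hM0 => ?_⟩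
  obtain ⟨K, hK0, hK⟩ := hmain a M ha hM hM0
  refine ⟨K, ?_⟩
  intro f B hf hB hf1 hf2 h hh h1 T hT u v
  set Φ : Cn n → ℝ := fun x => P.phi x + f x with hΦ
  have hΦc : Continuous Φ := P.continuous_phi.add hf.continuous
  have hfd : Differentiable ℝ f := hf.differentiable one_ne_zero
  have hη := continuous_eta (hf.continuous_fderiv one_ne_zero)
  have hLp : ∀ w : HSpace P.phi h, MemLp (red Φ h (w : Cn n → ℂ)) 2 volume := fun w =>
    (memLp_red_add_iff P.continuous_phi hf.continuous hB hh
      (differentiable_coe w).continuous).2 (memLp_red_coe P.continuous_phi w)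
  have hmem : ∀ x, (x, P.theta x + eta f x) ∈ P.tube ρ := fun x => by
    have := P.Lam_add_subset_tube hερ hfd hf1 ⟨x, rfl⟩
    simpa only [P.xi_phi_add (hfd x)] using this
  have hac : Continuous fun x => a (x, P.theta x + eta f x) :=
    ha.continuousOn.comp_continuous (by fun_prop) hmem
  have hab : ∀ x, ‖a (x, P.theta x + eta f x)‖ ≤ M := fun x => hM _ (hmem x)
  set N : HSpace P.phi h → ℝ := fun w => (eLpNorm (red Φ h (w : Cn n → ℂ)) 2 volume).toReal with hN
  have hN0 : ∀ w, 0 ≤ N w := fun w => ENNReal.toReal_nonneg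
  have hi1 : ∀ w : HSpace P.phi h, Integrable fun x =>
      red Φ h (T w : Cn n → ℂ) x * conj (red Φ h (v : Cn n → ℂ) x) := fun w =>
    integrable_mul_conj (hLp _) (hLp _)
  have hi2 : ∀ w : HSpace P.phi h, Integrable fun x => a (x, P.theta x + eta f x) *
      (red Φ h (w : Cn n → ℂ) x * conj (red Φ h (v : Cn n → ℂ) x)) := fun w =>
    (integrable_mul_conj (hLp _) (hLp _)).bdd_mul hac.aestronglyMeasurable
      (Filter.Eventually.of_forall hab)
  set D : HSpace P.phi h → ℂ := fun w => ∫ x, (red Φ h (T w : Cn n → ℂ) x *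
    conj (red Φ h (v : Cn n → ℂ) x) - a (x, P.theta x + eta f x) *
      (red Φ h (w : Cn n → ℂ) x * conj (red Φ h (v : Cn n → ℂ) x))) with hD
  have hgoal : wInner Φ h (T u : Cn n → ℂ) (v : Cn n → ℂ) -
      ∫ x, a (x, xi Φ x) * (u : Cn n → ℂ) x * conj ((v : Cn n → ℂ) x) ∂(wMeasure Φ h) = D u := by
    simp only [hD]
    rw [integral_sub (hi1 u) (hi2 u), wInner_eq hΦc, integral_wMeasure hΦc]
    congr 1
    refine integral_congr_ae (Filter.Eventually.of_forall fun x => ?_)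
    simp only
    rw [hΦ, P.xi_phi_add (hfd x)]
    simp only [red, exp_two, map_mul, Complex.conj_ofReal, Complex.real_smul]
    push_cast; ring
  rw [hgoal, wNorm_eq hΦc h (hLp u), wNorm_eq hΦc h (hLp v)]
  change ‖D u‖ ≤ K * h * N u * N v
  have hrapid : ∀ w : HSpace P.phi h, RapidDecay P.phi h (w : Cn n → ℂ) →
      ‖D w‖ ≤ K * h * N v * N w := by
    intro w hw
    have hTw : (T w : Cn n → ℂ) = P.weylOp h a w := by
      ext x
      rw [hT.2 w hw x, P.weylIntegral_eq_kernel hh hρ ha.continuousOn hM 0 (differentiable_coe w)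
        (memLp_red_coe P.continuous_phi w) hw x, weylOp]
    have := hK f B hf hB hf1 hf2 h hh h1 w v (differentiable_coe w)
      (memLp_red_coe P.continuous_phi w) hw (differentiable_coe v)
      (memLp_red_coe P.continuous_phi v)
    simp only [hD, hTw]
    refine this.trans (le_of_eq ?_)
    simp only [hN]
    ring
  obtain ⟨C, hC, hCT⟩ := exists_eLpNorm_le_of_wNorm_le P.continuous_phi hT.1
  obtain ⟨C', hC', hCf⟩ := exists_eLpNorm_red_le P.phi hB hh
  have hNle : ∀ w : HSpace P.phi h, N w ≤
      C' * (eLpNorm (red P.phi h (w : Cn n → ℂ)) 2 volume).toReal := fun w => by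
    have h2 := ENNReal.toReal_mono (ENNReal.mul_ne_top ENNReal.ofReal_ne_top
      (memLp_red_coe P.continuous_phi w).2.ne) (hCf w)
    rwa [ENNReal.toReal_mul, ENNReal.toReal_ofReal hC'] at h2
  have hTle : ∀ w : HSpace P.phi h, (eLpNorm (red P.phi h (T w : Cn n → ℂ)) 2 volume).toReal ≤
      C * (eLpNorm (red P.phi h (w : Cn n → ℂ)) 2 volume).toReal := fun w => by
    have h2 := ENNReal.toReal_mono (ENNReal.mul_ne_top ENNReal.ofReal_ne_top
      (memLp_red_coe P.continuous_phi w).2.ne) (hCT w)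
    rwa [ENNReal.toReal_mul, ENNReal.toReal_ofReal hC] at h2
  -- This bound has no factor h, and its constants depend on T, h and sup |f|; it is applied only to
  -- the approximation error u - V, which tends to zero.
  have hcrude : ∀ w : HSpace P.phi h, ‖D w‖ ≤ (C' * C + M * C') * N v *
      (eLpNorm (red P.phi h (w : Cn n → ℂ)) 2 volume).toReal := by
    intro w
    set m := (eLpNorm (red P.phi h (w : Cn n → ℂ)) 2 volume).toReal with hm
    have e1 : ‖∫ x, red Φ h (T w : Cn n → ℂ) x * conj (red Φ h (v : Cn n → ℂ) x)‖ ≤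
        C' * (C * m) * N v := by
      refine (norm_integral_mul_conj_le (hLp _) (hLp _)).trans ?_
      refine mul_le_mul_of_nonneg_right ((hNle (T w)).trans ?_) (hN0 v)
      exact mul_le_mul_of_nonneg_left (hTle w) hC'
    have e2 : ‖∫ x, a (x, P.theta x + eta f x) * (red Φ h (w : Cn n → ℂ) x *
        conj (red Φ h (v : Cn n → ℂ) x))‖ ≤ M * (C' * m * N v) := by
      refine (norm_integral_le_of_norm_le
        ((integrable_norm_mul (hLp w) (hLp v)).const_mul M)
        (Filter.Eventually.of_forall fun x => ?_)).trans ?_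
      · rw [norm_mul, norm_mul, RCLike.norm_conj]
        gcongr
        exact hab x
      · rw [integral_const_mul]
        refine mul_le_mul_of_nonneg_left ((norm_integral_mul_le (hLp w) (hLp v)).trans ?_) hM0
        exact mul_le_mul_of_nonneg_right (hNle w) (hN0 v)
    simp only [hD]
    rw [integral_sub (hi1 w) (hi2 w)]
    refine (norm_sub_le _ _).trans ((add_le_add e1 e2).trans (le_of_eq ?_))
    ring
  have hDsub : ∀ w w' : HSpace P.phi h, D w = D w' + D (w - w') := by
    intro w w'
    simp only [hD]
    have hi : ∀ z : HSpace P.phi h, Integrable fun x => red Φ h (T z : Cn n → ℂ) x *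
        conj (red Φ h (v : Cn n → ℂ) x) - a (x, P.theta x + eta f x) *
          (red Φ h (z : Cn n → ℂ) x * conj (red Φ h (v : Cn n → ℂ) x)) := fun z =>
      (hi1 z).sub (hi2 z)
    rw [← integral_add (hi w') (hi (w - w'))]
    refine integral_congr_ae (Filter.Eventually.of_forall fun x => ?_)
    simp only [map_sub, Submodule.coe_sub, red_sub, Pi.sub_apply]
    ring
  -- Q collects every coefficient of the approximation error m: one from replacing N u by N V, one
  -- from the crude bound. V is then chosen so close to u that Q·m ≤ τ.
  set Q := K * h * N v * C' + (C' * C + M * C') * N v with hQ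
  have hQ0 : 0 ≤ Q := by have := hN0 v; positivity
  refine le_of_forall_pos_le_add fun τ hτ => ?_
  obtain ⟨w, hw1, hw2, hw3, hw4⟩ := P.exists_rapidDecay_approx hh (differentiable_coe u)
    (memLp_red_coe P.continuous_phi u) (δ := ENNReal.ofReal (τ / (Q + 1)))
    (by have : 0 < τ / (Q + 1) := by positivity
        simpa using this)
  set V : HSpace P.phi h := ⟨w, (mem_HSpace_iff P.continuous_phi h).2 ⟨hw1, hw2⟩⟩ with hV
  set m := (eLpNorm (red P.phi h ((u - V : HSpace P.phi h) : Cn n → ℂ)) 2 volume).toReal with hm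
  have hmle : m ≤ τ / (Q + 1) := by
    have : eLpNorm (red P.phi h ((u - V : HSpace P.phi h) : Cn n → ℂ)) 2 volume ≤
      ENNReal.ofReal (τ / (Q + 1)) := hw4
    have h2 := ENNReal.toReal_mono ENNReal.ofReal_ne_top this
    rwa [ENNReal.toReal_ofReal (by positivity)] at h2
  have hm0 : 0 ≤ m := ENNReal.toReal_nonneg
  have hNV : N V ≤ N u + C' * m := by
    have e : red Φ h (V : Cn n → ℂ) = red Φ h (u : Cn n → ℂ) -
        red Φ h ((u - V : HSpace P.phi h) : Cn n → ℂ) := by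
      rw [← red_sub]; congr 1; rw [Submodule.coe_sub]; abel
    have h2 := ENNReal.toReal_mono (ENNReal.add_ne_top.2 ⟨(hLp u).2.ne, (hLp (u - V)).2.ne⟩)
      (eLpNorm_sub_le (hLp u).1 (hLp (u - V)).1 (p := 2) (by norm_num))
    rw [← e, ENNReal.toReal_add (hLp u).2.ne (hLp (u - V)).2.ne] at h2
    exact h2.trans (by linarith [hNle (u - V)])
  have hKN : 0 ≤ K * h * N v := by have := hN0 v; positivity
  calc ‖D u‖ ≤ ‖D V‖ + ‖D (u - V)‖ := by rw [hDsub u V]; exact norm_add_le _ _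
    _ ≤ K * h * N v * (N u + C' * m) + (C' * C + M * C') * N v * m := by
        refine add_le_add ((hrapid V hw3).trans ?_) (hcrude _)
        exact mul_le_mul_of_nonneg_left hNV hKN
    _ = K * h * N u * N v + Q * m := by rw [hQ]; ring
    _ ≤ K * h * N u * N v + τ := by
        gcongr
        calc Q * m ≤ (Q + 1) * (τ / (Q + 1)) := by gcongr; linarith
          _ = τ := by field_simp

/-- The quantization theorem for the quadratic weight `P.phi`. -/
theorem exists_eps_quantization {W : Set (Cn n × Cn n)} (hWo : IsOpen W)
    (hW0 : (0 : Cn n × Cn n) ∈ W) :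
    ∃ ε : ℝ≥0, 0 < ε ∧
      ∀ a : Cn n × Cn n → ℂ,
        DifferentiableOn ℂ a (Lam P.phi + W) →
        (∃ M : ℝ, ∀ p ∈ Lam P.phi + W, ‖a p‖ ≤ M) →
        (∀ h : ℝ, 0 < h → h ≤ 1 →
          ∃! T : HSpace P.phi h →ₗ[ℂ] HSpace P.phi h, IsWeylQuantization P.phi h a T) ∧
        ∃ K : ℝ, ∀ f : Cn n → ℝ,
          ContDiff ℝ 1 f → HasCompactSupport f →
          (∀ x, ‖fderiv ℝ f x‖ ≤ ε) → LipschitzWith ε (fderiv ℝ f) →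
          Lam (fun x => P.phi x + f x) ⊆ Lam P.phi + W ∧
          ∀ h : ℝ, 0 < h → h ≤ 1 →
            HSpace (fun x => P.phi x + f x) h = HSpace P.phi h ∧
            ∀ T : HSpace P.phi h →ₗ[ℂ] HSpace P.phi h, IsWeylQuantization P.phi h a T →
              ∀ u v : HSpace P.phi h,
                ‖wInner (fun x => P.phi x + f x) h (T u : Cn n → ℂ) (v : Cn n → ℂ) -
                  ∫ x, a (x, xi (fun x => P.phi x + f x) x) * (u : Cn n → ℂ) x *
                    conj ((v : Cn n → ℂ) x) ∂(wMeasure (fun x => P.phi x + f x) h)‖ ≤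
                  K * h * wNorm (fun x => P.phi x + f x) h (u : Cn n → ℂ) *
                    wNorm (fun x => P.phi x + f x) h (v : Cn n → ℂ) := by
  obtain ⟨ρ, hρ, hsub⟩ := P.exists_tube_subset hWo hW0
  obtain ⟨ε, hε, hερ, hquant⟩ := P.quantization_vs_multiplication hρ
  refine ⟨ε, hε, fun a ha hbd => ?_⟩
  obtain ⟨M, hM⟩ := hbd
  have ha' := ha.mono hsub
  have hM' : ∀ p ∈ P.tube ρ, ‖a p‖ ≤ |M| := fun p hp => (hM p (hsub hp)).trans (le_abs_self M)
  obtain ⟨K, hK⟩ := hquant a |M| ha' hM' (abs_nonneg M)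
  refine ⟨fun h hh h1 => ?_, K, fun f hf hfc hf1 hf2 => ⟨?_, fun h hh h1 => ?_⟩⟩
  · obtain ⟨T, hT⟩ := P.exists_isWeylQuantization hh h1 hρ ha' hM' (abs_nonneg M)
    exact ⟨T, hT, fun T' hT' => P.isWeylQuantization_unique hh hT' hT⟩
  · exact (P.Lam_add_subset_tube hερ (hf.differentiable one_ne_zero) hf1).trans hsub
  · obtain ⟨B, hB⟩ := hfc.exists_bound_of_continuous hf.continuous
    exact ⟨HSpace_add_eq P.continuous_phi hf.continuous hB hh,
      hK f B hf hB hf1 hf2 h hh h1⟩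

end Weight

end FBI

end

theorem proposition1p4p4 (n : ℕ) (Φ : QuadraticForm ℝ (FBI.Cn n))
    (hΦ : FBI.StrictlyPlurisubharmonic Φ)
    (W : Set (FBI.Cn n × FBI.Cn n)) (hWo : IsOpen W) (hWb : Bornology.IsBounded W)
    (hW0 : (0 : FBI.Cn n × FBI.Cn n) ∈ W) :
    ∃ ε : ℝ≥0, 0 < ε ∧
      ∀ a : FBI.Cn n × FBI.Cn n → ℂ,
        DifferentiableOn ℂ a (FBI.Lam Φ + W) →
        (∃ M : ℝ, ∀ p ∈ FBI.Lam Φ + W, ‖a p‖ ≤ M) →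
        (∀ h : ℝ, 0 < h → h ≤ 1 →
          ∃! T : FBI.HSpace Φ h →ₗ[ℂ] FBI.HSpace Φ h, FBI.IsWeylQuantization Φ h a T) ∧
        ∃ K : ℝ, ∀ f : FBI.Cn n → ℝ,
          ContDiff ℝ 1 f → HasCompactSupport f →
          (∀ x, ‖fderiv ℝ f x‖ ≤ ε) → LipschitzWith ε (fderiv ℝ f) →
          FBI.Lam (fun x => Φ x + f x) ⊆ FBI.Lam Φ + W ∧
          ∀ h : ℝ, 0 < h → h ≤ 1 →
            FBI.HSpace (fun x => Φ x + f x) h = FBI.HSpace Φ h ∧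
            ∀ T : FBI.HSpace Φ h →ₗ[ℂ] FBI.HSpace Φ h, FBI.IsWeylQuantization Φ h a T →
              ∀ u v : FBI.HSpace Φ h,
                ‖FBI.wInner (fun x => Φ x + f x) h (T u : FBI.Cn n → ℂ) (v : FBI.Cn n → ℂ) -
                  ∫ x, a (x, FBI.xi (fun x => Φ x + f x) x) * (u : FBI.Cn n → ℂ) x *
                    conj ((v : FBI.Cn n → ℂ) x) ∂(FBI.wMeasure (fun x => Φ x + f x) h)‖ ≤
                  K * h * FBI.wNorm (fun x => Φ x + f x) h (u : FBI.Cn n → ℂ) *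
                    FBI.wNorm (fun x => Φ x + f x) h (v : FBI.Cn n → ℂ) := by
  obtain ⟨P, hP⟩ := FBI.exists_weight Φ hΦ
  have e : (Φ : FBI.Cn n → ℝ) = P.phi := funext hP
  have h := P.exists_eps_quantization hWo hW0
  rw [← e] at h
  exact h
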